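/- A clique covering (respectively, clique partition) of a finite graph $G$ is a collection $\mathcal{C}$ of cliques (vertex sets of complete subgraphs) of $G$ such that every edge of $G$ is contained in at least one (respectively, exactly one) member of $\mathcal{C}$. View $\mathcal{C}$ as a hypergraph with vertex set $V(G)$ and edge set $\mathcal{C}$, let $\Delta(\mathcal{C})$ be its maximum degree (the largest number of members of $\mathcal{C}$ containing a common vertex), and let $\chi'(\mathcal{C})$ be its chromatic index (the least number of colors in a coloring of the members of $\mathcal{C}$ in which any two distinct intersecting members receive different colors). Put $$\mathrm{cc}_\Delta(G)=\min_{\mathcal{C}}\Delta(\mathcal{C}),\qquad \mathrm{cc}'(G)=\min_{\mathcal{C}}\chi'(\mathcal{C}),\qquad \mathrm{cp}'(G)=\min_{\mathcal{P}}\chi'(\mathcal{P}),$$ where $\mathcal{C}$ ranges over all clique coverings of $G$ and $\mathcal{P}$ over all clique partitions of $G$. Let $G_{n,p}$ be the binomial random graph on $n$ labelled vertices, in which each of the $\binom n2$ possible edges is present independently with probability $p$. **Theorem.** There is an absolute constant $c>0$ such that for every real $\gamma\in(0,1)$ there is a constant $C=C(\gamma)>0$ with the following property. If $p=p(n)\in[0,1]$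 satisfies $\frac{\log n}{n}=o(p(n))$ as $n\to\infty$ and $p(n)\le 1-\gamma$ for all sufficiently large $n$, then with probability tending to $1$ as $n\to\infty$ $$c\,\frac{np}{\log_{1/p} n}\;\le\;\mathrm{cc}_\Delta(G_{n,p})\;\le\;\mathrm{cc}'(G_{n,p})\;\le\;\mathrm{cp}'(G_{n,p})\;\le\;C\,\frac{np}{\log_{1/p} n}.$$ In particular (taking $p\in(0,1)$ constant), the clique-covering chromatic index of $G_{n,p}$ is with high probability of order $\Theta(n/\log n)$, as conjectured by Füredi and Kantor. -/

import Mathlib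

open Filter Topology Asymptotics

/-! A finite hypergraph on the vertex set `V` is given by its edge set `H : Finset (Finset V)`. -/

namespace HypergraphParam

/-- The degree of `v` in the hypergraph `H`: the number of edges containing `v`. -/
def degree {V : Type*} [DecidableEq V] (H : Finset (Finset V)) (v : V) : ℕ :=
  (H.filter (fun e => v ∈ e)).card

/-- The maximum degree `Δ(H)`. -/
def maxDegree {V : Type*} [Fintype V] [DecidableEq V] (H : Finset (Finset V)) : ℕ :=
  Finset.univ.sup (degree H)

/-- `f` is a proper colouring of the edges of `H` with colours `0, …, k - 1`:
distinct intersecting edges receive distinct colours. -/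
def IsProperEdgeColoring {V : Type*} [DecidableEq V] (H : Finset (Finset V)) (k : ℕ)
    (f : Finset V → ℕ) : Prop :=
  (∀ e ∈ H, f e < k) ∧
    ∀ e ∈ H, ∀ e' ∈ H, e ≠ e' → (e ∩ e').Nonempty → f e ≠ f e'

/-- The chromatic index `χ'(H)`: the least number of colours in a proper edge colouring. -/
noncomputable def chromaticIndex {V : Type*} [DecidableEq V] (H : Finset (Finset V)) : ℕ :=
  sInf {k : ℕ | ∃ f : Finset V → ℕ, IsProperEdgeColoring H k f}

/-- The set in the definition of `chromaticIndex` is never empty. -/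
theorem exists_isProperEdgeColoring {V : Type*} [DecidableEq V] (H : Finset (Finset V)) :
    {k : ℕ | ∃ f : Finset V → ℕ, IsProperEdgeColoring H k f}.Nonempty := by
  refine ⟨H.card, fun e => if h : e ∈ H then (H.equivFin ⟨e, h⟩ : ℕ) else 0, ?_, ?_⟩
  · intro e he
    simp [he]
  · intro e he e' he' hne _ heq
    simp only [he, he', dif_pos] at heq
    have h := H.equivFin.injective (Fin.ext heq)
    exact hne (congrArg Subtype.val h)

end HypergraphParam

namespace SimpleGraph

/-- `C` is a clique covering of (the edges of) `G`: a collection of cliques of `G` such that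
each edge of `G` lies in at least one of them. -/
def IsCliqueCovering {V : Type*} (G : SimpleGraph V) (C : Finset (Finset V)) : Prop :=
  (∀ K ∈ C, G.IsClique (K : Set V)) ∧ ∀ u v, G.Adj u v → ∃ K ∈ C, u ∈ K ∧ v ∈ K

/-- `C` is a clique partition of (the edges of) `G`: a collection of cliques of `G` such that
each edge of `G` lies in exactly one of them. -/
def IsCliquePartition {V : Type*} (G : SimpleGraph V) (C : Finset (Finset V)) : Prop :=
  (∀ K ∈ C, G.IsClique (K : Set V)) ∧ ∀ u v, G.Adj u v → ∃! K, K ∈ C ∧ u ∈ K ∧ v ∈ K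

theorem IsCliquePartition.isCliqueCovering {V : Type*} {G : SimpleGraph V}
    {C : Finset (Finset V)} (h : G.IsCliquePartition C) : G.IsCliqueCovering C :=
  ⟨h.1, fun u v huv => by
    obtain ⟨K, ⟨hK, hu, hv⟩, _⟩ := h.2 u v huv
    exact ⟨K, hK, hu, hv⟩⟩

/-- Every finite graph has a clique partition (and hence a clique covering), namely into its
single edges; so the minima below are over nonempty sets. -/
theorem exists_isCliquePartition {V : Type*} [Fintype V] [DecidableEq V] (G : SimpleGraph V) :
    ∃ C : Finset (Finset V), G.IsCliquePartition C := by
  classical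
  refine ⟨Finset.univ.filter (fun K => ∃ u v, G.Adj u v ∧ K = {u, v}), ?_, ?_⟩
  · intro K hK
    obtain ⟨u, v, huv, rfl⟩ := (Finset.mem_filter.mp hK).2
    intro x hx y hy hxy
    simp only [Finset.coe_insert, Finset.coe_singleton, Set.mem_insert_iff,
      Set.mem_singleton_iff] at hx hy
    rcases hx with rfl | rfl <;> rcases hy with rfl | rfl
    · exact absurd rfl hxy
    · exact huv
    · exact huv.symm
    · exact absurd rfl hxy
  · intro u v huv
    refine ⟨{u, v}, ⟨by simp only [Finset.mem_filter, Finset.mem_univ, true_and]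
                        exact ⟨u, v, huv, rfl⟩, by simp, by simp⟩, ?_⟩
    rintro K ⟨hK, hu, hv⟩
    obtain ⟨a, b, hab, rfl⟩ := (Finset.mem_filter.mp hK).2
    have hne := huv.ne
    simp only [Finset.mem_insert, Finset.mem_singleton] at hu hv
    rcases hu with rfl | rfl <;> rcases hv with rfl | rfl
    · exact absurd rfl hne
    · rfl
    · exact Finset.pair_comm _ _
    · exact absurd rfl hne

/-- The clique covering thickness of `G`: the minimum of `Δ(C)` over all clique coverings. -/
noncomputable def cliqueCoveringThickness {V : Type*} [Fintype V] [DecidableEq V]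
    (G : SimpleGraph V) : ℕ :=
  sInf {t : ℕ | ∃ C : Finset (Finset V),
    G.IsCliqueCovering C ∧ HypergraphParam.maxDegree C = t}

/-- The clique covering chromatic index of `G`: the minimum of `χ'(C)` over all clique
coverings. -/
noncomputable def cliqueCoveringChromaticIndex {V : Type*} [DecidableEq V]
    (G : SimpleGraph V) : ℕ :=
  sInf {t : ℕ | ∃ C : Finset (Finset V),
    G.IsCliqueCovering C ∧ HypergraphParam.chromaticIndex C = t}

/-- The clique partition chromatic index of `G`: the minimum of `χ'(C)` over all clique
partitions. -/
noncomputable def cliquePartitionChromaticIndex {V : Type*} [DecidableEq V]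
    (G : SimpleGraph V) : ℕ :=
  sInf {t : ℕ | ∃ C : Finset (Finset V),
    G.IsCliquePartition C ∧ HypergraphParam.chromaticIndex C = t}

end SimpleGraph

/-! ### One step of a random removal process: drift and exponential moment of a survivor count. -/

section Potential

open Finset

variable {E β κ : Type*} [DecidableEq E]

/-! Lower bound. With high probability every vertex has degree at least np/2 and, by a first moment
count, no clique has more than about 3 log_{1/p} n vertices. A clique through v covers fewer edges
at v than it has vertices, so every covering uses of order np / log_{1/p} n cliques at v
(`SimpleGraph.le_cliqueCoveringThickness_of_cliqueFree`). The two middle inequalities are formal.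

Upper bound. Put L = log n. If p is at least n^{-1/100}, only one property of the random graph is
used: every set S of at most k vertices, with k of order L / log(4/p), has (1 ± η) n p^|S| common
neighbours (`SimpleGraph.IsCodegreeRegular`). Join the graph to an independent set of N colour
vertices. Edge-disjoint (k+1)-cliques, each with one colour vertex, are edge-disjoint k-cliques of
the graph together with a proper colouring by N colours, since two cliques meeting at v with the
same colour c would share the pair vc. Packing and colouring thus become a single packing problem.

It is solved by a random greedy process in which every remaining pair disappears in each step with
probability exactly a: each available clique is taken with probability a/Δ, and a pair of degree
below Δ makes up its deficit by a chance of being deleted alone, that is, wasted. Survivor counts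
for tests of size s then follow the trajectory (1 - a)^{is}. An exponential potential over all tests
grows by a factor at most 1 + 2a on average, so moves can be chosen that keep every test near its
trajectory and all waste small (`PackingProblem.exists_packing`). The tests control clique extension
counts, which keeps the packing problem nearly regular. N is of order nq/k at density q, large
enough that pairs inside the graph have the largest degree and are seldom wasted; wasted
vertex-colour pairs do no harm.

The process stops when (1 - a)^T = 1/2. The surviving graph is again codegree-regular, with density
q/2 and a slightly larger error (`SimpleGraph.exists_stage`), so the stage can be repeated. Stage i
costs O(np 2^{-i} / k_i) colours with 1/k_i = O((i + 3) log(1/p) / (γ L)), a convergent sum. After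
about log_2 L stages the uncovered graph has maximum degree O(np/L) and its edges are coloured
greedily. If p < n^{-1/100}, then log_{1/p} n is bounded and greedy colouring of all edges suffices.
-/

theorem Real.exp_le_one_add_add_sq {x : ℝ} (hx : |x| ≤ 1) : Real.exp x ≤ 1 + x + x ^ 2 := by
  have h := Real.abs_exp_sub_one_sub_id_le hx
  have := le_of_abs_le h
  linarith

/-- The moment generating function of a bounded random decrement, to second order. -/
theorem sum_weight_mul_exp_le {S : Finset β} {w ℓ : β → ℝ} {u v B d m lam ε : ℝ}
    (hw : ∀ b ∈ S, 0 ≤ w b) (hsum : ∑ b ∈ S, w b = 1) (hℓ : ∀ b ∈ S, 0 ≤ ℓ b)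
    (hB : ∀ b ∈ S, ℓ b ≤ B) (hu : 0 ≤ u) (hv : 0 ≤ v) (hlam : 0 ≤ lam)
    (hd : |u - v * ∑ b ∈ S, w b * ℓ b| ≤ d) (hm : ∑ b ∈ S, w b * ℓ b ≤ m)
    (hsmall : lam * (u + v * B) ≤ 1) (hε : |ε| = 1) :
    ∑ b ∈ S, w b * Real.exp (ε * lam * (u - v * ℓ b)) ≤
      1 + lam * d + lam ^ 2 * (2 * u ^ 2 + 2 * v ^ 2 * B * m) := by
  have hε2 : ε ^ 2 = 1 := by rw [← sq_abs, hε]; norm_num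
  have hS : S.Nonempty := by
    by_contra h
    rw [not_nonempty_iff_eq_empty] at h
    simp [h] at hsum
  obtain ⟨b₀, hb₀⟩ := hS
  have hB0 : 0 ≤ B := (hℓ b₀ hb₀).trans (hB b₀ hb₀)
  have key : ∀ b ∈ S, w b * Real.exp (ε * lam * (u - v * ℓ b)) ≤
      w b + ε * lam * (u * w b - v * (w b * ℓ b)) +
        lam ^ 2 * (2 * u ^ 2 * w b + 2 * v ^ 2 * B * (w b * ℓ b)) := by
    intro b hb
    have h1 := hℓ b hb
    have h2 := hB b hb
    have habs : |ε * lam * (u - v * ℓ b)| ≤ 1 := by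
      rw [abs_mul, abs_mul, hε, one_mul, abs_of_nonneg hlam]
      refine le_trans (mul_le_mul_of_nonneg_left ?_ hlam) hsmall
      have : v * ℓ b ≤ v * B := by gcongr
      have : 0 ≤ v * ℓ b := by positivity
      rw [abs_le]; constructor <;> nlinarith
    have h3 := Real.exp_le_one_add_add_sq habs
    have h4 : (u - v * ℓ b) ^ 2 ≤ 2 * u ^ 2 + 2 * v ^ 2 * B * ℓ b := by
      -- Since ℓ ≤ B, the second moment is at most `B` times the mean; this is better than `B ^ 2`
      -- when losses are rare.
      have : v ^ 2 * ℓ b ^ 2 ≤ v ^ 2 * (B * ℓ b) := by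
        gcongr; nlinarith
      nlinarith [sq_nonneg (u + v * ℓ b)]
    have h5 : (ε * lam * (u - v * ℓ b)) ^ 2 ≤ lam ^ 2 * (2 * u ^ 2 + 2 * v ^ 2 * B * ℓ b) := by
      rw [mul_pow, mul_pow, hε2, one_mul]; gcongr
    have h6 := mul_le_mul_of_nonneg_left (h3.trans (add_le_add_right h5 _)) (hw b hb)
    refine h6.trans (le_of_eq ?_)
    ring
  refine (sum_le_sum key).trans ?_
  rw [sum_add_distrib, sum_add_distrib, ← mul_sum, ← mul_sum, sum_sub_distrib, sum_add_distrib,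
    ← mul_sum, ← mul_sum, ← mul_sum, ← mul_sum, hsum]
  have h7 : ε * lam * (u * 1 - v * ∑ b ∈ S, w b * ℓ b) ≤ lam * d := by
    refine (le_abs_self _).trans ?_
    rw [abs_mul, abs_mul, hε, one_mul, abs_of_nonneg hlam, mul_one]
    gcongr
  have h8 : 2 * v ^ 2 * B * ∑ b ∈ S, w b * ℓ b ≤ 2 * v ^ 2 * B * m := by gcongr
  nlinarith [sq_nonneg lam]

/-- The number of members `x` of `cand` with `F x ⊆ R`. -/
def survivors (cand : Finset κ) (F : κ → Finset E) (R : Finset E) : ℕ :=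
  #{x ∈ cand | F x ⊆ R}

/-- The number of members of `cand` surviving in `R` but not in `R \ X`. -/
def losses (cand : Finset κ) (F : κ → Finset E) (R X : Finset E) : ℕ :=
  #{x ∈ cand | F x ⊆ R ∧ ¬ Disjoint (F x) X}

theorem survivors_sdiff (cand : Finset κ) (F : κ → Finset E) (R X : Finset E) :
    (survivors cand F (R \ X) : ℝ) = survivors cand F R - losses cand F R X := by
  classical
  have : survivors cand F (R \ X) + losses cand F R X = survivors cand F R := by
    unfold survivors losses
    rw [← card_union_of_disjoint]
    · congr 1
      ext x
      simp only [mem_union, mem_filter, subset_sdiff]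
      tauto
    · rw [disjoint_left]
      simp only [mem_filter, subset_sdiff]
      tauto
  rw [← this]; push_cast; ring

theorem losses_eq_sum (cand : Finset κ) (F : κ → Finset E) (R X : Finset E) :
    (losses cand F R X : ℝ) =
      ∑ x ∈ cand with F x ⊆ R, if Disjoint (F x) X then (0 : ℝ) else 1 := by
  unfold losses
  rw [← filter_filter, card_filter, Nat.cast_sum]
  refine sum_congr rfl fun x _ => ?_
  by_cases h : Disjoint (F x) X <;> simp [h]

theorem ite_disjoint_le (F X : Finset E) :
    (if Disjoint F X then (0 : ℝ) else 1) ≤ ∑ e ∈ F, if e ∈ X then (1 : ℝ) else 0 := by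
  split_ifs with h
  · positivity
  · obtain ⟨e, he, heX⟩ := not_disjoint_iff.mp h
    refine le_trans ?_ (single_le_sum (f := fun e => if e ∈ X then (1 : ℝ) else 0)
      (fun i _ => by positivity) he)
    simp [heX]

/-- Bonferroni's inequality: with m = |F ∩ X| it reads m - m(m - 1) ≤ 1 for m > 0. The pairs are
ordered, so they are counted twice, which is harmless. -/
theorem le_ite_disjoint (F X : Finset E) :
    (∑ e ∈ F, if e ∈ X then (1 : ℝ) else 0) -
      ∑ q ∈ F.offDiag, (if q.1 ∈ X ∧ q.2 ∈ X then (1 : ℝ) else 0) ≤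
      if Disjoint F X then (0 : ℝ) else 1 := by
  have h1 : (∑ e ∈ F, if e ∈ X then (1 : ℝ) else 0) = #(F ∩ X) := by
    rw [sum_boole, filter_mem_eq_inter]
  have h2 : (∑ q ∈ F.offDiag, (if q.1 ∈ X ∧ q.2 ∈ X then (1 : ℝ) else 0)) =
      #(F ∩ X).offDiag := by
    rw [← Finset.sum_filter, sum_const, nsmul_eq_mul, mul_one]
    congr 2
    ext ⟨x, y⟩
    simp only [mem_filter, mem_offDiag, mem_inter]
    tauto
  rw [h1, h2, offDiag_card]
  have h3 : Disjoint F X ↔ #(F ∩ X) = 0 := by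
    rw [card_eq_zero, disjoint_iff_inter_eq_empty]
  rw [Nat.cast_sub (Nat.le_mul_self _)]
  push_cast
  simp only [h3]
  generalize #(F ∩ X) = m
  split_ifs with h
  · simp [h]
  · rcases Nat.lt_or_ge m 2 with hm | hm
    · have : m = 1 := by omega
      simp [this]
    · have : (2 : ℝ) ≤ m := by exact_mod_cast hm
      nlinarith

/-- If each element of `R` is removed with probability `a` and pairs inside the sets `F x` are
removed simultaneously with probability at most `a * ξ`, the expected loss is as expected. -/
theorem mean_losses {S : Finset β} {w : β → ℝ} {rem : β → Finset E} {R : Finset E}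
    {cand : Finset κ} {F : κ → Finset E} {s : ℕ} {a ξ : ℝ}
    (hw : ∀ b ∈ S, 0 ≤ w b)
    (ha : ∀ e ∈ R, ∑ b ∈ S, w b * (if e ∈ rem b then (1 : ℝ) else 0) = a)
    (hξ : 0 ≤ a * ξ)
    (hpair : ∀ x ∈ cand, F x ⊆ R → ∀ e ∈ F x, ∀ e' ∈ F x, e ≠ e' →
      ∑ b ∈ S, w b * (if e ∈ rem b ∧ e' ∈ rem b then (1 : ℝ) else 0) ≤ a * ξ)
    (hs : ∀ x ∈ cand, #(F x) = s) :
    ∑ b ∈ S, w b * losses cand F R (rem b) ≤ survivors cand F R * (s * a) ∧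
    survivors cand F R * (s * a - s ^ 2 * (a * ξ)) ≤ ∑ b ∈ S, w b * losses cand F R (rem b) := by
  have hrw : ∑ b ∈ S, w b * losses cand F R (rem b) =
      ∑ x ∈ cand with F x ⊆ R, ∑ b ∈ S, w b * if Disjoint (F x) (rem b) then (0 : ℝ) else 1 := by
    rw [sum_comm]
    refine sum_congr rfl fun b _ => ?_
    rw [losses_eq_sum, mul_sum]
  have hsingle : ∀ x ∈ cand.filter (fun x => F x ⊆ R),
      ∑ b ∈ S, w b * (∑ e ∈ F x, if e ∈ rem b then (1 : ℝ) else 0) = s * a := by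
    intro x hx
    obtain ⟨hx1, hx2⟩ := mem_filter.mp hx
    simp_rw [mul_sum]
    rw [sum_comm, sum_congr rfl fun e he => ha e (hx2 he), sum_const, hs x hx1, nsmul_eq_mul]
  rw [hrw]
  constructor
  · rw [survivors, ← nsmul_eq_mul]
    refine sum_le_card_nsmul _ _ _ fun x hx => ?_
    rw [← hsingle x hx]
    exact sum_le_sum fun b hb => mul_le_mul_of_nonneg_left (ite_disjoint_le _ _) (hw b hb)
  · rw [survivors, ← nsmul_eq_mul]
    refine card_nsmul_le_sum _ _ _ fun x hx => ?_
    have h1 : ∑ b ∈ S, w b *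
        (∑ q ∈ (F x).offDiag, if q.1 ∈ rem b ∧ q.2 ∈ rem b then (1 : ℝ) else 0) ≤
        s ^ 2 * (a * ξ) := by
      obtain ⟨hx1, hx2⟩ := mem_filter.mp hx
      simp_rw [mul_sum]
      rw [sum_comm]
      refine (sum_le_card_nsmul _ _ (a * ξ) fun q hq => ?_).trans ?_
      · rw [mem_offDiag] at hq
        exact hpair x hx1 hx2 _ hq.1 _ hq.2.1 hq.2.2
      · rw [nsmul_eq_mul]
        refine mul_le_mul_of_nonneg_right ?_ hξ
        rw [offDiag_card, hs x hx1]
        have : s * s - s ≤ s ^ 2 := by rw [sq]; omega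
        exact_mod_cast this
    rw [← hsingle x hx]
    refine (sub_le_sub_left h1 _).trans ?_
    rw [← sum_sub_distrib]
    refine sum_le_sum fun b hb => ?_
    rw [← mul_sub]
    exact mul_le_mul_of_nonneg_left (le_ite_disjoint _ _) (hw b hb)

/-- Bernoulli's inequality for (1 + a)^s together with (1 + a)^s (1 - a)^s ≤ 1 gives (1 - a)^s ≤ 1 /
(1 + sa). -/
theorem one_sub_pow_le {a : ℝ} (h0 : 0 ≤ a) (h1 : a ≤ 1) (s : ℕ) :
    (1 - a) ^ s ≤ 1 - s * a + (s * a) ^ 2 := by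
  have h2 : 1 + s * a ≤ (1 + a) ^ s := one_add_mul_le_pow (by linarith) s
  have h3 : (1 + s * a) * (1 - a) ^ s ≤ 1 := by
    calc (1 + s * a) * (1 - a) ^ s ≤ (1 + a) ^ s * (1 - a) ^ s := by
          gcongr
      _ = (1 - a ^ 2) ^ s := by rw [← mul_pow]; ring
      _ ≤ 1 := pow_le_one₀ (by nlinarith) (by nlinarith)
  have h4 : 0 ≤ s * a := by positivity
  have h5 : 0 < 1 + s * a := by positivity
  have h6 : (1 - a) ^ s ≤ 1 / (1 + s * a) := by rw [le_div_iff₀ h5]; linarith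
  refine h6.trans ?_
  rw [div_le_iff₀ h5]
  nlinarith [pow_pos h5 2, pow_nonneg h4 3]

/-- `Y` is the present count, `y` its target, `P` the factor by which the target shrinks and `m` the
mean loss. The drift of the normalised count would vanish if m = Y(1 - P). Both m / Y and 1 - P lie
in [A - Q, A]; the factors Y / y ≤ 2 and 1 / P ≤ 2 turn their difference into 4Q. -/
theorem abs_drift_le {Y y P A Q m : ℝ} (hy : 0 < y) (hY : 0 ≤ Y) (hYy : Y / y ≤ 2)
    (hPlow : 1 - A ≤ P) (hPhigh : P ≤ 1 - A + A ^ 2) (hPhalf : 1 / 2 ≤ P)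
    (hAQ : A ^ 2 ≤ Q) (hm1 : m ≤ Y * A) (hm2 : Y * (A - Q) ≤ m) :
    |Y / y * (1 / P - 1) - 1 / (y * P) * m| ≤ 4 * Q := by
  have hP0 : 0 < P := by linarith
  have hQ : 0 ≤ Q := (sq_nonneg A).trans hAQ
  have hYy0 : 0 ≤ Y / y := by positivity
  have hv0 : 0 ≤ 1 / (y * P) := by positivity
  have e1 : ∀ z : ℝ, Y / y * (1 / P - 1) - 1 / (y * P) * (Y * z) = Y / y * ((1 - P - z) / P) := by
    intro z
    field_simp
  refine abs_le.mpr ⟨?_, ?_⟩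
  · have h1 : 1 / (y * P) * m ≤ 1 / (y * P) * (Y * A) := mul_le_mul_of_nonneg_left hm1 hv0
    have h2 : -(2 * Q) ≤ (1 - P - A) / P := by
      rw [le_div_iff₀ hP0]
      nlinarith
    have h3 := mul_le_mul_of_nonneg_left h2 hYy0
    have h4 := e1 A
    nlinarith
  · have h1 : 1 / (y * P) * (Y * (A - Q)) ≤ 1 / (y * P) * m := mul_le_mul_of_nonneg_left hm2 hv0
    have h2 : (1 - P - (A - Q)) / P ≤ 2 * Q := by
      rw [div_le_iff₀ hP0]
      nlinarith
    have h3 := mul_le_mul_of_nonneg_left h2 hYy0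
    have h4 := e1 (A - Q)
    nlinarith

/-- One step of the evolution of the exponential potential attached to the survivors in `cand`:
`y` is the current target and `y * (1 - a) ^ s` the next one. -/
theorem sum_exp_survivors_le {S : Finset β} {w : β → ℝ} {rem : β → Finset E} {R : Finset E}
    {cand : Finset κ} {F : κ → Finset E} {s : ℕ} {a ξ y B lam ε : ℝ}
    (hw : ∀ b ∈ S, 0 ≤ w b) (hsum : ∑ b ∈ S, w b = 1)
    (ha : ∀ e ∈ R, ∑ b ∈ S, w b * (if e ∈ rem b then (1 : ℝ) else 0) = a)
    (hpair : ∀ x ∈ cand, F x ⊆ R → ∀ e ∈ F x, ∀ e' ∈ F x, e ≠ e' →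
      ∑ b ∈ S, w b * (if e ∈ rem b ∧ e' ∈ rem b then (1 : ℝ) else 0) ≤ a * ξ)
    (hs : ∀ x ∈ cand, #(F x) = s)
    (hB : ∀ b ∈ S, (losses cand F R (rem b) : ℝ) ≤ B)
    (ha0 : 0 < a) (haξ : a ≤ ξ) (hsa : s * a ≤ 1 / 2) (hy : 0 < y)
    (hY : (survivors cand F R : ℝ) ≤ 2 * y) (hlam : 0 ≤ lam)
    (hsmall : lam * (4 * (s * a) + 2 * B / y) ≤ 1)
    (hmu : lam * (4 * s ^ 2 * ξ) + lam ^ 2 * (32 * s ^ 2 * a + 16 * B * s / y) ≤ 1)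
    (hε : |ε| = 1) :
    ∑ b ∈ S, w b * Real.exp (ε * lam *
      (survivors cand F (R \ rem b) / (y * (1 - a) ^ s) - survivors cand F R / y)) ≤ 1 + a := by
  -- For `s = 0` the bound on `s * a` says nothing about `a`, but then the test sets are empty and
  -- never lost.
  rcases Nat.eq_zero_or_pos s with hs0 | hspos
  · have hl : ∀ b ∈ S, losses cand F R (rem b) = 0 := by
      intro b _
      unfold losses
      rw [card_eq_zero, filter_eq_empty_iff]
      rintro x hx ⟨-, h⟩
      rw [card_eq_zero.mp ((hs x hx).trans hs0)] at h
      exact h (disjoint_empty_left _)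
    calc _ = ∑ b ∈ S, w b := sum_congr rfl fun b hb => by
            rw [survivors_sdiff, hl b hb, hs0]; simp
      _ ≤ 1 + a := by rw [hsum]; linarith
  have hs1 : (1 : ℝ) ≤ s := by exact_mod_cast hspos
  have ha1 : a ≤ 1 / 2 := by nlinarith
  set Y : ℝ := (survivors cand F R : ℝ) with hYdef
  have hY0 : 0 ≤ Y := by positivity
  have hξ0 : 0 < ξ := ha0.trans_le haξ
  set P : ℝ := (1 - a) ^ s with hPdef
  have hPlow : 1 - s * a ≤ P := by
    have := one_add_mul_le_pow (show (-2 : ℝ) ≤ -a by linarith) s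
    rw [hPdef, sub_eq_add_neg]; simpa [sub_eq_add_neg] using this
  have hPhigh : P ≤ 1 - s * a + (s * a) ^ 2 := one_sub_pow_le ha0.le (by linarith) s
  have hP1 : P ≤ 1 := pow_le_one₀ (by linarith) (by linarith)
  have hPhalf : 1 / 2 ≤ P := by linarith
  have hP0 : 0 < P := by linarith
  have hsa0 : 0 ≤ s * a := by positivity
  obtain ⟨hm1, hm2⟩ := mean_losses (F := F) (cand := cand) hw ha (by positivity) hpair hs
  set m : ℝ := ∑ b ∈ S, w b * losses cand F R (rem b) with hmdef
  -- The normalised count changes by (Y - ℓ)/(yP) - Y/y = u - vℓ, where ℓ is the loss: `u`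
  -- compensates for the shrinking target.
  set u : ℝ := Y / y * (1 / P - 1) with hudef
  set v : ℝ := 1 / (y * P) with hvdef
  have hYy : Y / y ≤ 2 := by rw [div_le_iff₀ hy]; exact hY
  have hYy0 : 0 ≤ Y / y := by positivity
  have hinv : 1 / P - 1 ≤ 2 * (s * a) := by
    rw [div_sub_one hP0.ne', div_le_iff₀ hP0]; nlinarith
  have hinv0 : 0 ≤ 1 / P - 1 := by
    rw [div_sub_one hP0.ne']; apply div_nonneg <;> linarith
  have hu0 : 0 ≤ u := by positivity
  have hu : u ≤ 4 * (s * a) := by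
    calc u ≤ 2 * (2 * (s * a)) := by rw [hudef]; gcongr
      _ = _ := by ring
  have hv0 : 0 ≤ v := by positivity
  have hv : v ≤ 2 / y := by
    rw [hvdef, div_le_div_iff₀ (by positivity) hy]; nlinarith
  have hS : S.Nonempty := by
    by_contra h
    rw [not_nonempty_iff_eq_empty] at h
    simp [h] at hsum
  obtain ⟨b₀, hb₀⟩ := hS
  have hB0 : 0 ≤ B := le_trans (by positivity) (hB b₀ hb₀)
  have hsq : (s * a) ^ 2 ≤ s ^ 2 * (a * ξ) := by
    rw [mul_pow, sq a]; gcongr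
  have hd : |u - v * m| ≤ 4 * (s ^ 2 * (a * ξ)) :=
    abs_drift_le hy hY0 hYy hPlow hPhigh hPhalf hsq hm1 hm2
  have hm : m ≤ 2 * y * (s * a) := hm1.trans (by gcongr)
  have main := sum_weight_mul_exp_le (ℓ := fun b => (losses cand F R (rem b) : ℝ))
    hw hsum (fun b _ => by positivity) hB hu0 hv0 hlam hd hm
    (le_trans (mul_le_mul_of_nonneg_left (by
      have : v * B ≤ 2 / y * B := by gcongr
      have e : 2 * B / y = 2 / y * B := by ring
      rw [e]; linarith) hlam) hsmall) hε
  have hrw : ∀ b ∈ S, w b * Real.exp (ε * lam *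
      (survivors cand F (R \ rem b) / (y * P) - Y / y)) =
      w b * Real.exp (ε * lam * (u - v * losses cand F R (rem b))) := by
    intro b _
    rw [survivors_sdiff]
    congr 3
    rw [hudef, hvdef, ← hYdef]; field_simp; ring
  rw [sum_congr rfl hrw]
  refine main.trans ?_
  have f1 : 2 * u ^ 2 ≤ 32 * (s * a) ^ 2 := by nlinarith
  have f2 : 2 * v ^ 2 * B * (2 * y * (s * a)) ≤ 16 * B * s / y * a := by
    calc 2 * v ^ 2 * B * (2 * y * (s * a)) ≤ 2 * (2 / y) ^ 2 * B * (2 * y * (s * a)) := by gcongr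
      _ = _ := by field_simp; ring
  calc 1 + lam * (4 * (s ^ 2 * (a * ξ))) +
        lam ^ 2 * (2 * u ^ 2 + 2 * v ^ 2 * B * (2 * y * (s * a)))
      ≤ 1 + lam * (4 * (s ^ 2 * (a * ξ))) +
        lam ^ 2 * (32 * (s * a) ^ 2 + 16 * B * s / y * a) := by gcongr
    _ = 1 + a * (lam * (4 * s ^ 2 * ξ) + lam ^ 2 * (32 * s ^ 2 * a + 16 * B * s / y)) := by ring
    _ ≤ 1 + a * 1 := by gcongr
    _ = 1 + a := by ring

end Potential

/-! ### Packing by a random greedy process, derandomised by an exponential potential. -/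

section Packing

open Finset

/-- A set system `h H`, `H ∈ A`, on a ground set `R₀`, from which disjoint members are to be packed,
together with families of test sets `F j x`, `x ∈ cand j`, whose numbers of survivors are to follow
prescribed trajectories, and sets `D u` in which few elements may be wasted. -/
structure PackingProblem (E α ι κ υ : Type*) where
  A : Finset α
  h : α → Finset E
  R₀ : Finset E
  J : Finset ι
  cand : ι → Finset κ
  F : ι → κ → Finset E
  size : ι → ℕ
  y : ι → ℝ
  U : Finset υ
  D : υ → Finset E

namespace PackingProblem

variable {E α ι κ υ : Type*} [DecidableEq E] (P : PackingProblem E α ι κ υ)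

/-- The predicted number of survivors of the test `j` after `i` steps. -/
def target (a : ℝ) (i : ℕ) (j : ι) : ℝ := P.y j * (1 - a) ^ (i * P.size j)

/-- All tests are within a relative error `η` of their targets. -/
def Regular (a η : ℝ) (i : ℕ) (R : Finset E) : Prop :=
  ∀ j ∈ P.J, |(survivors (P.cand j) (P.F j) R : ℝ) - P.target a i j| ≤ η * P.target a i j

/-- The members of the set system contained in `R`. -/
def avail (R : Finset E) : Finset α := {H ∈ P.A | P.h H ⊆ R}

/-- The number of members of the set system in `R` containing `e`. -/
def deg (R : Finset E) (e : E) : ℕ := #{H ∈ P.avail R | e ∈ P.h H}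

/-- The number of members of the set system in `R` containing `e` and `e'`. -/
def codeg (R : Finset E) (e e' : E) : ℕ := #{H ∈ P.avail R | e ∈ P.h H ∧ e' ∈ P.h H}

/-- Degrees are at most `Δ`, nearly `Δ` on the sets `D u`, and codegrees are small. -/
structure NearlyRegular (ξ ω Δ : ℝ) (R : Finset E) : Prop where
  pos : 0 < Δ
  deg_le : ∀ e ∈ R, (P.deg R e : ℝ) ≤ Δ
  le_deg : ∀ u ∈ P.U, ∀ e ∈ P.D u, e ∈ R → (1 - ω) * Δ ≤ P.deg R e
  codeg_le : ∀ j ∈ P.J, ∀ x ∈ P.cand j, P.F j x ⊆ R → ∀ e ∈ P.F j x, ∀ e' ∈ P.F j x, e ≠ e' →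
    (P.codeg R e e' : ℝ) ≤ ξ * Δ

/-- The numerical conditions under which the random packing process follows its trajectory. -/
structure Admissible (T s : ℕ) (a ξ ω η₀ η lam B W Y : ℝ) : Prop where
  h_nonempty : ∀ H ∈ P.A, (P.h H).Nonempty
  card_F : ∀ j ∈ P.J, ∀ x ∈ P.cand j, #(P.F j x) = P.size j
  size_le : ∀ j ∈ P.J, P.size j ≤ s
  hits_le : ∀ H ∈ P.A, ∀ j ∈ P.J, (#{x ∈ P.cand j | ¬ Disjoint (P.F j x) (P.h H)} : ℝ) ≤ B
  hits_singleton_le : ∀ e, ∀ j ∈ P.J, (#{x ∈ P.cand j | e ∈ P.F j x} : ℝ) ≤ B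
  B_nonneg : 0 ≤ B
  a_pos : 0 < a
  a_le : a ≤ ξ
  a_card : a * #P.R₀ ≤ 1
  a_size : s * a ≤ 1 / 2
  a_time : a * T ≤ 1
  Y_pos : 0 < Y
  Y_le : ∀ j ∈ P.J, Y ≤ P.y j * (1 - a) ^ (T * P.size j)
  lam_pos : 0 < lam
  lam_small : lam * (4 * (s * a) + 2 * B / Y) ≤ 1
  mu_small : lam * (4 * s ^ 2 * ξ) + lam ^ 2 * (32 * s ^ 2 * a + 16 * B * s / Y) ≤ 1
  η_le : η ≤ 1
  W_ge : 1 ≤ W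
  ω_nonneg : 0 ≤ ω
  D_le : ∀ u ∈ P.U, #(P.D u) * ω ≤ W
  init : P.Regular a η₀ 0 P.R₀
  fin : Real.exp 2 * (2 * #P.J + #P.U) ≤ Real.exp (lam * (η - η₀))

/-- The exponential potential. -/
noncomputable def potential (a η₀ lam W : ℝ) (i : ℕ) (R X : Finset E) : ℝ :=
  ∑ j ∈ P.J, (Real.exp (lam * (survivors (P.cand j) (P.F j) R / P.target a i j - 1 - η₀)) +
    Real.exp (lam * (1 - survivors (P.cand j) (P.F j) R / P.target a i j - η₀))) +
  ∑ u ∈ P.U, Real.exp (#(P.D u ∩ X) / W)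

/-- The possible moves from `R`: nothing, a member of the set system, or a single element. -/
def moves (R : Finset E) : Finset (Option (α ⊕ E)) := insertNone ((P.avail R).disjSum R)

/-- The elements removed by a move. -/
def removed : Option (α ⊕ E) → Finset E
  | none => ∅
  | some (.inl H) => P.h H
  | some (.inr e) => {e}

/-- The elements wasted by a move. -/
def wasted : Option (α ⊕ E) → Finset E
  | some (.inr e) => {e}
  | _ => ∅

/-- The probability of a move. -/
noncomputable def weight (a Δ : ℝ) (R : Finset E) : Option (α ⊕ E) → ℝ
  | none => 1 - (∑ _H ∈ P.avail R, a / Δ + ∑ e ∈ R, a * (1 - P.deg R e / Δ))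
  | some (.inl _) => a / Δ
  | some (.inr e) => a * (1 - P.deg R e / Δ)

theorem sum_moves (R : Finset E) (g : Option (α ⊕ E) → ℝ) :
    ∑ b ∈ P.moves R, g b =
      g none + (∑ H ∈ P.avail R, g (some (.inl H)) + ∑ e ∈ R, g (some (.inr e))) := by
  rw [moves, sum_insertNone, sum_disjSum]

theorem sum_weight (a Δ : ℝ) (R : Finset E) : ∑ b ∈ P.moves R, P.weight a Δ R b = 1 := by
  rw [sum_moves]
  simp only [weight]
  ring

variable {P} {T s : ℕ} {a ξ ω η₀ η lam B W Y : ℝ}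

/-- Only doing nothing needs an argument. Members are nonempty, so there are at most ∑ deg of them;
the members together with the single deletions therefore have total weight at most a · #R ≤ 1. -/
theorem weight_nonneg {R : Finset E} {Δ : ℝ} (hP : P.Admissible T s a ξ ω η₀ η lam B W Y)
    (hR : R ⊆ P.R₀) (hreg : P.NearlyRegular ξ ω Δ R) : ∀ b ∈ P.moves R, 0 ≤ P.weight a Δ R b := by
  have ha := hP.a_pos
  have hΔ := hreg.pos
  rintro (_ | H | e) hb
  · simp only [weight]
    have h1 : ∑ _H ∈ P.avail R, a / Δ ≤ ∑ e ∈ R, a * (P.deg R e / Δ) := by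
      have h2 : (#(P.avail R) : ℝ) ≤ ∑ e ∈ R, (P.deg R e : ℝ) := by
        have h3 : ∑ e ∈ R, P.deg R e = ∑ H ∈ P.avail R, #(R ∩ P.h H) := by
          unfold deg
          simp_rw [← filter_mem_eq_inter]
          exact sum_card_bipartiteAbove_eq_sum_card_bipartiteBelow (fun e H => e ∈ P.h H)
        have h4 : #(P.avail R) ≤ ∑ e ∈ R, P.deg R e := by
          rw [h3, card_eq_sum_ones]
          refine sum_le_sum fun H hH => ?_
          obtain ⟨hHA, hHR⟩ := mem_filter.mp hH
          rw [inter_eq_right.mpr hHR]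
          exact card_pos.mpr (hP.h_nonempty H hHA)
        exact_mod_cast h4
      have e1 : ∑ e ∈ R, a * (P.deg R e / Δ) = (∑ e ∈ R, (P.deg R e : ℝ)) * (a / Δ) := by
        rw [sum_mul]
        exact sum_congr rfl fun e _ => by ring
      rw [e1, sum_const, nsmul_eq_mul]
      gcongr
    have h6 : ∑ e ∈ R, a * (1 - P.deg R e / Δ) = a * #R - ∑ e ∈ R, a * (P.deg R e / Δ) := by
      rw [mul_comm a, ← nsmul_eq_mul, ← sum_const, ← sum_sub_distrib]
      refine sum_congr rfl fun e _ => by ring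
    have h7 : a * #R ≤ 1 := le_trans (by gcongr) hP.a_card
    linarith
  · exact div_nonneg ha.le hΔ.le
  · simp only [moves, some_mem_insertNone, inr_mem_disjSum] at hb
    refine mul_nonneg ha.le (sub_nonneg.mpr ?_)
    rw [div_le_one hΔ]
    exact hreg.deg_le e hb

/-- The purpose of the single deletions: members through `e` contribute a · deg / Δ and the deletion
of `e` alone contributes the rest of `a`, so the removal probability is the same for all elements
whatever their degrees. -/
theorem sum_weight_mem {R : Finset E} {Δ : ℝ} {e : E} (he : e ∈ R) :
    ∑ b ∈ P.moves R, P.weight a Δ R b * (if e ∈ P.removed b then (1 : ℝ) else 0) = a := by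
  have h1 : ∀ H ∈ P.avail R, P.weight a Δ R (some (.inl H)) *
      (if e ∈ P.removed (some (.inl H)) then (1 : ℝ) else 0) =
      if e ∈ P.h H then a / Δ else 0 := by
    intro H _
    by_cases h : e ∈ P.h H <;> simp [weight, removed, h]
  have h2 : ∀ x ∈ R, P.weight a Δ R (some (.inr x)) *
      (if e ∈ P.removed (some (.inr x)) then (1 : ℝ) else 0) =
      if e = x then a * (1 - P.deg R e / Δ) else 0 := by
    intro x _
    by_cases h : e = x
    · subst h; simp [weight, removed]
    · simp [removed, h]
  rw [sum_moves, sum_congr rfl h1, sum_congr rfl h2, ← sum_filter, sum_const, nsmul_eq_mul,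
    sum_ite_eq, if_pos he, ← deg]
  simp only [removed, notMem_empty, if_false]
  ring

/-- Two elements can only disappear together as part of a member, so small codegrees make removals
nearly pairwise exclusive. -/
theorem sum_weight_mem_mem {R : Finset E} {Δ : ℝ} {e e' : E} (he : e ≠ e') :
    ∑ b ∈ P.moves R, P.weight a Δ R b *
      (if e ∈ P.removed b ∧ e' ∈ P.removed b then (1 : ℝ) else 0) = P.codeg R e e' * (a / Δ) := by
  rw [sum_moves]
  have : ∀ x ∈ R, P.weight a Δ R (some (.inr x)) * (if e ∈ P.removed (some (.inr x)) ∧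
      e' ∈ P.removed (some (.inr x)) then (1 : ℝ) else 0) = 0 := by
    intro x _
    rw [if_neg, mul_zero]
    simp only [removed, mem_singleton]
    rintro ⟨rfl, h⟩
    exact he h.symm
  have h1 : ∀ H ∈ P.avail R, P.weight a Δ R (some (.inl H)) *
      (if e ∈ P.removed (some (.inl H)) ∧ e' ∈ P.removed (some (.inl H)) then (1 : ℝ) else 0) =
      if e ∈ P.h H ∧ e' ∈ P.h H then a / Δ else 0 := by
    intro H _
    by_cases h : e ∈ P.h H <;> by_cases h' : e' ∈ P.h H <;> simp [weight, removed, h, h']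
  rw [sum_congr rfl this, sum_congr rfl h1, ← sum_filter, sum_const, nsmul_eq_mul, ← codeg]
  simp [removed]

theorem target_pos (hP : P.Admissible T s a ξ ω η₀ η lam B W Y) {i : ℕ} (hi : i ≤ T) {j : ι}
    (hj : j ∈ P.J) : Y ≤ P.target a i j := by
  have h1 := hP.Y_le j hj
  have ha := hP.a_pos
  rcases Nat.eq_zero_or_pos (P.size j) with h0 | h0
  · simpa [target, h0] using h1
  have hs : (1 : ℝ) ≤ s := by exact_mod_cast h0.trans_le (hP.size_le j hj)
  have ha1 : a ≤ 1 / 2 := by nlinarith [hP.a_size]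
  have hy : 0 < P.y j := by
    by_contra hneg
    have : P.y j * (1 - a) ^ (T * P.size j) ≤ 0 :=
      mul_nonpos_of_nonpos_of_nonneg (not_lt.mp hneg) (pow_nonneg (by linarith) _)
    linarith [hP.Y_pos]
  refine h1.trans ?_
  unfold target
  refine mul_le_mul_of_nonneg_left ?_ hy.le
  exact pow_le_pow_of_le_one (by linarith) (by linarith) (Nat.mul_le_mul_right _ hi)

theorem losses_le (hP : P.Admissible T s a ξ ω η₀ η lam B W Y) {R : Finset E} {j : ι}
    (hj : j ∈ P.J) : ∀ b ∈ P.moves R,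
      (losses (P.cand j) (P.F j) R (P.removed b) : ℝ) ≤ B := by
  rintro (_ | H | e) hb
  · have h0 : losses (P.cand j) (P.F j) R (P.removed (none : Option (α ⊕ E))) = 0 := by
      simp [losses, removed]
    rw [h0]
    simpa using hP.B_nonneg
  · simp only [moves, some_mem_insertNone, inl_mem_disjSum, avail, mem_filter] at hb
    refine le_trans ?_ (hP.hits_le H hb.1 j hj)
    unfold losses removed
    exact_mod_cast card_le_card fun x => by simp only [mem_filter]; tauto
  · refine le_trans ?_ (hP.hits_singleton_le e j hj)
    unfold losses removed
    exact_mod_cast card_le_card fun x => by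
      simp only [mem_filter, disjoint_singleton_right, not_not]; tauto

/-- An element of `D u` is wasted with probability at most a ω, so one step wastes at most a ω #(D
u) ≤ a W elements on average. At most one is wasted at a time and W ≥ 1, so the exponential at scale
`W` is linear up to a factor 2, and the growth factor is 1 + 2a. -/
theorem sum_weight_exp_wasted_le (hP : P.Admissible T s a ξ ω η₀ η lam B W Y) {R X : Finset E}
    {Δ : ℝ} (hR : R ⊆ P.R₀) (hreg : P.NearlyRegular ξ ω Δ R) {u : υ} (hu : u ∈ P.U) :
    ∑ b ∈ P.moves R, P.weight a Δ R b * Real.exp (#(P.D u ∩ (X ∪ wasted b)) / W) ≤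
      (1 + 2 * a) * Real.exp (#(P.D u ∩ X) / W) := by
  have hw := weight_nonneg hP hR hreg
  have hW : 0 < W := by linarith [hP.W_ge]
  have ha := hP.a_pos
  have key : ∀ b ∈ P.moves R, P.weight a Δ R b * Real.exp (#(P.D u ∩ (X ∪ wasted b)) / W) ≤
      Real.exp (#(P.D u ∩ X) / W) * (P.weight a Δ R b +
        2 / W * (P.weight a Δ R b * #(P.D u ∩ (wasted b)))) := by
    intro b hb
    have h1 : (#(P.D u ∩ (X ∪ wasted b)) : ℝ) ≤ #(P.D u ∩ X) + #(P.D u ∩ (wasted b)) := by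
      rw [inter_union_distrib_left]; exact_mod_cast card_union_le _ _
    have h2 : (#(P.D u ∩ (wasted b)) : ℝ) ≤ 1 := by
      have : #(wasted b) ≤ 1 := by rcases b with _ | H | e <;> simp [wasted]
      exact_mod_cast (card_le_card inter_subset_right).trans this
    set c : ℝ := (#(P.D u ∩ (wasted b)) : ℝ)
    have hc0 : 0 ≤ c := by positivity
    have hcW1 : c / W ≤ 1 := by rw [div_le_one hW]; linarith [hP.W_ge]
    have hcW0 : 0 ≤ c / W := by positivity
    have h3 : Real.exp (c / W) ≤ 1 + 2 / W * c := by
      refine (Real.exp_le_one_add_add_sq (by rwa [abs_of_nonneg hcW0])).trans ?_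
      have : 2 / W * c = 2 * (c / W) := by ring
      nlinarith
    calc _ ≤ P.weight a Δ R b * Real.exp ((#(P.D u ∩ X) + c) / W) := by
          have := hw b hb; gcongr
      _ = Real.exp (#(P.D u ∩ X) / W) * (P.weight a Δ R b * Real.exp (c / W)) := by
          rw [add_div, Real.exp_add]; ring
      _ ≤ Real.exp (#(P.D u ∩ X) / W) * (P.weight a Δ R b * (1 + 2 / W * c)) := by
          have := hw b hb; gcongr
      _ = _ := by ring
  refine (sum_le_sum key).trans ?_
  rw [← mul_sum, sum_add_distrib, sum_weight, ← mul_sum, mul_comm]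
  refine mul_le_mul_of_nonneg_right ?_ (Real.exp_pos _).le
  have h4 : ∑ b ∈ P.moves R, P.weight a Δ R b * #(P.D u ∩ (wasted b)) ≤ a * W := by
    rw [sum_moves]
    simp only [wasted, inter_empty, card_empty, Nat.cast_zero, mul_zero, sum_const_zero, zero_add,
      weight]
    have h5 : ∀ e ∈ R, a * (1 - P.deg R e / Δ) * (#(P.D u ∩ {e}) : ℝ) ≤
        if e ∈ P.D u then a * ω else 0 := by
      intro e he
      split_ifs with hD
      · have h6 := hreg.le_deg u hu e hD he
        have h7 : 1 - P.deg R e / Δ ≤ ω := by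
          have : 1 - ω ≤ P.deg R e / Δ := by rw [le_div_iff₀ hreg.pos]; exact h6
          linarith
        rw [inter_singleton_of_mem hD, card_singleton, Nat.cast_one, mul_one]
        gcongr
      · simp [inter_singleton_of_notMem hD]
    refine (sum_le_sum h5).trans ?_
    rw [← sum_filter, sum_const, nsmul_eq_mul]
    have h8 : (#{e ∈ R | e ∈ P.D u} : ℝ) ≤ #(P.D u) := by
      exact_mod_cast card_le_card fun x => by simp
    have h9 := hP.D_le u hu
    have := hP.ω_nonneg
    calc _ ≤ (#(P.D u) : ℝ) * (a * ω) := by gcongr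
      _ = a * (#(P.D u) * ω) := by ring
      _ ≤ a * W := by gcongr
  have h10 : 2 / W * ∑ b ∈ P.moves R, P.weight a Δ R b * #(P.D u ∩ (wasted b)) ≤
      2 / W * (a * W) := by gcongr
  have h11 : 2 / W * (a * W) = 2 * a := by field_simp
  linarith

/-- Both signs of deviation come from the one-step estimate, with ε = ±1. Regularity with η ≤ 1
supplies its hypothesis that the count is at most twice the target; the codegree bound supplies its
pair condition. -/
theorem sum_weight_potential_le (hP : P.Admissible T s a ξ ω η₀ η lam B W Y) {R X : Finset E}
    {Δ : ℝ} {i : ℕ} (hi : i < T) (hR : R ⊆ P.R₀) (hreg : P.NearlyRegular ξ ω Δ R)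
    (hgood : P.Regular a η i R) :
    ∑ b ∈ P.moves R, P.weight a Δ R b *
      P.potential a η₀ lam W (i + 1) (R \ P.removed b) (X ∪ wasted b) ≤
    (1 + 2 * a) * P.potential a η₀ lam W i R X := by
  have hw := weight_nonneg hP hR hreg
  have ha := hP.a_pos
  have hpos : ∀ j ∈ P.J, 0 < P.target a i j := fun j hj =>
    hP.Y_pos.trans_le (target_pos hP hi.le hj)
  have step : ∀ j ∈ P.J, ∀ ε : ℝ, |ε| = 1 → ∑ b ∈ P.moves R, P.weight a Δ R b *
      Real.exp (lam * (ε * (survivors (P.cand j) (P.F j) (R \ P.removed b) /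
        P.target a (i + 1) j - 1) - η₀)) ≤
      (1 + 2 * a) * Real.exp (lam * (ε * (survivors (P.cand j) (P.F j) R /
        P.target a i j - 1) - η₀)) := by
    intro j hj ε hε
    have hY := target_pos hP hi.le hj
    have hYpos := hP.Y_pos
    have hB0 := hP.B_nonneg
    have hs : (P.size j : ℝ) ≤ s := by exact_mod_cast hP.size_le j hj
    have hξ : 0 < ξ := ha.trans_le hP.a_le
    have hlam := hP.lam_pos
    have h1 := sum_exp_survivors_le (rem := P.removed) (cand := P.cand j) (F := P.F j)
      (s := P.size j) (ξ := ξ) (y := P.target a i j) (B := B) (lam := lam) (ε := ε) hw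
      (P.sum_weight a Δ R) (fun e he => sum_weight_mem he)
      (fun x hx hxR e he e' he' hne => by
        rw [sum_weight_mem_mem hne]
        have := hreg.codeg_le j hj x hx hxR e he e' he' hne
        have hΔ := hreg.pos
        calc _ ≤ ξ * Δ * (a / Δ) := by gcongr
          _ = a * ξ := by field_simp)
      (hP.card_F j hj) (losses_le hP hj) ha hP.a_le
      (le_trans (by gcongr) hP.a_size) (hpos j hj)
      (by
        have := le_of_abs_le (hgood j hj)
        have h2 : η * P.target a i j ≤ 1 * P.target a i j :=
          mul_le_mul_of_nonneg_right hP.η_le (hpos j hj).le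
        linarith)
      hlam.le (le_trans (by gcongr) hP.lam_small)
      (le_trans (by gcongr) hP.mu_small) hε
    have htgt : P.target a (i + 1) j = P.target a i j * (1 - a) ^ P.size j := by
      unfold target; rw [add_mul, one_mul, pow_add]; ring
    have h3 : ∀ b ∈ P.moves R, P.weight a Δ R b *
      Real.exp (lam * (ε * (survivors (P.cand j) (P.F j) (R \ P.removed b) /
        P.target a (i + 1) j - 1) - η₀)) = (P.weight a Δ R b * Real.exp (ε * lam *
      (survivors (P.cand j) (P.F j) (R \ P.removed b) / (P.target a i j * (1 - a) ^ P.size j) -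
        survivors (P.cand j) (P.F j) R / P.target a i j))) *
        Real.exp (lam * (ε * (survivors (P.cand j) (P.F j) R / P.target a i j - 1) - η₀)) := by
      intro b _
      rw [mul_assoc, ← Real.exp_add, htgt]
      congr 2
      ring
    rw [sum_congr rfl h3, ← sum_mul]
    refine mul_le_mul_of_nonneg_right (h1.trans ?_) (Real.exp_pos _).le
    linarith
  unfold potential
  simp_rw [mul_add, mul_sum]
  rw [sum_add_distrib, sum_comm, sum_comm (s := P.moves R) (t := P.U)]
  refine add_le_add (sum_le_sum fun j hj => ?_) (sum_le_sum fun u hu => ?_)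
  · have h1 := step j hj 1 (by simp)
    have h2 := step j hj (-1) (by simp)
    simp only [one_mul] at h1
    have e : ∀ z : ℝ, (-1) * (z - 1) - η₀ = 1 - z - η₀ := fun z => by ring
    simp only [e] at h2
    simp_rw [mul_add]
    rw [sum_add_distrib]
    exact add_le_add h1 h2
  · exact sum_weight_exp_wasted_le hP hR hreg hu

theorem potential_zero_le (hP : P.Admissible T s a ξ ω η₀ η lam B W Y) :
    P.potential a η₀ lam W 0 P.R₀ ∅ ≤ 2 * #P.J + #P.U := by
  have hlam := hP.lam_pos
  unfold potential
  refine add_le_add ?_ ?_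
  · rw [mul_comm, ← nsmul_eq_mul]
    refine sum_le_card_nsmul _ _ _ fun j hj => ?_
    have hpos := hP.Y_pos.trans_le (target_pos hP (Nat.zero_le T) hj)
    have h1 := abs_le.mp (hP.init j hj)
    set X : ℝ := (survivors (P.cand j) (P.F j) P.R₀ : ℝ)
    set y : ℝ := P.target a 0 j
    have h2 : X / y ≤ 1 + η₀ := by rw [div_le_iff₀ hpos]; linarith
    have h3 : 1 - η₀ ≤ X / y := by rw [le_div_iff₀ hpos]; linarith
    have h4 : Real.exp (lam * (X / y - 1 - η₀)) ≤ 1 := by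
      rw [Real.exp_le_one_iff]
      exact mul_nonpos_of_nonneg_of_nonpos hlam.le (by linarith)
    have h5 : Real.exp (lam * (1 - X / y - η₀)) ≤ 1 := by
      rw [Real.exp_le_one_iff]
      exact mul_nonpos_of_nonneg_of_nonpos hlam.le (by linarith)
    linarith
  · simp

theorem regular_of_potential_le (hP : P.Admissible T s a ξ ω η₀ η lam B W Y) {i : ℕ} (hi : i ≤ T)
    {R X : Finset E} (h : P.potential a η₀ lam W i R X ≤ Real.exp (lam * (η - η₀))) :
    P.Regular a η i R := by
  intro j hj
  have hlam := hP.lam_pos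
  have hpos := hP.Y_pos.trans_le (target_pos hP hi hj)
  have h1 : Real.exp (lam * (survivors (P.cand j) (P.F j) R / P.target a i j - 1 - η₀)) +
      Real.exp (lam * (1 - survivors (P.cand j) (P.F j) R / P.target a i j - η₀)) ≤
      Real.exp (lam * (η - η₀)) := by
    refine le_trans ?_ h
    unfold potential
    refine le_trans ?_ (le_add_of_nonneg_right (by positivity))
    exact single_le_sum (f := fun j =>
      Real.exp (lam * (survivors (P.cand j) (P.F j) R / P.target a i j - 1 - η₀)) +
      Real.exp (lam * (1 - survivors (P.cand j) (P.F j) R / P.target a i j - η₀)))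
      (fun _ _ => by positivity) hj
  set x : ℝ := (survivors (P.cand j) (P.F j) R : ℝ)
  set y : ℝ := P.target a i j
  have h2 : x / y - 1 - η₀ ≤ η - η₀ := by
    have : Real.exp (lam * (x / y - 1 - η₀)) ≤ Real.exp (lam * (η - η₀)) :=
      le_trans (le_add_of_nonneg_right (Real.exp_pos _).le) h1
    exact le_of_mul_le_mul_left (Real.exp_le_exp.mp this) hlam
  have h3 : 1 - x / y - η₀ ≤ η - η₀ := by
    have : Real.exp (lam * (1 - x / y - η₀)) ≤ Real.exp (lam * (η - η₀)) :=
      le_trans (le_add_of_nonneg_left (Real.exp_pos _).le) h1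
    exact le_of_mul_le_mul_left (Real.exp_le_exp.mp this) hlam
  have h4 : x / y ≤ 1 + η := by linarith
  have h5 : 1 - η ≤ x / y := by linarith
  rw [div_le_iff₀ hpos] at h4
  rw [le_div_iff₀ hpos] at h5
  rw [abs_le]
  constructor <;> linarith

theorem wasted_le_of_potential_le (hP : P.Admissible T s a ξ ω η₀ η lam B W Y) {i : ℕ}
    {R X : Finset E} (h : P.potential a η₀ lam W i R X ≤ Real.exp (lam * (η - η₀)))
    {u : υ} (hu : u ∈ P.U) : (#(P.D u ∩ X) : ℝ) ≤ W * (lam * (η - η₀)) := by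
  have hW : 0 < W := by linarith [hP.W_ge]
  have h1 : Real.exp (#(P.D u ∩ X) / W) ≤ Real.exp (lam * (η - η₀)) := by
    refine le_trans ?_ h
    unfold potential
    refine le_trans ?_ (le_add_of_nonneg_left (by positivity))
    exact single_le_sum (f := fun u => Real.exp (#(P.D u ∩ X) / W))
      (fun _ _ => by positivity) hu
  have h2 := Real.exp_le_exp.mp h1
  rwa [div_le_iff₀' hW] at h2

/-- The averaging argument that replaces random moves by chosen ones: some weight is positive, so
values all above `c` would have mean above `c`. -/
theorem exists_le_of_sum_weight_le {β : Type*} {S : Finset β} {w f : β → ℝ} {c : ℝ}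
    (hw : ∀ b ∈ S, 0 ≤ w b) (hsum : ∑ b ∈ S, w b = 1) (h : ∑ b ∈ S, w b * f b ≤ c) :
    ∃ b ∈ S, f b ≤ c := by
  by_contra! hcon
  have h1 : ∃ b ∈ S, 0 < w b := by
    by_contra! h2
    have := sum_nonpos h2
    linarith
  obtain ⟨b, hb, hwb⟩ := h1
  have : ∑ b ∈ S, w b * c < ∑ b ∈ S, w b * f b :=
    sum_lt_sum (fun b hb => mul_le_mul_of_nonneg_left (hcon b hb).le (hw b hb))
      ⟨b, hb, mul_lt_mul_of_pos_left (hcon b hb) hwb⟩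
  rw [← sum_mul, hsum, one_mul] at this
  linarith

/-- A nearly regular set system contains a packing such that the uncovered part follows the
trajectory of a random set, up to few wasted elements. -/
theorem exists_packing [DecidableEq α] (hP : P.Admissible T s a ξ ω η₀ η lam B W Y)
    (hreg : ∀ i < T, ∀ R ⊆ P.R₀, P.Regular a η i R → ∃ Δ, P.NearlyRegular ξ ω Δ R) :
    ∃ M ⊆ P.A, ∃ R ⊆ P.R₀, P.Regular a η T R ∧
      (∀ H ∈ M, ∀ H' ∈ M, H ≠ H' → Disjoint (P.h H) (P.h H')) ∧
      (∀ H ∈ M, P.h H ⊆ P.R₀ ∧ Disjoint (P.h H) R) ∧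
      ∀ u ∈ P.U, (#{e ∈ P.D u | e ∈ P.R₀ ∧ e ∉ R ∧ ∀ H ∈ M, e ∉ P.h H} : ℝ) ≤
        W * (lam * (η - η₀)) := by
  have ha := hP.a_pos
  -- Since a T ≤ 1, the potential grows by at most e² over the whole process; the condition `fin`
  -- was set to absorb this and the initial value.
  have hbound : ∀ i ≤ T, (1 + 2 * a) ^ i * P.potential a η₀ lam W 0 P.R₀ ∅ ≤
      Real.exp (lam * (η - η₀)) := by
    intro i hi
    refine le_trans ?_ hP.fin
    refine mul_le_mul ?_ (potential_zero_le hP) (by unfold potential; positivity)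
      (Real.exp_pos _).le
    calc (1 + 2 * a) ^ i ≤ Real.exp (2 * a) ^ i := by
          gcongr; linarith [Real.add_one_le_exp (2 * a)]
      _ = Real.exp (2 * (a * i)) := by rw [← Real.exp_nat_mul]; ring_nf
      _ ≤ Real.exp 2 := by
          rw [Real.exp_le_exp]
          have : a * i ≤ a * T := by gcongr
          linarith [hP.a_time]
  -- `X` collects the elements deleted alone. What the conclusion needs is only that an element
  -- which is neither left nor covered belongs to `X`.
  have main : ∀ i ≤ T, ∃ M ⊆ P.A, ∃ R ⊆ P.R₀, ∃ X : Finset E,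
      (∀ H ∈ M, ∀ H' ∈ M, H ≠ H' → Disjoint (P.h H) (P.h H')) ∧
      (∀ H ∈ M, P.h H ⊆ P.R₀ ∧ Disjoint (P.h H) R) ∧
      (∀ e ∈ P.R₀, e ∉ R → (∀ H ∈ M, e ∉ P.h H) → e ∈ X) ∧
      P.potential a η₀ lam W i R X ≤ (1 + 2 * a) ^ i * P.potential a η₀ lam W 0 P.R₀ ∅ := by
    intro i
    induction i with
    | zero =>
      intro _
      exact ⟨∅, by simp, P.R₀, subset_rfl, ∅, by simp, by simp, fun e he he' => absurd he he',
        by simp⟩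
    | succ i ih =>
      intro hi
      obtain ⟨M, hMA, R, hR, X, hM, hMR, hX, hpot⟩ := ih (by omega)
      have hgood := regular_of_potential_le hP (by omega : i ≤ T)
        (hpot.trans (hbound i (by omega)))
      obtain ⟨Δ, hΔ⟩ := hreg i (by omega) R hR hgood
      -- The bound on the potential forces regularity, regularity makes the weights a probability
      -- distribution, and some move does no worse than the average.
      obtain ⟨b, hb, hle⟩ := exists_le_of_sum_weight_le (weight_nonneg hP hR hΔ)
        (P.sum_weight a Δ R) (sum_weight_potential_le (X := X) hP (by omega : i < T) hR hΔ hgood)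
      have hfin : P.potential a η₀ lam W (i + 1) (R \ P.removed b) (X ∪ wasted b) ≤
          (1 + 2 * a) ^ (i + 1) * P.potential a η₀ lam W 0 P.R₀ ∅ := by
        refine hle.trans ?_
        rw [pow_succ', mul_assoc]
        gcongr
      have hMR' : ∀ H ∈ M, P.h H ⊆ P.R₀ ∧ Disjoint (P.h H) (R \ P.removed b) := fun H hH =>
        ⟨(hMR H hH).1, (hMR H hH).2.mono_right sdiff_subset⟩
      rcases b with _ | H | e
      · refine ⟨M, hMA, _, sdiff_subset.trans hR, _, hM, hMR', fun e he heR heM => ?_, hfin⟩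
        refine mem_union_left _ (hX e he (fun h => heR ?_) heM)
        simpa [removed] using h
      · simp only [moves, some_mem_insertNone, inl_mem_disjSum, avail, mem_filter] at hb
        refine ⟨insert H M, insert_subset hb.1 hMA, _, sdiff_subset.trans hR, _, ?_, ?_, ?_, hfin⟩
        · have h1 : ∀ H' ∈ M, Disjoint (P.h H') (P.h H) := fun H' hH' =>
            (hMR H' hH').2.mono_right hb.2
          intro H₁ h₁ H₂ h₂ hne
          rcases mem_insert.mp h₁ with rfl | h₁' <;> rcases mem_insert.mp h₂ with rfl | h₂'
          · exact absurd rfl hne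
          · exact (h1 _ h₂').symm
          · exact h1 _ h₁'
          · exact hM _ h₁' _ h₂' hne
        · intro H' hH'
          rcases mem_insert.mp hH' with rfl | h
          · exact ⟨hb.2.trans hR, disjoint_sdiff⟩
          · exact hMR' H' h
        · intro e he heR heM
          refine mem_union_left _ (hX e he (fun h => heR ?_) fun H' hH' =>
            heM H' (mem_insert_of_mem hH'))
          exact mem_sdiff.mpr ⟨h, heM H (mem_insert_self _ _)⟩
      · refine ⟨M, hMA, _, sdiff_subset.trans hR, _, hM, hMR', fun e' he heR heM => ?_, hfin⟩
        by_cases h : e' ∈ R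
        · refine mem_union_right _ ?_
          by_contra h'
          exact heR (mem_sdiff.mpr ⟨h, h'⟩)
        · exact mem_union_left _ (hX e' he h heM)
  obtain ⟨M, hMA, R, hR, X, hM, hMR, hX, hpot⟩ := main T le_rfl
  have hpot' := hpot.trans (hbound T le_rfl)
  refine ⟨M, hMA, R, hR, regular_of_potential_le hP le_rfl hpot', hM, hMR, fun u hu => ?_⟩
  refine le_trans ?_ (wasted_le_of_potential_le hP hpot' hu)
  refine Nat.cast_le.mpr (card_le_card fun e he => ?_)
  obtain ⟨h1, h2, h3, h4⟩ := mem_filter.mp he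
  exact mem_inter.mpr ⟨h1, hX e h2 h3 h4⟩

end PackingProblem

end Packing

/-! ### Counting coloured cliques by adding one vertex at a time. -/

section Extensions

open Finset

variable {W : Type*} [DecidableEq W]

/-- The set of (unordered) pairs of distinct elements of `K`. -/
def pairSet (K : Finset W) : Finset (Sym2 W) := K.offDiag.image fun p => s(p.1, p.2)

theorem mk_mem_pairSet {K : Finset W} {x y : W} : s(x, y) ∈ pairSet K ↔ x ∈ K ∧ y ∈ K ∧ x ≠ y := by
  simp only [pairSet, mem_image, mem_offDiag, Prod.exists, Sym2.eq_iff]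
  constructor
  · rintro ⟨a, b, ⟨ha, hb, hab⟩, ⟨rfl, rfl⟩ | ⟨rfl, rfl⟩⟩
    · exact ⟨ha, hb, hab⟩
    · exact ⟨hb, ha, hab.symm⟩
  · rintro ⟨hx, hy, hxy⟩
    exact ⟨x, y, ⟨hx, hy, hxy⟩, Or.inl ⟨rfl, rfl⟩⟩

theorem pairSet_subset_iff {K : Finset W} {R : Finset (Sym2 W)} :
    pairSet K ⊆ R ↔ ∀ x ∈ K, ∀ y ∈ K, x ≠ y → s(x, y) ∈ R := by
  constructor
  · intro h x hx y hy hxy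
    exact h (mk_mem_pairSet.mpr ⟨hx, hy, hxy⟩)
  · intro h e
    induction e with
    | _ x y =>
      intro he
      obtain ⟨hx, hy, hxy⟩ := mk_mem_pairSet.mp he
      exact h x hx y hy hxy

/-- The pairs joining `x` to `τ`. -/
def joinSet (τ : Finset W) (x : W) : Finset (Sym2 W) := τ.image fun t => s(x, t)

theorem joinSet_subset_iff {τ : Finset W} {x : W} {R : Finset (Sym2 W)} :
    joinSet τ x ⊆ R ↔ ∀ t ∈ τ, s(x, t) ∈ R := by
  simp [joinSet, image_subset_iff]

theorem card_joinSet (τ : Finset W) (x : W) : #(joinSet τ x) = #τ := by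
  refine card_image_of_injective _ fun t t' h => ?_
  exact Sym2.congr_right.mp h

variable {V Q : Type*} [Fintype V] [DecidableEq V] [Fintype Q] [DecidableEq Q]

/-- The elements of `V ⊕ Q` outside `τ`, from the side `V` if `b` is true and from `Q` otherwise. -/
def sideCand (b : Bool) (τ : Finset (V ⊕ Q)) : Finset (V ⊕ Q) :=
  {x | x.isLeft = b ∧ x ∉ τ}

/-- The sets of `k + 1` vertices meeting `Q` all of whose pairs lie in `R`, and containing `S`. -/
def extSet (k : ℕ) (R : Finset (Sym2 (V ⊕ Q))) (S : Finset (V ⊕ Q)) : Finset (Finset (V ⊕ Q)) :=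
  {K | (#K = k + 1 ∧ ∃ c, Sum.inr c ∈ K) ∧ pairSet K ⊆ R ∧ S ⊆ K}

theorem mem_extSet {k : ℕ} {R : Finset (Sym2 (V ⊕ Q))} {S K : Finset (V ⊕ Q)} :
    K ∈ extSet k R S ↔ (#K = k + 1 ∧ ∃ c, Sum.inr c ∈ K) ∧ pairSet K ⊆ R ∧ S ⊆ K := by
  simp [extSet]

/-- Double counting of pairs (K, x) with x ∈ K \ S. As `S` already has a colour and no two colours
are joined, all `d` missing vertices lie in `V`. -/
theorem card_extSet_mul {k : ℕ} {R : Finset (Sym2 (V ⊕ Q))}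
    (hR : ∀ c c' : Q, s(Sum.inr c, Sum.inr c') ∉ R) {S : Finset (V ⊕ Q)} {c : Q}
    (hc : Sum.inr c ∈ S) {d : ℕ} (hd : #S + d = k + 1) :
    d * #(extSet k R S) =
      ∑ x ∈ sideCand true S with joinSet S x ⊆ R, #(extSet k R (insert x S)) := by
  have h1 : ∀ x ∈ (sideCand true S).filter (fun x => joinSet S x ⊆ R), #(extSet k R (insert x S)) =
      #(bipartiteAbove (fun x (K : Finset (V ⊕ Q)) => x ∈ K) (extSet k R S) x) := by
    intro x _
    congr 1
    ext K
    simp only [mem_extSet, bipartiteAbove, mem_filter, insert_subset_iff]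
    tauto
  rw [sum_congr rfl h1, sum_card_bipartiteAbove_eq_sum_card_bipartiteBelow, mul_comm,
    ← smul_eq_mul, ← sum_const]
  refine sum_congr rfl fun K hK => ?_
  obtain ⟨⟨hcard, -⟩, hKR, hSK⟩ := mem_extSet.mp hK
  have h2 : bipartiteBelow (fun x (K : Finset (V ⊕ Q)) => x ∈ K)
      ((sideCand true S).filter (fun x => joinSet S x ⊆ R)) K = K \ S := by
    ext x
    simp only [bipartiteBelow, mem_filter, Finset.mem_sdiff, sideCand, mem_univ, true_and,
      joinSet_subset_iff]
    constructor
    · rintro ⟨⟨⟨-, h3⟩, -⟩, h4⟩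
      exact ⟨h4, h3⟩
    · rintro ⟨hxK, hxS⟩
      rw [pairSet_subset_iff] at hKR
      have hne : ∀ t ∈ S, x ≠ t := fun t ht h => hxS (h ▸ ht)
      refine ⟨⟨⟨?_, hxS⟩, fun t ht => hKR x hxK t (hSK ht) (hne t ht)⟩, hxK⟩
      rcases x with v | c'
      · rfl
      · exact absurd (hKR _ hxK _ (hSK hc) (hne _ hc)) (hR _ _)
  rw [h2, card_sdiff_of_subset hSK]
  omega

/-- The predicted number of extensions by `d` further vertices. -/
noncomputable def extPred (n q Θ : ℝ) (k : ℕ) : ℕ → ℝ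
  | 0 => 1
  | d + 1 => n * q ^ (k - d - 1) * Θ ^ (k - d) * extPred n q Θ k d / (d + 1)

theorem extPred_pos {n q Θ : ℝ} (hn : 0 < n) (hq : 0 < q) (hΘ : 0 < Θ) (k d : ℕ) :
    0 < extPred n q Θ k d := by
  induction d with
  | zero => simp [extPred]
  | succ d ih => rw [extPred]; positivity

theorem pairSet_insert_subset {R : Finset (Sym2 W)} {S : Finset W} {x : W}
    (hS : pairSet S ⊆ R) (hx : joinSet S x ⊆ R) : pairSet (insert x S) ⊆ R := by
  rw [pairSet_subset_iff] at hS ⊢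
  rw [joinSet_subset_iff] at hx
  intro y hy z hz hyz
  rcases mem_insert.mp hy with rfl | hy' <;> rcases mem_insert.mp hz with rfl | hz'
  · exact absurd rfl hyz
  · exact hx z hz'
  · rw [Sym2.eq_swap]; exact hx y hy'
  · exact hS y hy' z hz' hyz

/-- Induction on the number `d` of missing vertices. Each added vertex brings one factor 1 ± η. The
exponent of `q` is one less than that of `Θ` because the pairs with the colour are all present at
the start, so they are thinned by the process but not by the density of the graph. -/
theorem card_extSet_bounds {k : ℕ} {R : Finset (Sym2 (V ⊕ Q))} {n q Θ η : ℝ}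
    (hn : 0 < n) (hq : 0 < q) (hΘ : 0 < Θ) (hη0 : 0 ≤ η) (hη1 : η ≤ 1)
    (hR : ∀ c c' : Q, s(Sum.inr c, Sum.inr c') ∉ R)
    (hY : ∀ S : Finset (V ⊕ Q), #S ≤ k → (∃ c, Sum.inr c ∈ S) → pairSet S ⊆ R →
      |(survivors (sideCand true S) (joinSet S) R : ℝ) - n * q ^ (#S - 1) * Θ ^ #S| ≤
        η * (n * q ^ (#S - 1) * Θ ^ #S)) (d : ℕ) :
    ∀ S : Finset (V ⊕ Q), #S + d = k + 1 → (∃ c, Sum.inr c ∈ S) → pairSet S ⊆ R →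
      (1 - η) ^ d * extPred n q Θ k d ≤ #(extSet k R S) ∧
      (#(extSet k R S) : ℝ) ≤ (1 + η) ^ d * extPred n q Θ k d := by
  induction d with
  | zero =>
    intro S hS hc hSR
    have : extSet k R S = {S} := by
      ext K
      rw [mem_extSet, mem_singleton]
      constructor
      · rintro ⟨⟨h1, -⟩, -, h2⟩
        exact (eq_of_subset_of_card_le h2 (by omega)).symm
      · rintro rfl
        exact ⟨⟨by omega, hc⟩, hSR, subset_rfl⟩
    simp [this, extPred]
  | succ d ih =>
    intro S hS hc hSR
    obtain ⟨c, hcS⟩ := hc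
    have hrec := card_extSet_mul hR hcS hS
    have hrecR : ((d + 1 : ℕ) : ℝ) * #(extSet k R S) =
        ∑ x ∈ sideCand true S with joinSet S x ⊆ R, (#(extSet k R (insert x S)) : ℝ) := by
      exact_mod_cast hrec
    have hstep : ∀ x ∈ (sideCand true S).filter (fun x => joinSet S x ⊆ R),
        (1 - η) ^ d * extPred n q Θ k d ≤ #(extSet k R (insert x S)) ∧
        (#(extSet k R (insert x S)) : ℝ) ≤ (1 + η) ^ d * extPred n q Θ k d := by
      intro x hx
      obtain ⟨hx1, hx2⟩ := mem_filter.mp hx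
      simp only [sideCand, mem_filter, mem_univ, true_and] at hx1
      exact ih _ (by rw [card_insert_of_notMem hx1.2]; omega) ⟨c, mem_insert_of_mem hcS⟩
        (pairSet_insert_subset hSR hx2)
    have hyS := abs_le.mp (hY S (by omega) ⟨c, hcS⟩ hSR)
    have e1 : #S = k - d := by omega
    have e2 : #S - 1 = k - d - 1 := by omega
    rw [e2, e1] at hyS
    have hL := extPred_pos hn hq hΘ k d
    have hd : (0 : ℝ) < d + 1 := by positivity
    set y := n * q ^ (k - d - 1) * Θ ^ (k - d) with hy
    have hy0 : 0 < y := by positivity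
    have hpred : extPred n q Θ k (d + 1) = y * extPred n q Θ k d / (d + 1) := rfl
    have hsurv : (survivors (sideCand true S) (joinSet S) R : ℝ) =
      #((sideCand true S).filter (fun x => joinSet S x ⊆ R)) := rfl
    rw [hsurv] at hyS
    have hlow := card_nsmul_le_sum _ _ _ fun x hx => (hstep x hx).1
    have hup := sum_le_card_nsmul _ _ _ fun x hx => (hstep x hx).2
    rw [← hrecR, nsmul_eq_mul] at hlow hup
    push_cast at hlow hup
    have g1 : 0 ≤ (1 - η) ^ d * extPred n q Θ k d := by
      have : 0 ≤ 1 - η := by linarith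
      positivity
    have g2 : 0 ≤ (1 + η) ^ d * extPred n q Θ k d := by positivity
    constructor
    · rw [hpred, ← mul_div_assoc, div_le_iff₀ hd]
      calc (1 - η) ^ (d + 1) * (y * extPred n q Θ k d)
          = ((1 - η) * y) * ((1 - η) ^ d * extPred n q Θ k d) := by ring
        _ ≤ _ := mul_le_mul_of_nonneg_right (by linarith) g1
        _ ≤ _ := hlow
        _ = _ := by ring
    · rw [hpred, ← mul_div_assoc, le_div_iff₀ hd]
      calc _ = (d + 1 : ℝ) * #(extSet k R S) := by ring
        _ ≤ _ := hup
        _ ≤ ((1 + η) * y) * ((1 + η) ^ d * extPred n q Θ k d) :=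
          mul_le_mul_of_nonneg_right (by linarith) g2
        _ = _ := by ring

/-- Sets without elements of `Q` are extended by first choosing an element of `Q`. -/
theorem card_extSet_eq_sum {k : ℕ} {R : Finset (Sym2 (V ⊕ Q))}
    (hR : ∀ c c' : Q, s(Sum.inr c, Sum.inr c') ∉ R) {S : Finset (V ⊕ Q)}
    (hS : ∀ c, Sum.inr c ∉ S) :
    #(extSet k R S) =
      ∑ x ∈ sideCand false S with joinSet S x ⊆ R, #(extSet k R (insert x S)) := by
  have h1 : ∀ x ∈ (sideCand false S).filter (fun x => joinSet S x ⊆ R), #(extSet k R (insert x S)) =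
      #(bipartiteAbove (fun x (K : Finset (V ⊕ Q)) => x ∈ K) (extSet k R S) x) := by
    intro x _
    congr 1
    ext K
    simp only [mem_extSet, bipartiteAbove, mem_filter, insert_subset_iff]
    tauto
  rw [sum_congr rfl h1, sum_card_bipartiteAbove_eq_sum_card_bipartiteBelow, card_eq_sum_ones]
  refine sum_congr rfl fun K hK => ?_
  obtain ⟨⟨hcard, c, hc⟩, hKR, hSK⟩ := mem_extSet.mp hK
  rw [pairSet_subset_iff] at hKR
  symm
  rw [card_eq_one]
  refine ⟨Sum.inr c, ?_⟩
  ext x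
  simp only [bipartiteBelow, mem_filter, sideCand, mem_univ, true_and,
    joinSet_subset_iff, mem_singleton]
  constructor
  · rintro ⟨⟨⟨h2, -⟩, -⟩, hxK⟩
    rcases x with v | c'
    · simp at h2
    · by_contra hne
      exact hR c' c (hKR _ hxK _ hc hne)
  · rintro rfl
    refine ⟨⟨⟨rfl, hS c⟩, fun t ht => hKR _ hc _ (hSK ht) fun h => hS c (h ▸ ht)⟩, hc⟩

end Extensions

/-! ### Coloured cliques as a packing problem in the graph joined to its colours. -/

section Stage

open Finset

variable {V Q : Type*}

/-- The graph obtained from `G` by adding an independent set `Q` joined to all vertices of `G`. -/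
def augGraph (Q : Type*) (G : SimpleGraph V) : SimpleGraph (V ⊕ Q) where
  Adj
    | .inl u, .inl v => G.Adj u v
    | .inl _, .inr _ => True
    | .inr _, .inl _ => True
    | .inr _, .inr _ => False
  symm := ⟨by
    rintro (u | c) (v | c') h
    · exact SimpleGraph.Adj.symm (G := G) h
    · trivial
    · trivial
    · exact h⟩
  loopless := ⟨by
    rintro (u | c) h
    · exact G.loopless.irrefl _ h
    · exact h⟩

theorem card_filter_isLeft [DecidableEq V] [DecidableEq Q] {S : Finset (V ⊕ Q)} {c : Q} (hc : Sum.inr c ∈ S)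
    (hS : ∀ c c', Sum.inr c ∈ S → Sum.inr c' ∈ S → c = c') :
    #{x ∈ S | x.isLeft} = #S - 1 := by
  rw [← card_erase_of_mem hc]
  congr 1
  ext x
  rw [mem_filter, mem_erase]
  rcases x with v | c'
  · simp
  · simp only [Sum.isLeft_inr, Bool.false_eq_true, and_false, ne_eq, Sum.inr.injEq, false_iff,
      not_and]
    intro h h'
    exact h (hS _ _ h' hc)

variable [Fintype V] [DecidableEq V] [Fintype Q] [DecidableEq Q]

open scoped Classical in
/-- The problem of packing cliques with `k` vertices of `G`, each provided with a colour in `Q`. -/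
noncomputable def stageProblem (Q : Type*) [Fintype Q] [DecidableEq Q] (G : SimpleGraph V) (k : ℕ)
    (q : ℝ) : PackingProblem (Sym2 (V ⊕ Q)) (Finset (V ⊕ Q)) (Bool × Finset (V ⊕ Q)) (V ⊕ Q) V where
  A := {K | #K = k + 1 ∧ ∃ c, Sum.inr c ∈ K}
  h := pairSet
  R₀ := {e | e ∈ (augGraph Q G).edgeSet}
  J := {j | #j.2 ≤ k ∧ (j.1 = true → ∀ c c', Sum.inr c ∈ j.2 → Sum.inr c' ∈ j.2 → c = c') ∧
    (j.1 = false → #j.2 = 2 ∧ ∀ c, Sum.inr c ∉ j.2)}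
  cand j := sideCand j.1 j.2
  F j := joinSet j.2
  size j := #j.2
  y j := if j.1 then Fintype.card V * q ^ #{x ∈ j.2 | x.isLeft} else Fintype.card Q
  U := univ
  D u := univ.image fun v => s(Sum.inl u, Sum.inl v)

variable {G : SimpleGraph V} {k : ℕ} {q : ℝ} {R : Finset (Sym2 (V ⊕ Q))}

theorem mk_mem_stage_R₀ {x y : V ⊕ Q} :
    s(x, y) ∈ (stageProblem Q G k q).R₀ ↔ (augGraph Q G).Adj x y := by
  simp [stageProblem]

theorem inr_inr_notMem (hR : R ⊆ (stageProblem Q G k q).R₀) (c c' : Q) :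
    s(Sum.inr c, Sum.inr c') ∉ R := fun h => mk_mem_stage_R₀.mp (hR h)

theorem ne_of_mk_mem (hR : R ⊆ (stageProblem Q G k q).R₀) {x y : V ⊕ Q} (h : s(x, y) ∈ R) :
    x ≠ y := (mk_mem_stage_R₀.mp (hR h)).ne

/-- A clique of `R` contains at most one colour, so it is an admissible vertex test, and exactly `#S
- 1` of its elements carry a factor `q`. -/
theorem stage_hY {a η : ℝ} {i : ℕ} (hR : R ⊆ (stageProblem Q G k q).R₀)
    (hreg : (stageProblem Q G k q).Regular a η i R) (S : Finset (V ⊕ Q)) (hS : #S ≤ k)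
    (hc : ∃ c, Sum.inr c ∈ S) (hSR : pairSet S ⊆ R) :
    |(survivors (sideCand true S) (joinSet S) R : ℝ) -
      Fintype.card V * q ^ (#S - 1) * ((1 - a) ^ i) ^ #S| ≤
      η * (Fintype.card V * q ^ (#S - 1) * ((1 - a) ^ i) ^ #S) := by
  obtain ⟨c, hc⟩ := hc
  have huniq : ∀ c c', Sum.inr c ∈ S → Sum.inr c' ∈ S → c = c' := by
    intro c c' hc hc'
    by_contra hne
    exact inr_inr_notMem hR c c' (pairSet_subset_iff.mp hSR _ hc _ hc' (by simpa using hne))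
  have := hreg (true, S) (by simpa [stageProblem] using ⟨hS, huniq⟩)
  simpa only [PackingProblem.target, stageProblem, if_true, card_filter_isLeft hc huniq,
    pow_mul] using this

theorem stage_hZ {a η : ℝ} {i : ℕ} (hk : 2 ≤ k)
    (hreg : (stageProblem Q G k q).Regular a η i R) (S : Finset (V ⊕ Q)) (hS : #S = 2)
    (hc : ∀ c, Sum.inr c ∉ S) :
    |(survivors (sideCand false S) (joinSet S) R : ℝ) - Fintype.card Q * ((1 - a) ^ i) ^ 2| ≤
      η * (Fintype.card Q * ((1 - a) ^ i) ^ 2) := by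
  have := hreg (false, S) (by simpa [stageProblem, hS] using ⟨hk, hc⟩)
  simpa only [PackingProblem.target, stageProblem, if_false, Bool.false_eq_true, hS,
    pow_mul] using this

theorem mem_stage_avail {K : Finset (V ⊕ Q)} : K ∈ (stageProblem Q G k q).avail R ↔
    (#K = k + 1 ∧ ∃ c, Sum.inr c ∈ K) ∧ pairSet K ⊆ R := by
  rw [PackingProblem.avail, mem_filter]
  refine and_congr_left' ?_
  simp [stageProblem]

theorem stage_h (K : Finset (V ⊕ Q)) : (stageProblem Q G k q).h K = pairSet K := rfl

theorem stage_deg_eq {x y : V ⊕ Q} (hxy : x ≠ y) :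
    (stageProblem Q G k q).deg R s(x, y) = #(extSet k R {x, y}) := by
  unfold PackingProblem.deg
  congr 1
  ext K
  rw [mem_filter, mem_stage_avail, stage_h, mem_extSet, mk_mem_pairSet, insert_subset_iff,
    singleton_subset_iff]
  tauto

theorem stage_codeg_le {x t t' : V ⊕ Q} :
    (stageProblem Q G k q).codeg R s(x, t) s(x, t') ≤ #(extSet k R {x, t, t'}) := by
  unfold PackingProblem.codeg
  refine card_le_card fun K => ?_
  rw [mem_filter, mem_stage_avail, stage_h, mem_extSet, mk_mem_pairSet, mk_mem_pairSet,
    insert_subset_iff, insert_subset_iff, singleton_subset_iff]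
  tauto

theorem pairSet_mono {W : Type*} [DecidableEq W] {S T : Finset W} (h : S ⊆ T) :
    pairSet S ⊆ pairSet T := by
  rw [pairSet_subset_iff]
  intro x hx y hy hxy
  exact mk_mem_pairSet.mpr ⟨h hx, h hy, hxy⟩

theorem sideCand_false_card_le (S : Finset (V ⊕ Q)) :
    #(sideCand false S) ≤ Fintype.card Q := by
  have : sideCand false S ⊆ univ.map (Function.Embedding.inr : Q ↪ V ⊕ Q) := by
    intro x hx
    simp only [sideCand, mem_filter, mem_univ, true_and] at hx
    rcases x with v | c
    · simp at hx
    · simp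
  simpa using card_le_card this

/-- The extension counts for pairs inside `V`. -/
theorem stage_deg_left_bounds {a η : ℝ} {i m : ℕ} (hk : k = m + 3)
    (hn : 0 < (Fintype.card V : ℝ)) (hq : 0 < q) (hΘ : 0 < (1 - a) ^ i)
    (hη0 : 0 ≤ η) (hη1 : η ≤ 1)
    (hR : R ⊆ (stageProblem Q G k q).R₀) (hreg : (stageProblem Q G k q).Regular a η i R)
    {u v : V} (huv : s(Sum.inl u, Sum.inl v) ∈ R) :
    (1 - η) ^ (m + 2) * (Fintype.card Q * ((1 - a) ^ i) ^ 2 *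
        extPred (Fintype.card V) q ((1 - a) ^ i) k (m + 1)) ≤
      (stageProblem Q G k q).deg R s(Sum.inl u, Sum.inl v) ∧
    ((stageProblem Q G k q).deg R s(Sum.inl u, Sum.inl v) : ℝ) ≤
      (1 + η) ^ (m + 2) * (Fintype.card Q * ((1 - a) ^ i) ^ 2 *
        extPred (Fintype.card V) q ((1 - a) ^ i) k (m + 1)) := by
  have hne := ne_of_mk_mem hR huv
  have hcard : #({Sum.inl u, Sum.inl v} : Finset (V ⊕ Q)) = 2 := card_pair hne
  have hnoc : ∀ c : Q, Sum.inr c ∉ ({Sum.inl u, Sum.inl v} : Finset (V ⊕ Q)) := by simp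
  have hsub : pairSet {Sum.inl u, Sum.inl v} ⊆ R := by
    rw [pairSet_subset_iff]
    intro x hx y hy hxy
    simp only [mem_insert, mem_singleton] at hx hy
    rcases hx with rfl | rfl <;> rcases hy with rfl | rfl
    · exact absurd rfl hxy
    · exact huv
    · rw [Sym2.eq_swap]; exact huv
    · exact absurd rfl hxy
  -- The colour is chosen first; it accounts for one error factor 1 ± η and the remaining m + 1
  -- vertices for the others.
  rw [stage_deg_eq hne, card_extSet_eq_sum (inr_inr_notMem hR) hnoc]
  have hstep : ∀ x ∈ (sideCand false {Sum.inl u, Sum.inl v}).filter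
      (fun x => joinSet {Sum.inl u, Sum.inl v} x ⊆ R), _ := fun x hx =>
    card_extSet_bounds hn hq hΘ hη0 hη1 (inr_inr_notMem hR) (stage_hY hR hreg) (m + 1)
      (insert x {Sum.inl u, Sum.inl v})
      (by
        have hx1 := (mem_filter.mp hx).1
        simp only [sideCand, mem_filter] at hx1
        rw [card_insert_of_notMem hx1.2.2, hcard]; omega)
      (by
        have hx1 := (mem_filter.mp hx).1
        simp only [sideCand, mem_filter] at hx1
        rcases x with w | c
        · simp at hx1
        · exact ⟨c, mem_insert_self _ _⟩)
      (pairSet_insert_subset hsub (mem_filter.mp hx).2)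
  have hZ := abs_le.mp (stage_hZ (by omega) hreg _ hcard hnoc)
  have hsurv : (survivors (sideCand false {Sum.inl u, Sum.inl v})
      (joinSet {Sum.inl u, Sum.inl v}) R : ℝ) =
      #((sideCand false {Sum.inl u, Sum.inl v}).filter
        (fun x => joinSet {Sum.inl u, Sum.inl v} x ⊆ R)) := rfl
  rw [hsurv] at hZ
  have hlow := card_nsmul_le_sum _ _ _ fun x hx => (hstep x hx).1
  have hup := sum_le_card_nsmul _ _ _ fun x hx => (hstep x hx).2
  rw [nsmul_eq_mul] at hlow hup
  have hL := extPred_pos hn hq hΘ k (m + 1)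
  set L := extPred (Fintype.card V) q ((1 - a) ^ i) k (m + 1)
  set z := (Fintype.card Q : ℝ) * ((1 - a) ^ i) ^ 2
  have hη' : 0 ≤ 1 - η := by linarith
  push_cast
  constructor
  · calc (1 - η) ^ (m + 2) * (z * L) = ((1 - η) * z) * ((1 - η) ^ (m + 1) * L) := by ring
      _ ≤ _ := mul_le_mul_of_nonneg_right (by linarith) (by positivity)
      _ ≤ _ := hlow
  · calc _ ≤ _ := hup
      _ ≤ ((1 + η) * z) * ((1 + η) ^ (m + 1) * L) :=
        mul_le_mul_of_nonneg_right (by linarith) (by positivity)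
      _ = _ := by ring

/-- A vertex-colour pair lacks one more vertex of `V` but no colour. Compared with a pair inside
`V`, the factor N Θ² is replaced by n q Θ² / (m + 2), which `hN` makes no larger. Hence pairs inside
`V` attain the maximum degree up to the errors. -/
theorem stage_deg_right_le {a η : ℝ} {i m : ℕ} (hk : k = m + 3)
    (hn : 0 < (Fintype.card V : ℝ)) (hq : 0 < q) (hΘ : 0 < (1 - a) ^ i)
    (hη0 : 0 ≤ η) (hη1 : η ≤ 1) (hN : Fintype.card V * q ≤ Fintype.card Q * (m + 2))
    (hR : R ⊆ (stageProblem Q G k q).R₀) (hreg : (stageProblem Q G k q).Regular a η i R)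
    {u : V} {c : Q} (huc : s(Sum.inl u, Sum.inr c) ∈ R) :
    ((stageProblem Q G k q).deg R s(Sum.inl u, Sum.inr c) : ℝ) ≤
      (1 + η) ^ (m + 2) * (Fintype.card Q * ((1 - a) ^ i) ^ 2 *
        extPred (Fintype.card V) q ((1 - a) ^ i) k (m + 1)) := by
  have hne := ne_of_mk_mem hR huc
  have hcard : #({Sum.inl u, Sum.inr c} : Finset (V ⊕ Q)) = 2 := card_pair hne
  have hsub : pairSet {Sum.inl u, Sum.inr c} ⊆ R := by
    rw [pairSet_subset_iff]
    intro x hx y hy hxy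
    simp only [mem_insert, mem_singleton] at hx hy
    rcases hx with rfl | rfl <;> rcases hy with rfl | rfl
    · exact absurd rfl hxy
    · exact huc
    · rw [Sym2.eq_swap]; exact huc
    · exact absurd rfl hxy
  rw [stage_deg_eq hne]
  refine (card_extSet_bounds hn hq hΘ hη0 hη1 (inr_inr_notMem hR) (stage_hY hR hreg) (m + 2)
      {Sum.inl u, Sum.inr c} (by omega) ⟨c, by simp⟩ hsub).2.trans ?_
  have hL := extPred_pos hn hq hΘ k (m + 1)
  have e : extPred (Fintype.card V) q ((1 - a) ^ i) k (m + 2) =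
      Fintype.card V * q * ((1 - a) ^ i) ^ 2 *
        extPred (Fintype.card V) q ((1 - a) ^ i) k (m + 1) / (m + 2) := by
    rw [extPred]
    have h1 : k - (m + 1) - 1 = 1 := by omega
    have h2 : k - (m + 1) = 2 := by omega
    rw [h1, h2]
    push_cast
    ring
  rw [e]
  gcongr
  rw [div_le_iff₀ (by positivity)]
  calc _ = (Fintype.card V * q) * (((1 - a) ^ i) ^ 2 *
        extPred (Fintype.card V) q ((1 - a) ^ i) k (m + 1)) := by ring
    _ ≤ (Fintype.card Q * (m + 2)) * (((1 - a) ^ i) ^ 2 *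
        extPred (Fintype.card V) q ((1 - a) ^ i) k (m + 1)) := by gcongr
    _ = _ := by ring

/-- Fixing a third vertex loses a factor of the degree. If a colour is among the three, the lost
factor is the choice of colour, N Θ² ≥ N / 4. Otherwise it is the choice of a vertex, at least n q²
/ (32 k), once the number of colours is bounded by `N`. Both use Θ ≥ 1/2. -/
theorem stage_codeg_bound {a η ξ : ℝ} {i m : ℕ} (hk : k = m + 3)
    (hn : 0 < (Fintype.card V : ℝ)) (hQ : 0 < (Fintype.card Q : ℝ)) (hq : 0 < q)
    (hΘ : 1 / 2 ≤ (1 - a) ^ i)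
    (hη0 : 0 ≤ η) (hη1 : η ≤ 1) (hξ1 : 4 / Fintype.card Q ≤ ξ)
    (hξ2 : 32 * k / (Fintype.card V * q ^ 2) ≤ ξ)
    (hR : R ⊆ (stageProblem Q G k q).R₀) (hreg : (stageProblem Q G k q).Regular a η i R)
    {x t t' : V ⊕ Q} (ht : s(x, t) ∈ R) (ht' : s(x, t') ∈ R) (htt : t ≠ t') :
    ((stageProblem Q G k q).codeg R s(x, t) s(x, t') : ℝ) ≤
      ξ * ((1 + η) ^ (m + 2) * (Fintype.card Q * ((1 - a) ^ i) ^ 2 *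
        extPred (Fintype.card V) q ((1 - a) ^ i) k (m + 1))) := by
  have hΘ0 : 0 < (1 - a) ^ i := by linarith
  have hL1 := extPred_pos hn hq hΘ0 k (m + 1)
  have hL0 := extPred_pos hn hq hΘ0 k m
  have hξ0 : 0 ≤ ξ := le_trans (by positivity) hξ1
  refine (Nat.cast_le.mpr stage_codeg_le).trans ?_
  rcases (extSet k R {x, t, t'}).eq_empty_or_nonempty with h | ⟨K, hK⟩
  · rw [h]; simp; positivity
  have hsub : pairSet {x, t, t'} ⊆ R :=
    (pairSet_mono (mem_extSet.mp hK).2.2).trans (mem_extSet.mp hK).2.1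
  have hcard : #({x, t, t'} : Finset (V ⊕ Q)) = 3 :=
    card_eq_three.mpr ⟨x, t, t', ne_of_mk_mem hR ht, ne_of_mk_mem hR ht', htt, rfl⟩
  set Θ := (1 - a) ^ i
  set N : ℝ := (Fintype.card Q : ℝ)
  have hone : 1 ≤ 1 + η := by linarith
  by_cases hc : ∃ c, Sum.inr c ∈ ({x, t, t'} : Finset (V ⊕ Q))
  · refine (card_extSet_bounds hn hq hΘ0 hη0 hη1 (inr_inr_notMem hR) (stage_hY hR hreg) (m + 1)
      _ (by omega) hc hsub).2.trans ?_
    have h1 : 1 ≤ ξ * (N * Θ ^ 2) := by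
      calc (1 : ℝ) = 4 / N * (N * (1 / 2) ^ 2) := by field_simp; norm_num
        _ ≤ _ := by gcongr
    have h2 : (1 + η) ^ (m + 1) ≤ (1 + η) ^ (m + 2) := pow_le_pow_right₀ hone (by omega)
    set L := extPred (Fintype.card V) q Θ k (m + 1)
    calc (1 + η) ^ (m + 1) * L ≤ (1 + η) ^ (m + 2) * L := by gcongr
      _ = 1 * ((1 + η) ^ (m + 2) * L) := by ring
      _ ≤ ξ * (N * Θ ^ 2) * ((1 + η) ^ (m + 2) * L) := by gcongr
      _ = _ := by ring
  · rw [not_exists] at hc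
    rw [card_extSet_eq_sum (inr_inr_notMem hR) hc]
    have hstep : ∀ z ∈ (sideCand false {x, t, t'}).filter
        (fun z => joinSet {x, t, t'} z ⊆ R), (#(extSet k R (insert z {x, t, t'})) : ℝ) ≤
          (1 + η) ^ m * extPred (Fintype.card V) q Θ k m := fun z hz =>
      (card_extSet_bounds hn hq hΘ0 hη0 hη1 (inr_inr_notMem hR) (stage_hY hR hreg) m
        (insert z {x, t, t'})
        (by
          have hx1 := (mem_filter.mp hz).1
          simp only [sideCand, mem_filter] at hx1
          rw [card_insert_of_notMem hx1.2.2, hcard]; omega)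
        (by
          have hx1 := (mem_filter.mp hz).1
          simp only [sideCand, mem_filter] at hx1
          rcases z with w | c
          · simp at hx1
          · exact ⟨c, mem_insert_self _ _⟩)
        (pairSet_insert_subset hsub (mem_filter.mp hz).2)).2
    push_cast
    refine (sum_le_card_nsmul _ _ _ hstep).trans ?_
    rw [nsmul_eq_mul]
    have hcardN : (#((sideCand false {x, t, t'}).filter
        (fun z => joinSet {x, t, t'} z ⊆ R)) : ℝ) ≤ N :=
      Nat.cast_le.mpr ((card_filter_le _ _).trans (sideCand_false_card_le _))
    have e : extPred (Fintype.card V) q Θ k (m + 1) =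
        Fintype.card V * q ^ 2 * Θ ^ 3 * extPred (Fintype.card V) q Θ k m / (m + 1) := by
      rw [extPred]
      have h1 : k - m - 1 = 2 := by omega
      have h2 : k - m = 3 := by omega
      rw [h1, h2]
    rw [e]
    set L := extPred (Fintype.card V) q Θ k m
    set n : ℝ := (Fintype.card V : ℝ)
    have h1 : 1 ≤ ξ * (n * q ^ 2 * Θ ^ 5 / (m + 1)) := by
      calc (1 : ℝ) ≤ k / (m + 1) := by
            rw [le_div_iff₀ (by positivity), hk]; push_cast; linarith
        _ = 32 * k / (n * q ^ 2) * (n * q ^ 2 * (1 / 2) ^ 5 / (m + 1)) := by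
            field_simp; norm_num
        _ ≤ _ := by gcongr
    have h2 : (1 + η) ^ m ≤ (1 + η) ^ (m + 2) := pow_le_pow_right₀ hone (by omega)
    calc _ ≤ N * ((1 + η) ^ m * L) := by gcongr
      _ ≤ N * ((1 + η) ^ (m + 2) * L) := by gcongr
      _ = 1 * (N * ((1 + η) ^ (m + 2) * L)) := by ring
      _ ≤ ξ * (n * q ^ 2 * Θ ^ 5 / (m + 1)) * (N * ((1 + η) ^ (m + 2) * L)) := by gcongr
      _ = _ := by ring

/-- The upper extension count for pairs inside `V` serves as the maximum degree. Only pairs inside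
`V` need a matching lower bound, because the sets `D u` contain no others. -/
theorem stage_nearlyRegular {a η ξ : ℝ} {i m : ℕ} (hk : k = m + 3)
    (hn : 0 < (Fintype.card V : ℝ)) (hQ : 0 < (Fintype.card Q : ℝ)) (hq : 0 < q)
    (hΘ : 1 / 2 ≤ (1 - a) ^ i) (hη0 : 0 ≤ η) (hη1 : η ≤ 1)
    (hN : Fintype.card V * q ≤ Fintype.card Q * (m + 2)) (hξ1 : 4 / Fintype.card Q ≤ ξ)
    (hξ2 : 32 * k / (Fintype.card V * q ^ 2) ≤ ξ)
    (hR : R ⊆ (stageProblem Q G k q).R₀) (hreg : (stageProblem Q G k q).Regular a η i R) :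
    (stageProblem Q G k q).NearlyRegular ξ (2 * k * η) ((1 + η) ^ (m + 2) *
      (Fintype.card Q * ((1 - a) ^ i) ^ 2 *
        extPred (Fintype.card V) q ((1 - a) ^ i) k (m + 1))) R := by
  have hΘ0 : 0 < (1 - a) ^ i := by linarith
  have hL1 := extPred_pos hn hq hΘ0 k (m + 1)
  have hη' : 0 < 1 + η := by linarith
  constructor
  · positivity
  · intro e he
    induction e with
    | _ x y =>
      rcases x with u | c <;> rcases y with v | c'
      · exact (stage_deg_left_bounds hk hn hq hΘ0 hη0 hη1 hR hreg he).2
      · exact stage_deg_right_le hk hn hq hΘ0 hη0 hη1 hN hR hreg he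
      · rw [Sym2.eq_swap] at he ⊢
        exact stage_deg_right_le hk hn hq hΘ0 hη0 hη1 hN hR hreg he
      · exact absurd he (inr_inr_notMem hR _ _)
  · intro u _ e he heR
    simp only [stageProblem, mem_image, mem_univ, true_and] at he
    obtain ⟨v, rfl⟩ := he
    refine le_trans ?_ (stage_deg_left_bounds hk hn hq hΘ0 hη0 hη1 hR hreg heR).1
    rw [← mul_assoc]
    refine mul_le_mul_of_nonneg_right ?_ (by positivity)
    -- The ratio of the two bounds is ((1 - η)/(1 + η))^(m+2). It is at least (1 - 2η)^(m+2) when 2η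
    -- ≤ 1, since (1 - 2η)(1 + η) ≤ 1 - η, and Bernoulli's inequality finishes. If 1 - 2kη ≤ 0 there
    -- is nothing to prove.
    have h1 : 1 - 2 * k * η ≤ (1 - 2 * η) ^ (m + 2) ∨ 1 - 2 * k * η ≤ 0 := by
      left
      have h2 := one_add_mul_le_pow (show (-2 : ℝ) ≤ -(2 * η) by linarith) (m + 2)
      rw [← sub_eq_add_neg] at h2
      refine le_trans ?_ h2
      rw [hk]; push_cast; nlinarith
    by_cases h0 : 1 - 2 * k * η ≤ 0
    · exact (mul_nonpos_of_nonpos_of_nonneg h0 (by positivity)).trans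
        (pow_nonneg (by linarith) _)
    · rcases h1 with h1 | h1
      · have h3 : 0 ≤ 1 - 2 * η := by
          have hk1 : (1 : ℝ) ≤ k := by rw [hk]; push_cast; linarith
          nlinarith
        calc (1 - 2 * k * η) * (1 + η) ^ (m + 2) ≤ (1 - 2 * η) ^ (m + 2) * (1 + η) ^ (m + 2) := by
              gcongr
          _ = ((1 - 2 * η) * (1 + η)) ^ (m + 2) := by rw [mul_pow]
          _ ≤ (1 - η) ^ (m + 2) := by
              gcongr; nlinarith
      · exact absurd h1 h0
  · rintro ⟨b, τ⟩ _ x _ hF e he e' he' hne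
    simp only [stageProblem, joinSet, mem_image] at he he'
    obtain ⟨t, ht, rfl⟩ := he
    obtain ⟨t', ht', rfl⟩ := he'
    have hF' : ∀ t ∈ τ, s(x, t) ∈ R := joinSet_subset_iff.mp hF
    exact stage_codeg_bound hk hn hQ hq hΘ hη0 hη1 hξ1 hξ2 hR hreg (hF' t ht) (hF' t' ht')
      fun h => hne (h ▸ rfl)

end Stage

/-! ### One stage: from a packing to a partial decomposition into coloured cliques. -/

section StageTheorem

open Finset

namespace SimpleGraph

variable {V : Type*}

/-- `G` has a partition into cliques with at least two vertices and chromatic index at most `t`. -/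
def HasColoredPartition [DecidableEq V] (G : SimpleGraph V) (t : ℕ) : Prop :=
  ∃ (C : Finset (Finset V)) (f : Finset V → ℕ), G.IsCliquePartition C ∧ (∀ K ∈ C, 2 ≤ #K) ∧
    HypergraphParam.IsProperEdgeColoring C t f

open scoped Classical in
/-- The set of vertices adjacent to all elements of `S`. -/
noncomputable def commonNbrs [Fintype V] (G : SimpleGraph V) (S : Finset V) : Finset V :=
  {v | ∀ s ∈ S, G.Adj v s}

theorem mem_commonNbrs [Fintype V] {G : SimpleGraph V} {S : Finset V} {v : V} :
    v ∈ G.commonNbrs S ↔ ∀ s ∈ S, G.Adj v s := by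
  simp [commonNbrs]

/-- All sets of at most `k` vertices have about as many common neighbours as in a random graph of
density `q`. -/
def IsCodegreeRegular [Fintype V] (G : SimpleGraph V) (q η : ℝ) (k : ℕ) : Prop :=
  ∀ S : Finset V, #S ≤ k →
    |(#(G.commonNbrs S) : ℝ) - Fintype.card V * q ^ #S| ≤ η * (Fintype.card V * q ^ #S)

end SimpleGraph

variable {V Q : Type*} [Fintype V] [DecidableEq V] [Fintype Q] [DecidableEq Q]
variable {G : SimpleGraph V} {k : ℕ} {q : ℝ} {R : Finset (Sym2 (V ⊕ Q))}

theorem survivors_true_eq (hR : R ⊆ (stageProblem Q G k q).R₀) (τ : Finset (V ⊕ Q)) :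
    survivors (sideCand true τ) (joinSet τ) R =
      #{v : V | ∀ t ∈ τ, s(Sum.inl v, t) ∈ R} := by
  unfold survivors
  rw [← card_map (Function.Embedding.inl : V ↪ V ⊕ Q)]
  congr 1
  ext x
  simp only [sideCand, mem_filter, mem_univ, true_and, joinSet_subset_iff, Finset.mem_map,
    Function.Embedding.inl_apply]
  constructor
  · rintro ⟨⟨h1, h2⟩, h3⟩
    rcases x with v | c
    · exact ⟨v, h3, rfl⟩
    · simp at h1
  · rintro ⟨v, h, rfl⟩
    exact ⟨⟨rfl, fun hv => ne_of_mk_mem hR (h _ hv) rfl⟩, h⟩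

/-- At the start all pairs between vertices and colours are present, so colour tests are exact and a
vertex test depends only on its part in `V`, where the codegree hypothesis applies. -/
theorem stage_init {a η₀ : ℝ} (hη₀ : 0 ≤ η₀) (hG : G.IsCodegreeRegular q η₀ k) :
    (stageProblem Q G k q).Regular a η₀ 0 (stageProblem Q G k q).R₀ := by
  rintro ⟨b, τ⟩ hj
  have hJ : #τ ≤ k ∧ (b = true → ∀ c c', Sum.inr c ∈ τ → Sum.inr c' ∈ τ → c = c') ∧
    (b = false → #τ = 2 ∧ ∀ c, Sum.inr c ∉ τ) := by
      simpa only [stageProblem, mem_filter, mem_univ, true_and] using hj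
  have hF : (stageProblem Q G k q).F (b, τ) = joinSet τ := rfl
  have hc : (stageProblem Q G k q).cand (b, τ) = sideCand b τ := rfl
  rw [PackingProblem.target, zero_mul, pow_zero, mul_one, hF, hc]
  cases b
  · have hy : (stageProblem Q G k q).y (false, τ) = Fintype.card Q := by simp [stageProblem]
    have hnoc := (hJ.2.2 rfl).2
    have : survivors (sideCand false τ) (joinSet τ) (stageProblem Q G k q).R₀ =
        Fintype.card Q := by
      unfold survivors
      rw [← card_univ, ← card_map (Function.Embedding.inr : Q ↪ V ⊕ Q)]
      congr 1
      ext x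
      simp only [sideCand, mem_filter, mem_univ, true_and, joinSet_subset_iff, Finset.mem_map,
        Function.Embedding.inr_apply]
      constructor
      · rintro ⟨⟨h1, h2⟩, h3⟩
        rcases x with v | c
        · simp at h1
        · exact ⟨c, rfl⟩
      · rintro ⟨c, rfl⟩
        refine ⟨⟨rfl, hnoc c⟩, fun t ht => ?_⟩
        rcases t with v | c'
        · exact mk_mem_stage_R₀.mpr trivial
        · exact absurd ht (hnoc c')
    rw [hy, this, sub_self, abs_zero]
    positivity
  · set S : Finset V := {v | Sum.inl v ∈ τ} with hS
    have hcard : #{x ∈ τ | x.isLeft} = #S := by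
      rw [← card_map (Function.Embedding.inl : V ↪ V ⊕ Q)]
      congr 1
      ext x
      rcases x with v | c <;> simp [hS]
    have hy : (stageProblem Q G k q).y (true, τ) = Fintype.card V * q ^ #S := by
      simp only [stageProblem, if_true, hcard]
    have : survivors (sideCand true τ) (joinSet τ) (stageProblem Q G k q).R₀ =
        #(G.commonNbrs S) := by
      rw [survivors_true_eq subset_rfl]
      congr 1
      ext v
      rw [SimpleGraph.mem_commonNbrs, mem_filter]
      simp only [mem_univ, true_and, hS, mem_filter]
      constructor
      · intro h s hs
        exact mk_mem_stage_R₀.mp (h _ hs)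
      · rintro h (u | c) ht
        · exact mk_mem_stage_R₀.mpr (h u ht)
        · exact mk_mem_stage_R₀.mpr trivial
    rw [hy, this]
    refine hG S (le_trans ?_ hJ.1)
    rw [← hcard]
    exact card_filter_le _ _

/-- A set of at most `k` elements is the set of values of a map from `Fin k` to `Option W`, with
`none` as padding. -/
theorem card_finset_card_le (W : Type*) [Fintype W] [DecidableEq W] (k : ℕ) :
    #{τ : Finset W | #τ ≤ k} ≤ (Fintype.card W + 1) ^ k := by
  have h : ({τ : Finset W | #τ ≤ k} : Finset (Finset W)) ⊆
      (univ : Finset (Fin k → Option W)).image (fun g => univ.filter fun w => ∃ i, g i = some w) := by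
    intro τ hτ
    rw [mem_filter] at hτ
    rw [mem_image]
    refine ⟨fun i => if h : (i : ℕ) < #τ then some (τ.equivFin.symm ⟨i, h⟩) else none,
      mem_univ _, ?_⟩
    ext w
    rw [mem_filter]
    constructor
    · rintro ⟨-, i, hi⟩
      dsimp only at hi
      split_ifs at hi with h
      · simp only [Option.some.injEq] at hi
        rw [← hi]
        exact Subtype.prop _
    · intro hw
      refine ⟨mem_univ _, ⟨τ.equivFin ⟨w, hw⟩, by have := (τ.equivFin ⟨w, hw⟩).2; omega⟩, ?_⟩
      simp
  refine (card_le_card h).trans (card_image_le.trans ?_)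
  simp

theorem card_stage_J_le : #(stageProblem Q G k q).J ≤
    2 * (Fintype.card V + Fintype.card Q + 1) ^ k := by
  have h : (stageProblem Q G k q).J ⊆
      (univ : Finset Bool) ×ˢ (univ.filter fun τ : Finset (V ⊕ Q) => #τ ≤ k) := by
    rintro ⟨b, τ⟩ hj
    have hJ : #τ ≤ k ∧ (b = true → ∀ c c', Sum.inr c ∈ τ → Sum.inr c' ∈ τ → c = c') ∧
      (b = false → #τ = 2 ∧ ∀ c, Sum.inr c ∉ τ) := by
        simpa only [stageProblem, mem_filter, mem_univ, true_and] using hj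
    simp [hJ.1]
  refine (card_le_card h).trans ?_
  rw [card_product, card_univ, Fintype.card_bool, ← Fintype.card_sum]
  gcongr
  exact card_finset_card_le _ _

theorem card_stage_R₀_le : (#(stageProblem Q G k q).R₀ : ℝ) ≤
    ((Fintype.card V : ℝ) + Fintype.card Q) ^ 2 := by
  have h : #(stageProblem Q G k q).R₀ ≤ (Fintype.card V + Fintype.card Q) ^ 2 := by
    have h1 : (stageProblem Q G k q).R₀ ⊆
        (univ : Finset ((V ⊕ Q) × (V ⊕ Q))).image fun p => s(p.1, p.2) := by
      intro e _
      induction e with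
      | _ x y => exact mem_image.mpr ⟨(x, y), mem_univ _, rfl⟩
    refine (card_le_card h1).trans (card_image_le.trans ?_)
    rw [card_univ, Fintype.card_prod, Fintype.card_sum, sq]
  exact_mod_cast h

/-- A packing in the augmented graph gives cliques with a proper colouring. -/
theorem hasColoredPartition_of_packing {M : Finset (Finset (V ⊕ Q))} (hk : 2 ≤ k)
    (hM : ∀ K ∈ M, #K = k + 1 ∧ ∃ c, Sum.inr c ∈ K)
    (hdisj : ∀ H ∈ M, ∀ H' ∈ M, H ≠ H' → Disjoint (pairSet H) (pairSet H'))
    (hsub : ∀ H ∈ M, pairSet H ⊆ (stageProblem Q G k q).R₀)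
    {G₁ : SimpleGraph V}
    (hG₁ : ∀ u v, G₁.Adj u v ↔ ∃ H ∈ M, s(Sum.inl u, Sum.inl v) ∈ pairSet H) :
    G₁.HasColoredPartition (Fintype.card Q) := by
  classical
  set g : Finset (V ⊕ Q) → Finset V := fun K => univ.filter fun v => Sum.inl v ∈ K with hg
  have mem_g : ∀ {K v}, v ∈ g K ↔ Sum.inl v ∈ K := by intro K v; simp [hg]
  rcases M.eq_empty_or_nonempty with rfl | ⟨K₀, hK₀⟩
  · refine ⟨∅, fun _ => 0, ⟨by simp, fun u v huv => ?_⟩, by simp, by simp, by simp⟩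
    obtain ⟨H, hH, -⟩ := (hG₁ u v).mp huv
    exact absurd hH (notMem_empty H)
  have : Nonempty Q := ⟨(hM K₀ hK₀).2.choose⟩
  choose! col hcol using fun K hK => (hM K hK).2
  have huniq : ∀ H ∈ M, ∀ c, Sum.inr c ∈ H → c = col H := by
    intro H hH c hc
    by_contra hne
    exact inr_inr_notMem (hsub H hH) c (col H)
      (mk_mem_pairSet.mpr ⟨hc, hcol H hH, by simpa using hne⟩)
  have hcardg : ∀ H ∈ M, #(g H) = k := by
    intro H hH
    have h1 := (hM H hH).1
    have h2 : H = insert (Sum.inr (col H)) ((g H).map Function.Embedding.inl) := by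
      ext x
      rcases x with v | c
      · simp [hg]
      · simp only [mem_insert, Sum.inr.injEq, Finset.mem_map, Function.Embedding.inl_apply, reduceCtorEq,
          and_false, exists_false, or_false]
        exact ⟨fun h => huniq H hH c h, fun h => h ▸ hcol H hH⟩
    rw [h2, card_insert_of_notMem (by simp), card_map] at h1
    omega
  -- Edge-disjointness in the form used twice below: with two vertices it gives uniqueness of the
  -- covering clique, with a vertex and a colour it gives properness.
  have key : ∀ H ∈ M, ∀ H' ∈ M, ∀ x y, x ≠ y → x ∈ H → y ∈ H → x ∈ H' → y ∈ H' → H = H' := by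
    intro H hH H' hH' x y hxy h1 h2 h3 h4
    by_contra hne
    exact disjoint_left.mp (hdisj H hH H' hH' hne) (mk_mem_pairSet.mpr ⟨h1, h2, hxy⟩)
      (mk_mem_pairSet.mpr ⟨h3, h4, hxy⟩)
  have hinj : ∀ H ∈ M, ∀ H' ∈ M, g H = g H' → H = H' := by
    intro H hH H' hH' h
    obtain ⟨u, hu, v, hv, huv⟩ := one_lt_card.mp (by rw [hcardg H hH]; omega : 1 < #(g H))
    exact key H hH H' hH' (Sum.inl u) (Sum.inl v) (by simpa using huv) (mem_g.mp hu)
      (mem_g.mp hv) (mem_g.mp (h ▸ hu)) (mem_g.mp (h ▸ hv))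
  choose! lift hlift using fun (e : Finset V) (he : e ∈ M.image g) => mem_image.mp he
  refine ⟨M.image g, fun e => (Fintype.equivFin Q (col (lift e)) : ℕ), ⟨?_, ?_⟩, ?_, ?_, ?_⟩
  · intro K hK u hu v hv huv
    obtain ⟨H, hH, rfl⟩ := mem_image.mp hK
    rw [hG₁]
    exact ⟨H, hH, mk_mem_pairSet.mpr ⟨mem_g.mp hu, mem_g.mp hv, by simpa using huv⟩⟩
  · intro u v huv
    obtain ⟨H, hH, hmem⟩ := (hG₁ u v).mp huv
    obtain ⟨h1, h2, h3⟩ := mk_mem_pairSet.mp hmem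
    refine ⟨g H, ⟨mem_image_of_mem _ hH, mem_g.mpr h1, mem_g.mpr h2⟩, ?_⟩
    rintro K ⟨hK, hu, hv⟩
    obtain ⟨H', hH', rfl⟩ := mem_image.mp hK
    rw [key H hH H' hH' _ _ h3 h1 h2 (mem_g.mp hu) (mem_g.mp hv)]
  · intro K hK
    obtain ⟨H, hH, rfl⟩ := mem_image.mp hK
    rw [hcardg H hH]
    exact hk
  · intro e _
    exact Fin.is_lt _
  · intro e he e' he' hne hinter heq
    obtain ⟨v, hv⟩ := hinter
    rw [mem_inter] at hv
    have h1 := hlift e he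
    have h2 := hlift e' he'
    have hceq : col (lift e) = col (lift e') := (Fintype.equivFin Q).injective (Fin.ext heq)
    have h3 : lift e = lift e' := by
      refine key _ h1.1 _ h2.1 (Sum.inl v) (Sum.inr (col (lift e))) (by simp) ?_
        (hcol _ h1.1) ?_ ?_
      · rw [← mem_g, h1.2]; exact hv.1
      · rw [← mem_g, h2.2]; exact hv.2
      · rw [hceq]; exact hcol _ h2.1
    exact hne (by rw [← h1.2, ← h2.2, h3])

open scoped Classical in
/-- A codegree-regular graph of density `q` decomposes into coloured cliques of order `k`,
a codegree-regular graph of density `q / 2`, and a graph of small maximum degree. -/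
theorem exists_stage_decomposition {m T N : ℕ} {a ξ η₀ η lam Y : ℝ}
    (hk : k = m + 3) (hn : 1 ≤ Fintype.card V) (hNpos : 0 < N) (hq0 : 0 < q) (hq1 : q ≤ 1)
    (haT : (1 - a) ^ T = 1 / 2) (ha0 : 0 < a) (ha1 : a ≤ 1) (haξ : a ≤ ξ)
    (hacard : a * ((Fintype.card V : ℝ) + N) ^ 2 ≤ 1) (hak : k * a ≤ 1 / 2)
    (hN : Fintype.card V * q ≤ N * (m + 2)) (hξ1 : 4 / N ≤ ξ)
    (hξ2 : 32 * k / (Fintype.card V * q ^ 2) ≤ ξ)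
    (hη₀ : 0 ≤ η₀) (hη0 : 0 ≤ η) (hη1 : η ≤ 1)
    (hYpos : 0 < Y) (hY1 : Y ≤ Fintype.card V * (q / 2) ^ k) (hY2 : Y ≤ N / 4)
    (hlam : 0 < lam) (hlam_small : lam * (4 * (k * a) + 2 * (k + 1) / Y) ≤ 1)
    (hmu : lam * (4 * k ^ 2 * ξ) + lam ^ 2 * (32 * k ^ 2 * a + 16 * (k + 1) * k / Y) ≤ 1)
    (hW : 1 ≤ Fintype.card V * (2 * k * η))
    (hfin : Real.exp 2 * (4 * (Fintype.card V + N + 1 : ℝ) ^ k + Fintype.card V) ≤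
      Real.exp (lam * (η - η₀)))
    (hG : G.IsCodegreeRegular q η₀ k) :
    ∃ G₁ G' : SimpleGraph V, G₁ ≤ G ∧ G' ≤ G ∧ Disjoint G₁ G' ∧ G₁.HasColoredPartition N ∧
      G'.IsCodegreeRegular (q / 2) η k ∧
      ∀ u, (#{v | G.Adj u v ∧ ¬ G₁.Adj u v ∧ ¬ G'.Adj u v} : ℝ) ≤
        Fintype.card V * (2 * k * η) * (lam * (η - η₀)) := by
  set P := stageProblem (Fin N) G k q with hP
  have hcN : Fintype.card (Fin N) = N := Fintype.card_fin N
  have hnR : (1 : ℝ) ≤ Fintype.card V := by exact_mod_cast hn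
  -- Otherwise 1/2 = (1 - a)^T ≤ e^{-aT} < 1/e < 1/2.
  have hT1 : a * T ≤ 1 := by
    have h1 : (1 - a) ^ T ≤ Real.exp (-(a * T)) := by
      have : 1 - a ≤ Real.exp (-a) := by linarith [Real.add_one_le_exp (-a)]
      calc (1 - a) ^ T ≤ Real.exp (-a) ^ T := by
            have : 0 ≤ 1 - a := by linarith
            gcongr
        _ = _ := by rw [← Real.exp_nat_mul]; ring_nf
    rw [haT] at h1
    by_contra hcon
    push Not at hcon
    have h2 : Real.exp (-(a * T)) < Real.exp (-1) := Real.exp_lt_exp.mpr (by linarith)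
    have h3 := Real.exp_neg_one_lt_half
    linarith
  have hΘ : ∀ i ≤ T, 1 / 2 ≤ (1 - a) ^ i := fun i hi => by
    rw [← haT]
    exact pow_le_pow_of_le_one (by linarith) (by linarith) hi
  have hadm : P.Admissible T k a ξ (2 * k * η) η₀ η lam (k + 1)
      (Fintype.card V * (2 * k * η)) Y := by
    constructor
    · intro K hK
      have hK' : #K = k + 1 := by
        have : #K = k + 1 ∧ ∃ c, Sum.inr c ∈ K := by
          simpa [hP, stageProblem] using hK
        exact this.1
      obtain ⟨x, hx, y, hy, hxy⟩ := one_lt_card.mp (by omega : 1 < #K)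
      exact ⟨s(x, y), mk_mem_pairSet.mpr ⟨hx, hy, hxy⟩⟩
    · intro j _ x _
      exact card_joinSet _ _
    · rintro ⟨b, τ⟩ hj
      rw [hP, stageProblem, mem_filter] at hj
      exact hj.2.1
    · rintro K hK ⟨b, τ⟩ _
      have hK' : #K = k + 1 := by
        have : #K = k + 1 ∧ ∃ c, Sum.inr c ∈ K := by
          simpa [hP, stageProblem] using hK
        exact this.1
      -- Every pair of the test set at `x` contains `x`, so a clique `K` can only hit the test sets
      -- of its own k + 1 vertices; this is the value of `B`.
      have : ({x ∈ P.cand (b, τ) | ¬ Disjoint (P.F (b, τ) x) (P.h K)} : Finset _) ⊆ K := by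
        intro x hx
        obtain ⟨e, he1, he2⟩ := not_disjoint_iff.mp (mem_filter.mp hx).2
        obtain ⟨t, ht, rfl⟩ := mem_image.mp he1
        exact (mk_mem_pairSet.mp he2).1
      have h2 := card_le_card this
      rw [hK'] at h2
      exact_mod_cast h2
    · rintro e ⟨b, τ⟩ _
      induction e with
      | _ x y =>
        have : ({z ∈ P.cand (b, τ) | s(x, y) ∈ P.F (b, τ) z} : Finset _) ⊆ {x, y} := by
          intro z hz
          obtain ⟨t, ht, h⟩ := mem_image.mp (mem_filter.mp hz).2
          rw [Sym2.eq_iff] at h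
          rw [mem_insert, mem_singleton]
          tauto
        have h2 := (card_le_card this).trans card_le_two
        have h3 : (2 : ℝ) ≤ k + 1 := by rw [hk]; push_cast; linarith
        exact le_trans (by exact_mod_cast h2) h3
    · positivity
    · exact ha0
    · exact haξ
    · refine le_trans ?_ hacard
      have := card_stage_R₀_le (Q := Fin N) (G := G) (k := k) (q := q)
      rw [hcN] at this
      gcongr
    · exact hak
    · exact hT1
    · exact hYpos
    · rintro ⟨b, τ⟩ hj
      have hJ : #τ ≤ k ∧ (b = true → ∀ c c', Sum.inr c ∈ τ → Sum.inr c' ∈ τ → c = c') ∧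
        (b = false → #τ = 2 ∧ ∀ c, Sum.inr c ∉ τ) := by
          simpa only [hP, stageProblem, mem_filter, mem_univ, true_and] using hj
      have hsz : P.size (b, τ) = #τ := rfl
      rw [hsz, pow_mul, haT]
      cases b
      · have hy : P.y (false, τ) = N := by simp [hP, stageProblem]
        rw [hy, (hJ.2.2 rfl).1]
        linarith
      · have hy : P.y (true, τ) = Fintype.card V * q ^ #{x ∈ τ | x.isLeft} := by
          simp [hP, stageProblem]
        rw [hy, mul_assoc]
        refine hY1.trans (mul_le_mul_of_nonneg_left ?_ (by positivity))
        rw [div_eq_mul_one_div, mul_pow]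
        refine mul_le_mul ?_ ?_ (by positivity) (by positivity)
        · exact pow_le_pow_of_le_one hq0.le hq1 ((card_filter_le _ _).trans hJ.1)
        · exact pow_le_pow_of_le_one (by norm_num) (by norm_num) hJ.1
    · exact hlam
    · exact hlam_small
    · exact hmu
    · exact hη1
    · exact hW
    · positivity
    · intro u _
      gcongr
      exact card_image_le
    · exact stage_init hη₀ hG
    · refine le_trans ?_ hfin
      have h1 := card_stage_J_le (Q := Fin N) (G := G) (k := k) (q := q)
      rw [hcN] at h1
      have h2 : (#P.J : ℝ) ≤ 2 * (Fintype.card V + N + 1 : ℝ) ^ k := by exact_mod_cast h1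
      have h3 : #P.U = Fintype.card V := card_univ
      rw [h3]
      refine mul_le_mul_of_nonneg_left ?_ (Real.exp_pos _).le
      linarith
  obtain ⟨M, hMA, R, hR, hRreg, hdisj, hMR, hwaste⟩ := 
    PackingProblem.exists_packing hadm (fun i hi R hR hreg => ⟨_, stage_nearlyRegular hk
      (by linarith) (by rw [hcN]; exact_mod_cast hNpos) hq0 (hΘ i hi.le) hη0 hη1
      (by rw [hcN]; exact hN) (by rw [hcN]; exact hξ1) hξ2 hR hreg⟩)
  have hMA' : ∀ K ∈ M, #K = k + 1 ∧ ∃ c, Sum.inr c ∈ K := fun K hK => by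
    simpa [hP, stageProblem] using hMA hK
  let G₁ : SimpleGraph V :=
    { Adj := fun u v => ∃ H ∈ M, s(Sum.inl u, Sum.inl v) ∈ pairSet H
      symm := ⟨fun u v ⟨H, hH, h⟩ => ⟨H, hH, by rwa [Sym2.eq_swap]⟩⟩
      loopless := ⟨fun u ⟨H, hH, h⟩ => (mk_mem_pairSet.mp h).2.2 rfl⟩ }
  let G' : SimpleGraph V :=
    { Adj := fun u v => s(Sum.inl u, Sum.inl v) ∈ R
      symm := ⟨fun u v h => by rwa [Sym2.eq_swap]⟩
      loopless := ⟨fun u h => ne_of_mk_mem hR h rfl⟩ }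
  refine ⟨G₁, G', ?_, ?_, ?_, ?_, ?_, ?_⟩
  · rintro u v ⟨H, hH, h⟩
    exact mk_mem_stage_R₀.mp ((hMR H hH).1 h)
  · intro u v h
    exact mk_mem_stage_R₀.mp (hR h)
  · rw [disjoint_iff]
    ext u v
    simp only [SimpleGraph.inf_adj, SimpleGraph.bot_adj, iff_false, not_and]
    rintro ⟨H, hH, h⟩ h'
    exact disjoint_left.mp (hMR H hH).2 h h'
  · have := hasColoredPartition_of_packing (by omega) hMA' hdisj (fun H hH => (hMR H hH).1)
      (G₁ := G₁) (fun u v => Iff.rfl)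
    rwa [hcN] at this
  · intro S hS
    have h1 := hRreg (true, S.map Function.Embedding.inl) (by
      simpa [hP, stageProblem] using hS)
    have hy : P.target a T (true, S.map Function.Embedding.inl) =
        Fintype.card V * (q / 2) ^ #S := by
      have hy1 : P.y (true, S.map Function.Embedding.inl) = Fintype.card V * q ^ #S := by
        have : #{x ∈ S.map (Function.Embedding.inl : V ↪ V ⊕ Fin N) | x.isLeft} = #S := by
          rw [filter_true_of_mem, card_map]
          simp
        simp only [hP, stageProblem, if_true, this]
      have hsz : P.size (true, S.map Function.Embedding.inl) = #S := card_map _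
      rw [PackingProblem.target, hy1, hsz, pow_mul, haT, mul_assoc, ← mul_pow]
      ring
    have hs : survivors (P.cand (true, S.map Function.Embedding.inl))
        (P.F (true, S.map Function.Embedding.inl)) R = #(G'.commonNbrs S) := by
      refine (survivors_true_eq hR _).trans ?_
      congr 1
      ext v
      rw [SimpleGraph.mem_commonNbrs, mem_filter]
      simp [G']
    rwa [hy, hs] at h1
  · intro u
    refine le_trans ?_ (hwaste u (mem_univ u))
    rw [← card_map (Function.Embedding.inl : V ↪ V ⊕ Fin N)]
    -- Uncovered neighbours of `u` inject into the wasted elements of `D u`.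
    refine Nat.cast_le.mpr (card_le_card_of_injOn (fun x => s(Sum.inl u, x)) ?_ ?_)
    · intro x hx
      simp only [coe_map, Set.mem_image, mem_coe, mem_filter, mem_univ, true_and,
        Function.Embedding.inl_apply] at hx
      obtain ⟨v, ⟨h1, h2, h3⟩, rfl⟩ := hx
      simp only [coe_filter]
      exact (⟨mem_image_of_mem _ (mem_univ v),
        mk_mem_stage_R₀.mpr h1, h3, fun H hH h => h2 ⟨H, hH, h⟩⟩)
    · intro x _ y _ h
      exact Sym2.congr_right.mp h

end StageTheorem

/-! ### Greedy colouring, unions of coloured partitions, and inequalities between the parameters. -/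

section Deterministic

open Finset

open HypergraphParam

theorem HypergraphParam.degree_mono {V : Type*} [DecidableEq V] {H H' : Finset (Finset V)}
    (h : H ⊆ H') (v : V) : degree H v ≤ degree H' v :=
  card_le_card (filter_subset_filter _ h)

/-- Greedy colouring of a family of pairs of bounded degree. -/
theorem HypergraphParam.exists_isProperEdgeColoring_of_degree_le {V : Type*} [DecidableEq V]
    {D : ℕ} (H : Finset (Finset V)) (hcard : ∀ e ∈ H, #e = 2) (hdeg : ∀ v, degree H v ≤ D) :
    ∃ f, IsProperEdgeColoring H (2 * D + 1) f := by
  induction H using Finset.induction_on with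
  | empty => exact ⟨fun _ => 0, by simp [IsProperEdgeColoring]⟩
  | insert e H he ih =>
    obtain ⟨f, hf1, hf2⟩ := ih (fun e' h => hcard e' (mem_insert_of_mem h)) fun v =>
      (degree_mono (subset_insert e H) v).trans (hdeg v)
    obtain ⟨u, v, huv, rfl⟩ := card_eq_two.mp (hcard e (mem_insert_self _ _))
    -- The edges that conflict with the new pair: at most `D` at each end, so one of 2D + 1 colours
    -- is free.
    set X := (H.filter fun e' => u ∈ e') ∪ (H.filter fun e' => v ∈ e')
    have hX : #(X.image f) < #(range (2 * D + 1)) := by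
      have h1 : #(H.filter fun e' => u ∈ e') ≤ D :=
        (degree_mono (subset_insert _ H) u).trans (hdeg u)
      have h2 : #(H.filter fun e' => v ∈ e') ≤ D :=
        (degree_mono (subset_insert _ H) v).trans (hdeg v)
      have h3 := (card_image_le (s := X) (f := f)).trans (card_union_le _ _)
      rw [card_range]
      omega
    obtain ⟨c, hc, hcX⟩ := exists_mem_notMem_of_card_lt_card hX
    have hne : ∀ e' ∈ H, (({u, v} : Finset V) ∩ e').Nonempty → f e' ≠ c := by
      rintro e' he' ⟨w, hw⟩ h
      refine hcX (mem_image.mpr ⟨e', ?_, h⟩)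
      rw [mem_inter, mem_insert, mem_singleton] at hw
      rw [mem_union, mem_filter, mem_filter]
      rcases hw with ⟨rfl | rfl, hw⟩
      · exact Or.inl ⟨he', hw⟩
      · exact Or.inr ⟨he', hw⟩
    have hH : ∀ e' ∈ H, e' ≠ {u, v} := fun e' he' h => he (h ▸ he')
    refine ⟨Function.update f {u, v} c, ?_, ?_⟩
    · intro e' he'
      rcases mem_insert.mp he' with rfl | h
      · rw [Function.update_self]; exact mem_range.mp hc
      · rw [Function.update_of_ne (hH e' h)]; exact hf1 e' h
    · intro e₁ h₁ e₂ h₂ hne' hint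
      rcases mem_insert.mp h₁ with rfl | h₁' <;> rcases mem_insert.mp h₂ with rfl | h₂'
      · exact absurd rfl hne'
      · rw [Function.update_self, Function.update_of_ne (hH e₂ h₂')]
        exact (hne e₂ h₂' hint).symm
      · rw [Function.update_self, Function.update_of_ne (hH e₁ h₁')]
        exact hne e₁ h₁' (by rwa [inter_comm])
      · rw [Function.update_of_ne (hH e₁ h₁'), Function.update_of_ne (hH e₂ h₂')]
        exact hf2 e₁ h₁' e₂ h₂' hne' hint

theorem HypergraphParam.maxDegree_le_chromaticIndex {V : Type*} [Fintype V] [DecidableEq V]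
    (H : Finset (Finset V)) : maxDegree H ≤ chromaticIndex H := by
  obtain ⟨f, hf1, hf2⟩ := Nat.sInf_mem (exists_isProperEdgeColoring H)
  refine Finset.sup_le fun v _ => ?_
  have h : #((H.filter fun e => v ∈ e).image f) ≤ #(range (chromaticIndex H)) := by
    refine card_le_card fun c hc => ?_
    obtain ⟨e, he, rfl⟩ := mem_image.mp hc
    exact mem_range.mpr (hf1 e (mem_filter.mp he).1)
  rwa [card_image_of_injOn, card_range] at h
  intro e he e' he' heq
  rw [mem_coe, mem_filter] at he he'
  by_contra hne
  exact hf2 e he.1 e' he'.1 hne ⟨v, mem_inter.mpr ⟨he.2, he'.2⟩⟩ heq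

namespace SimpleGraph

variable {V : Type*}

section

variable [DecidableEq V] {G : SimpleGraph V}

theorem HasColoredPartition.cliquePartitionChromaticIndex_le {t : ℕ}
    (h : G.HasColoredPartition t) : G.cliquePartitionChromaticIndex ≤ t := by
  obtain ⟨C, f, hC, -, hf⟩ := h
  have h1 : G.cliquePartitionChromaticIndex ≤ HypergraphParam.chromaticIndex C :=
    Nat.sInf_le ⟨C, hC, rfl⟩
  have h2 : HypergraphParam.chromaticIndex C ≤ t := Nat.sInf_le ⟨f, hf⟩
  exact h1.trans h2

/-- Members with at least two vertices contain an edge, so no clique is shared by disjoint graphs,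
and membership in the first family decides which colouring to use; the second is shifted by `t₁`. -/
theorem HasColoredPartition.sup {G₁ G₂ : SimpleGraph V} {t₁ t₂ : ℕ}
    (h₁ : G₁.HasColoredPartition t₁) (h₂ : G₂.HasColoredPartition t₂) (hdisj : Disjoint G₁ G₂) :
    (G₁ ⊔ G₂).HasColoredPartition (t₁ + t₂) := by
  obtain ⟨C₁, f₁, hC₁, hcard₁, hf₁⟩ := h₁
  obtain ⟨C₂, f₂, hC₂, hcard₂, hf₂⟩ := h₂
  have hd : ∀ u v, G₁.Adj u v → ¬ G₂.Adj u v := by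
    intro u v h h'
    have : (G₁ ⊓ G₂).Adj u v := ⟨h, h'⟩
    rw [disjoint_iff.mp hdisj] at this
    exact this
  have hnot : ∀ K ∈ C₂, K ∉ C₁ := by
    intro K h₂ h₁
    obtain ⟨u, hu, v, hv, huv⟩ := one_lt_card.mp (hcard₁ K h₁)
    exact hd u v (hC₁.1 K h₁ hu hv huv) (hC₂.1 K h₂ hu hv huv)
  refine ⟨C₁ ∪ C₂, fun K => if K ∈ C₁ then f₁ K else t₁ + f₂ K, ⟨?_, ?_⟩, ?_, ?_, ?_⟩
  · intro K hK u hu v hv huv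
    rcases mem_union.mp hK with h | h
    · exact Or.inl (hC₁.1 K h hu hv huv)
    · exact Or.inr (hC₂.1 K h hu hv huv)
  · rintro u v (h | h)
    · obtain ⟨K, ⟨hK, hu, hv⟩, huniq⟩ := hC₁.2 u v h
      refine ⟨K, ⟨mem_union_left _ hK, hu, hv⟩, ?_⟩
      rintro K' ⟨hK', hu', hv'⟩
      rcases mem_union.mp hK' with h' | h'
      · exact huniq K' ⟨h', hu', hv'⟩
      · exact absurd (hC₂.1 K' h' hu' hv' h.ne) (hd u v h)
    · obtain ⟨K, ⟨hK, hu, hv⟩, huniq⟩ := hC₂.2 u v h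
      refine ⟨K, ⟨mem_union_right _ hK, hu, hv⟩, ?_⟩
      rintro K' ⟨hK', hu', hv'⟩
      rcases mem_union.mp hK' with h' | h'
      · exact absurd h (hd u v (hC₁.1 K' h' hu' hv' h.ne))
      · exact huniq K' ⟨h', hu', hv'⟩
  · intro K hK
    rcases mem_union.mp hK with h | h
    · exact hcard₁ K h
    · exact hcard₂ K h
  · intro K hK
    rcases mem_union.mp hK with h | h
    · have := hf₁.1 K h
      simp only [h, if_true]; omega
    · have := hf₂.1 K h
      simp only [hnot K h, if_false]; omega
  · intro K hK K' hK' hne hint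
    rcases mem_union.mp hK with h | h <;> rcases mem_union.mp hK' with h' | h'
    · simp only [h, h', if_true]
      exact hf₁.2 K h K' h' hne hint
    · have := hf₁.1 K h
      simp only [h, hnot K' h', if_true, if_false]; omega
    · have := hf₁.1 K' h'
      simp only [h', hnot K h, if_true, if_false]; omega
    · have := hf₂.2 K h K' h' hne hint
      simp only [hnot K h, hnot K' h', if_false]; omega

end

variable [Fintype V] [DecidableEq V]

open scoped Classical in
theorem hasColoredPartition_of_degree_le (G : SimpleGraph V) {D : ℕ}
    (hD : ∀ v, #{u | G.Adj v u} ≤ D) : G.HasColoredPartition (2 * D + 1) := by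
  set C : Finset (Finset V) := univ.filter fun K => ∃ u v, G.Adj u v ∧ K = {u, v} with hC
  have hmem : ∀ K, K ∈ C ↔ ∃ u v, G.Adj u v ∧ K = {u, v} := by simp [hC]
  have hcard : ∀ K ∈ C, #K = 2 := by
    intro K hK
    obtain ⟨u, v, huv, rfl⟩ := (hmem K).mp hK
    exact card_pair huv.ne
  have hpair : ∀ K ∈ C, ∀ u v, u ≠ v → u ∈ K → v ∈ K → G.Adj u v ∧ K = {u, v} := by
    intro K hK u v huv hu hv
    obtain ⟨a, b, hab, rfl⟩ := (hmem K).mp hK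
    rw [mem_insert, mem_singleton] at hu hv
    rcases hu with rfl | rfl <;> rcases hv with rfl | rfl
    · exact absurd rfl huv
    · exact ⟨hab, rfl⟩
    · exact ⟨hab.symm, pair_comm _ _⟩
    · exact absurd rfl huv
  obtain ⟨f, hf⟩ := exists_isProperEdgeColoring_of_degree_le C hcard (D := D) (by
    intro v
    refine le_trans ?_ (hD v)
    have : (C.filter fun e => v ∈ e) ⊆
        (univ.filter fun u => G.Adj v u).image fun u => ({v, u} : Finset V) := by
      intro K hK
      rw [mem_filter] at hK
      obtain ⟨a, b, hab, rfl⟩ := (hmem K).mp hK.1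
      have h2 := hK.2
      rw [mem_insert, mem_singleton] at h2
      rw [mem_image]
      rcases h2 with rfl | rfl
      · exact ⟨b, by simpa using hab, rfl⟩
      · exact ⟨a, by simpa using hab.symm, pair_comm _ _⟩
    exact (card_le_card this).trans card_image_le)
  refine ⟨C, f, ⟨?_, ?_⟩, fun K hK => (hcard K hK).ge, hf⟩
  · intro K hK u hu v hv huv
    exact (hpair K hK u v huv hu hv).1
  · intro u v huv
    refine ⟨{u, v}, ⟨(hmem _).mpr ⟨u, v, huv, rfl⟩, by simp, by simp⟩, ?_⟩
    rintro K ⟨hK, hu, hv⟩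
    exact (hpair K hK u v huv.ne hu hv).2

theorem cliqueCoveringThickness_le_cliqueCoveringChromaticIndex (G : SimpleGraph V) :
    G.cliqueCoveringThickness ≤ G.cliqueCoveringChromaticIndex := by
  obtain ⟨C₀, hC₀⟩ := G.exists_isCliquePartition
  obtain ⟨C, hC, h⟩ := Nat.sInf_mem (s := {t : ℕ | ∃ C : Finset (Finset V),
    G.IsCliqueCovering C ∧ HypergraphParam.chromaticIndex C = t}) ⟨_, C₀, hC₀.isCliqueCovering, rfl⟩
  rw [cliqueCoveringChromaticIndex, ← h]
  refine le_trans ?_ (maxDegree_le_chromaticIndex C)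
  exact Nat.sInf_le ⟨C, hC, rfl⟩

theorem cliqueCoveringChromaticIndex_le_cliquePartitionChromaticIndex (G : SimpleGraph V) :
    G.cliqueCoveringChromaticIndex ≤ G.cliquePartitionChromaticIndex := by
  obtain ⟨C₀, hC₀⟩ := G.exists_isCliquePartition
  obtain ⟨C, hC, h⟩ := Nat.sInf_mem (s := {t : ℕ | ∃ C : Finset (Finset V),
    G.IsCliquePartition C ∧ HypergraphParam.chromaticIndex C = t}) ⟨_, C₀, hC₀, rfl⟩
  rw [cliquePartitionChromaticIndex, ← h]
  exact Nat.sInf_le ⟨C, hC.isCliqueCovering, rfl⟩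

/-- If cliques have at most `m + 1` vertices, degrees are at most `m` times the thickness. -/
theorem card_commonNbrs_singleton_le (G : SimpleGraph V) {m : ℕ}
    (hm : ∀ K : Finset V, G.IsClique (K : Set V) → #K ≤ m + 1) (v : V) :
    #(G.commonNbrs {v}) ≤ G.cliqueCoveringThickness * m := by
  obtain ⟨C₀, hC₀⟩ := G.exists_isCliquePartition
  obtain ⟨C, hC, h⟩ := Nat.sInf_mem (s := {t : ℕ | ∃ C : Finset (Finset V),
    G.IsCliqueCovering C ∧ HypergraphParam.maxDegree C = t}) ⟨_, C₀, hC₀.isCliqueCovering, rfl⟩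
  rw [cliqueCoveringThickness, ← h]
  have hsub : G.commonNbrs {v} ⊆ (C.filter fun K => v ∈ K).biUnion fun K => K.erase v := by
    intro u hu
    have huv : G.Adj u v := mem_commonNbrs.mp hu v (mem_singleton_self v)
    obtain ⟨K, hK, h1, h2⟩ := hC.2 u v huv
    exact mem_biUnion.mpr ⟨K, mem_filter.mpr ⟨hK, h2⟩, mem_erase.mpr ⟨huv.ne, h1⟩⟩
  refine (card_le_card hsub).trans (card_biUnion_le_card_mul _ _ m ?_ |>.trans ?_)
  · intro K hK
    obtain ⟨hK1, hK2⟩ := mem_filter.mp hK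
    have := hm K (hC.1 K hK1)
    rw [card_erase_of_mem hK2]
    omega
  · refine Nat.mul_le_mul_right m ?_
    exact Finset.le_sup (f := HypergraphParam.degree C) (mem_univ v)

end SimpleGraph

end Deterministic

/-! ### Concentration and first moments in the binomial random graph. -/

section RandomGraph

open Finset MeasureTheory ProbabilityTheory

namespace SimpleGraph

variable {V : Type*} [Fintype V]

instance : MeasurableSingletonClass (SimpleGraph V) where
  measurableSet_singleton G := by
    have h : ({G} : Set (SimpleGraph V)) = edgeSet ⁻¹' {G.edgeSet} := by
      ext H
      simp
    rw [h]
    exact measurable_edgeSet (measurableSet_singleton _)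

theorem binomialRandom_real_subset_edgeSet (p : unitInterval) (F : Finset (Sym2 V))
    (hF : ∀ e ∈ F, ¬ e.IsDiag) :
    (binomialRandom V p).real {G | (F : Set (Sym2 V)) ⊆ G.edgeSet} = (p : ℝ) ^ #F := by
  classical
  have h1 : binomialRandom V p {G | (F : Set (Sym2 V)) ⊆ G.edgeSet} =
      setBernoulli Sym2.diagSetᶜ p {s | (F : Set (Sym2 V)) ⊆ s} := by
    rw [binomialRandom_apply', setBernoulli_apply_eq_apply_subsets _ _ {s | _}]
    congr 1
    ext s
    constructor
    · rintro ⟨G, hG, rfl⟩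
      refine ⟨hG, fun e he => ?_⟩
      simpa using G.not_isDiag_of_mem_edgeSet he
    · rintro ⟨h2, h3⟩
      refine ⟨fromEdgeSet s, ?_, ?_⟩
      · intro e he
        rw [edgeSet_fromEdgeSet]
        exact ⟨h2 he, hF e he⟩
      · rw [edgeSet_fromEdgeSet]
        ext e
        exact ⟨fun h => h.1, fun h => ⟨h, h3 h⟩⟩
  have h2 : setBernoulli Sym2.diagSetᶜ p {s | (F : Set (Sym2 V)) ⊆ s} =
      ∏ e ∈ F, (unitInterval.toNNReal p : ENNReal) := by
    rw [setBernoulli_apply']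
    have : ((fun (p : Sym2 V → Prop) => {i | p i}) ⁻¹' {s | (F : Set (Sym2 V)) ⊆ s}) =
        Set.pi (F : Set (Sym2 V)) fun _ => {True} := by
      ext f
      simp [Set.subset_def, Set.pi]
    rw [this, Measure.infinitePi_pi _ (fun _ _ => measurableSet_singleton _)]
    refine prod_congr rfl fun e he => ?_
    have := hF e he
    simp [this]
  rw [measureReal_def, h1, h2, prod_const, ENNReal.toReal_pow]
  rfl

open scoped Classical in
/-- The generating function of the number of sets of a disjoint family of `s`-sets of pairs that
are contained in the random graph. -/
theorem integral_prod_binomialRandom (p : unitInterval) {κ : Type*} (A : Finset κ)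
    (F : κ → Finset (Sym2 V)) {s : ℕ} (hF : ∀ v ∈ A, ∀ e ∈ F v, ¬ e.IsDiag)
    (hs : ∀ v ∈ A, #(F v) = s) (hdisj : (A : Set κ).PairwiseDisjoint F) (x : ℝ) :
    ∫ G, ∏ v ∈ A, (1 + if ((F v : Set (Sym2 V)) ⊆ G.edgeSet) then x else 0)
      ∂(binomialRandom V p) = (1 + x * (p : ℝ) ^ s) ^ #A := by
  -- Expand the product over subfamilies `t`. By disjointness the union over `t` has s · #t pairs,
  -- so each expectation is a power of p^s and the sum folds back into a product.
  have h1 : ∀ G : SimpleGraph V,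
      ∏ v ∈ A, (1 + if ((F v : Set (Sym2 V)) ⊆ G.edgeSet) then x else 0) =
      ∑ t ∈ A.powerset, Set.indicator {G : SimpleGraph V |
        ((t.biUnion F : Finset (Sym2 V)) : Set (Sym2 V)) ⊆ G.edgeSet} (fun _ => x ^ #t) G := by
    intro G
    rw [prod_one_add]
    refine sum_congr rfl fun t _ => ?_
    rw [prod_ite_zero]
    simp only [Set.indicator, Set.mem_ofPred_eq, prod_const, coe_biUnion, Set.iUnion_subset_iff,
      mem_coe]
  simp_rw [h1]
  rw [integral_finsetSum _ fun t _ => Integrable.of_finite]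
  have h2 : ∀ t ∈ A.powerset, ∫ G, Set.indicator {G : SimpleGraph V |
        ((t.biUnion F : Finset (Sym2 V)) : Set (Sym2 V)) ⊆ G.edgeSet} (fun _ => x ^ #t) G
        ∂(binomialRandom V p) = ∏ _v ∈ t, (x * (p : ℝ) ^ s) := by
    intro t ht
    rw [mem_powerset] at ht
    rw [integral_indicator (Set.toFinite _).measurableSet, setIntegral_const,
      binomialRandom_real_subset_edgeSet, card_biUnion, sum_congr rfl fun v hv => hs v (ht hv),
      sum_const, prod_const, mul_pow, ← pow_mul, smul_eq_mul, smul_eq_mul, mul_comm s, mul_comm]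
    · intro v hv w hw hvw
      exact hdisj (ht hv) (ht hw) hvw
    · intro e he
      obtain ⟨v, hv, hev⟩ := mem_biUnion.mp he
      exact hF v (ht hv) e hev
  rw [sum_congr rfl h2, ← prod_one_add, prod_const]

open scoped Classical in
/-- Chernoff bounds for the number of sets of a disjoint family contained in the random graph. -/
theorem binomialRandom_real_deviation_le (p : unitInterval) {κ : Type*} (A : Finset κ)
    (F : κ → Finset (Sym2 V)) {s : ℕ} (hF : ∀ v ∈ A, ∀ e ∈ F v, ¬ e.IsDiag)
    (hs : ∀ v ∈ A, #(F v) = s) (hdisj : (A : Set κ).PairwiseDisjoint F) {η : ℝ}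
    (hη0 : 0 ≤ η) (hη1 : η ≤ 1) :
    (binomialRandom V p).real {G | η * (#A * (p : ℝ) ^ s) ≤
      |(#{v ∈ A | (F v : Set (Sym2 V)) ⊆ G.edgeSet} : ℝ) - #A * (p : ℝ) ^ s|} ≤
      2 * Real.exp (-(η ^ 2 * (#A * (p : ℝ) ^ s) / 4)) := by
  set X : SimpleGraph V → ℝ := fun G => (#{v ∈ A | (F v : Set (Sym2 V)) ⊆ G.edgeSet} : ℝ) with hX
  set μ : ℝ := #A * (p : ℝ) ^ s with hμ
  have hμ0 : 0 ≤ μ := mul_nonneg (by positivity) (pow_nonneg p.2.1 _)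
  have hps : 0 ≤ (p : ℝ) ^ s := pow_nonneg p.2.1 _
  have hps1 : (p : ℝ) ^ s ≤ 1 := pow_le_one₀ p.2.1 p.2.2
  have hmgf : ∀ t : ℝ, |t| ≤ 1 → mgf X (binomialRandom V p) t ≤ Real.exp ((t + t ^ 2) * μ) := by
    intro t ht
    have h1 : ∀ G, Real.exp (t * X G) =
        ∏ v ∈ A, (1 + if ((F v : Set (Sym2 V)) ⊆ G.edgeSet) then Real.exp t - 1 else 0) := by
      intro G
      have : ∀ v ∈ A, (1 + if ((F v : Set (Sym2 V)) ⊆ G.edgeSet) then Real.exp t - 1 else 0) =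
          if ((F v : Set (Sym2 V)) ⊆ G.edgeSet) then Real.exp t else 1 := by
        intro v _
        split_ifs <;> ring
      rw [prod_congr rfl this, ← prod_filter, prod_const, ← Real.exp_nat_mul, mul_comm]
    rw [mgf, integral_congr_ae (ae_of_all _ h1),
      integral_prod_binomialRandom p A F hF hs hdisj]
    have h2 : Real.exp t - 1 ≤ t + t ^ 2 := by
      linarith [Real.exp_le_one_add_add_sq ht]
    have h3 : 0 ≤ 1 + (Real.exp t - 1) * (p : ℝ) ^ s := by
      have := Real.exp_pos t
      nlinarith
    calc (1 + (Real.exp t - 1) * (p : ℝ) ^ s) ^ #A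
        ≤ Real.exp ((t + t ^ 2) * (p : ℝ) ^ s) ^ #A := by
          gcongr
          refine le_trans ?_ (Real.add_one_le_exp _)
          nlinarith
      _ = Real.exp ((t + t ^ 2) * μ) := by
          rw [← Real.exp_nat_mul, hμ]; ring_nf
  have hup : (binomialRandom V p).real {G | (1 + η) * μ ≤ X G} ≤
      Real.exp (-(η ^ 2 * μ / 4)) := by
    -- With t = η/2 the exponent is -t(1 + η) + t + t² = -η²/4 times the mean; the lower tail uses
    -- -t.
    refine (measure_ge_le_exp_mul_mgf (t := η / 2) _ (by positivity) Integrable.of_finite).trans ?_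
    calc _ ≤ Real.exp (-(η / 2) * ((1 + η) * μ)) * Real.exp ((η / 2 + (η / 2) ^ 2) * μ) := by
          gcongr
          exact hmgf _ (by rw [abs_of_nonneg] <;> linarith)
      _ = _ := by rw [← Real.exp_add]; ring_nf
  have hlow : (binomialRandom V p).real {G | X G ≤ (1 - η) * μ} ≤
      Real.exp (-(η ^ 2 * μ / 4)) := by
    refine (measure_le_le_exp_mul_mgf (t := -(η / 2)) _ (by linarith)
      Integrable.of_finite).trans ?_
    calc _ ≤ Real.exp (-(-(η / 2)) * ((1 - η) * μ)) *
          Real.exp ((-(η / 2) + (-(η / 2)) ^ 2) * μ) := by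
          gcongr
          exact hmgf _ (by rw [abs_neg, abs_of_nonneg] <;> linarith)
      _ = _ := by rw [← Real.exp_add]; ring_nf
  calc _ ≤ (binomialRandom V p).real ({G | (1 + η) * μ ≤ X G} ∪ {G | X G ≤ (1 - η) * μ}) := by
        refine measureReal_mono ?_
        intro G hG
        have hG' : η * μ ≤ |X G - μ| := hG
        rw [Set.mem_union, Set.mem_ofPred_eq, Set.mem_ofPred_eq]
        rcases le_abs'.mp hG' with h | h
        · right; linarith
        · left; linarith
    _ ≤ _ := measureReal_union_le _ _
    _ ≤ _ := by linarith

variable [DecidableEq V]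

/-- Concentration of the number of common neighbours. -/
theorem binomialRandom_real_commonNbrs_le (p : unitInterval) (S : Finset V) {η : ℝ}
    (hη0 : 0 ≤ η) (hη1 : η ≤ 1) :
    (binomialRandom V p).real {G | η * ((Fintype.card V - #S) * (p : ℝ) ^ #S) ≤
      |(#(G.commonNbrs S) : ℝ) - (Fintype.card V - #S) * (p : ℝ) ^ #S|} ≤
      2 * Real.exp (-(η ^ 2 * ((Fintype.card V - #S) * (p : ℝ) ^ #S) / 4)) := by
  classical
  have hA : (#Sᶜ : ℝ) = Fintype.card V - #S := by
    rw [card_compl, Nat.cast_sub (card_le_univ S)]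
  have hcn : ∀ G : SimpleGraph V,
      #{v ∈ Sᶜ | ((joinSet S v : Finset (Sym2 V)) : Set (Sym2 V)) ⊆ G.edgeSet} =
      #(G.commonNbrs S) := by
    intro G
    congr 1
    ext v
    simp only [mem_filter, mem_compl, mem_commonNbrs, joinSet, coe_image, Set.image_subset_iff]
    constructor
    · rintro ⟨-, h⟩ s hs
      exact h hs
    · intro h
      exact ⟨fun hv => (h v hv).ne rfl, fun s hs => h s hs⟩
  have := binomialRandom_real_deviation_le p Sᶜ (joinSet S) (s := #S) (η := η)
    (by
      intro v hv e he
      obtain ⟨s, hs, rfl⟩ := mem_image.mp he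
      rw [Sym2.mk_isDiag_iff]
      rintro rfl
      exact mem_compl.mp hv hs)
    (fun v _ => card_joinSet S v)
    (by
      intro v hv w hw hvw
      rw [Function.onFun, Finset.disjoint_left]
      intro e he he'
      obtain ⟨s, hs, rfl⟩ := mem_image.mp he
      obtain ⟨s', hs', h⟩ := mem_image.mp he'
      rw [Sym2.eq_iff] at h
      rcases h with ⟨h, -⟩ | ⟨h, -⟩
      · exact hvw h.symm
      · rw [mem_coe, mem_compl] at hw
        exact hw (h ▸ hs))
    hη0 hη1
  simp_rw [hcn, hA] at this
  exact this

/-- Codegree regularity of the random graph. -/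
theorem binomialRandom_real_not_isCodegreeRegular_le (p : unitInterval) {η : ℝ} {k : ℕ}
    (hη0 : 0 ≤ η) (hη1 : η ≤ 1) (hk : k ≤ Fintype.card V) :
    (binomialRandom V p).real {G | ¬ G.IsCodegreeRegular p (η + k / Fintype.card V) k} ≤
      (Fintype.card V + 1) ^ k *
        (2 * Real.exp (-(η ^ 2 * ((Fintype.card V - k) * (p : ℝ) ^ k) / 4))) := by
  have hp0 := p.2.1
  have hp1 := p.2.2
  have hkR : (k : ℝ) ≤ Fintype.card V := by exact_mod_cast hk
  calc _ ≤ (binomialRandom V p).real (⋃ S ∈ ({S : Finset V | #S ≤ k} : Finset (Finset V)),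
        {G | η * ((Fintype.card V - #S) * (p : ℝ) ^ #S) ≤
          |(#(G.commonNbrs S) : ℝ) - (Fintype.card V - #S) * (p : ℝ) ^ #S|}) := by
        refine measureReal_mono ?_ (measure_ne_top _ _)
        intro G hG
        rw [Set.mem_ofPred_eq] at hG
        unfold IsCodegreeRegular at hG
        push Not at hG
        obtain ⟨S, hS, h⟩ := hG
        simp only [Set.mem_iUnion]
        refine ⟨S, by simpa using hS, ?_⟩
        rw [Set.mem_ofPred_eq]
        by_contra hcon
        push Not at hcon
        have hSk : (#S : ℝ) ≤ k := by exact_mod_cast hS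
        have hps : 0 ≤ (p : ℝ) ^ #S := pow_nonneg hp0 _
        set x : ℝ := (p : ℝ) ^ #S
        set n : ℝ := (Fintype.card V : ℝ)
        have h1 := abs_lt.mp hcon
        -- Vertices of `S` are not their own neighbours, so the true mean is (n - #S)x. Replacing it
        -- by nx costs at most kx, which is the summand k/n in the error.
        have h2 : |(#(G.commonNbrs S) : ℝ) - n * x| ≤ η * (n * x) + k * x := by
          have h3 : η * ((n - #S) * x) ≤ η * (n * x) := by
            have : (#S : ℝ) * x ≥ 0 := by positivity
            nlinarith
          have h4 : (#S : ℝ) * x ≤ k * x := by gcongr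
          have h5 : 0 ≤ (#S : ℝ) * x := by positivity
          rw [abs_le]
          constructor <;> nlinarith
        have h6 : (η + k / n) * (n * x) = η * (n * x) + k * x ∨ n = 0 := by
          by_cases hn : n = 0
          · exact Or.inr hn
          · left; field_simp
        rcases h6 with h6 | h6
        · rw [h6] at h; linarith
        · have hk0 : (k : ℝ) = 0 := le_antisymm (by linarith) (by positivity)
          rw [h6] at h h2
          rw [hk0] at h2
          simp only [zero_mul, mul_zero, add_zero] at h h2
          linarith
    _ ≤ ∑ S ∈ ({S : Finset V | #S ≤ k} : Finset (Finset V)), (binomialRandom V p).real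
          {G | η * ((Fintype.card V - #S) * (p : ℝ) ^ #S) ≤
          |(#(G.commonNbrs S) : ℝ) - (Fintype.card V - #S) * (p : ℝ) ^ #S|} :=
        measureReal_biUnion_finset_le _ _
    _ ≤ #({S : Finset V | #S ≤ k} : Finset (Finset V)) •
        (2 * Real.exp (-(η ^ 2 * ((Fintype.card V - k) * (p : ℝ) ^ k) / 4))) := by
        refine sum_le_card_nsmul _ _ _ fun S hS => ?_
        refine (binomialRandom_real_commonNbrs_le p S hη0 hη1).trans ?_
        rw [mem_filter] at hS
        have hSk : (#S : ℝ) ≤ k := by exact_mod_cast hS.2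
        have h7 : (p : ℝ) ^ k ≤ (p : ℝ) ^ #S := pow_le_pow_of_le_one hp0 hp1 hS.2
        have h8 : (0 : ℝ) ≤ Fintype.card V - k := by linarith
        have h9 : (Fintype.card V - k) * (p : ℝ) ^ k ≤ (Fintype.card V - #S) * (p : ℝ) ^ #S :=
          mul_le_mul (by linarith) h7 (pow_nonneg hp0 _) (by linarith)
        gcongr
    _ ≤ _ := by
        rw [nsmul_eq_mul]
        have h9 : (#({S : Finset V | #S ≤ k} : Finset (Finset V)) : ℝ) ≤
          (Fintype.card V + 1) ^ k := by exact_mod_cast card_finset_card_le V k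
        gcongr

/-- First moment bound for the existence of cliques on `r` vertices. -/
theorem binomialRandom_real_exists_isClique_le (p : unitInterval) (r : ℕ) :
    (binomialRandom V p).real {G | ∃ K : Finset V, #K = r ∧ G.IsClique (K : Set V)} ≤
      (Fintype.card V : ℝ) ^ r * (p : ℝ) ^ r.choose 2 := by
  calc _ ≤ (binomialRandom V p).real (⋃ K ∈ (univ.powersetCard r : Finset (Finset V)),
        {G | ((pairSet K : Finset (Sym2 V)) : Set (Sym2 V)) ⊆ G.edgeSet}) := by
        refine measureReal_mono ?_ (measure_ne_top _ _)
        rintro G ⟨K, hK, hcl⟩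
        simp only [Set.mem_iUnion]
        refine ⟨K, mem_powersetCard.mpr ⟨subset_univ _, hK⟩, ?_⟩
        intro e
        induction e with
        | _ x y =>
          intro he
          obtain ⟨hx, hy, hxy⟩ := mk_mem_pairSet.mp (mem_coe.mp he)
          exact hcl hx hy hxy
    _ ≤ ∑ K ∈ (univ.powersetCard r : Finset (Finset V)), (binomialRandom V p).real
        {G | ((pairSet K : Finset (Sym2 V)) : Set (Sym2 V)) ⊆ G.edgeSet} :=
        measureReal_biUnion_finset_le _ _
    _ ≤ #(univ.powersetCard r : Finset (Finset V)) • (p : ℝ) ^ r.choose 2 := by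
        refine sum_le_card_nsmul _ _ _ fun K hK => ?_
        rw [binomialRandom_real_subset_edgeSet]
        · have : #(pairSet K) = (#K).choose 2 := Sym2.card_image_offDiag K
          rw [this, (mem_powersetCard.mp hK).2]
        · intro e
          induction e with
          | _ x y =>
            intro he
            rw [Sym2.mk_isDiag_iff]
            exact (mk_mem_pairSet.mp he).2.2
    _ ≤ _ := by
        rw [nsmul_eq_mul, card_powersetCard, card_univ]
        have h1 : ((Fintype.card V).choose r : ℝ) ≤ (Fintype.card V : ℝ) ^ r := by
          exact_mod_cast Nat.choose_le_pow _ _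
        have := pow_nonneg p.2.1 (r.choose 2)
        gcongr

end SimpleGraph

end RandomGraph

/-! ### Choice of the numerical parameters of a stage. -/

section Stages

open Finset

/-- The clique size used at density `q`. -/
noncomputable def cliqueSize (L q : ℝ) : ℕ := ⌊L / (10 * Real.log (4 / q))⌋₊

section

variable {L q z : ℝ}

theorem log_four_div_pos (hq0 : 0 < q) (hq1 : q ≤ 1) : 1 ≤ Real.log (4 / q) := by
  rw [Real.le_log_iff_exp_le (by positivity), le_div_iff₀ hq0]
  have := Real.exp_one_lt_d9
  have := Real.exp_pos 1
  nlinarith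

theorem cliqueSize_mul_log_le (hL : 0 ≤ L) (hq0 : 0 < q) (hq1 : q ≤ 1) :
    cliqueSize L q * Real.log (4 / q) ≤ L / 10 := by
  have h1 := log_four_div_pos hq0 hq1
  have h2 : (cliqueSize L q : ℝ) ≤ L / (10 * Real.log (4 / q)) := Nat.floor_le (by positivity)
  rw [le_div_iff₀ (by positivity)] at h2
  linarith

theorem cliqueSize_le (hL : 0 ≤ L) (hq0 : 0 < q) (hq1 : q ≤ 1) : (cliqueSize L q : ℝ) ≤ L := by
  have h1 := log_four_div_pos hq0 hq1
  have h2 := cliqueSize_mul_log_le hL hq0 hq1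
  have h3 : (cliqueSize L q : ℝ) * 1 ≤ cliqueSize L q * Real.log (4 / q) := by gcongr
  linarith

/-- The reason for the choice of clique size: with L = log n, even (q/4)^k is at least n^{-1/10}, so
sets of `k` vertices still have polynomially many common neighbours at the end of the stage, when
the density is q/2. -/
theorem exp_neg_le_pow_cliqueSize (hL : 0 ≤ L) (hq0 : 0 < q) (hq1 : q ≤ 1) :
    Real.exp (-(L / 10)) ≤ (q / 4) ^ cliqueSize L q := by
  have h1 : q / 4 = Real.exp (-Real.log (4 / q)) := by
    rw [← Real.log_inv, Real.exp_log (by positivity), inv_div]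
  rw [h1, ← Real.exp_nat_mul, Real.exp_le_exp]
  linarith [cliqueSize_mul_log_le hL hq0 hq1]

theorem log_four_div_le (hz : 1 ≤ z) (hlog : L = 100 * Real.log z) (hL : 1000 ≤ L)
    (hq : 1 / z ^ 2 ≤ q) (hq0 : 0 < q) : Real.log (4 / q) ≤ L / 40 := by
  have h1 : Real.log (4 / q) ≤ Real.log (4 * z ^ 2) := by
    apply Real.log_le_log (by positivity)
    rw [div_le_iff₀ hq0]
    rw [div_le_iff₀ (by positivity)] at hq
    linarith
  rw [Real.log_mul (by norm_num) (by positivity), Real.log_pow] at h1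
  have h2 : Real.log 4 ≤ 2 := by
    rw [Real.log_le_iff_le_exp (by norm_num)]
    have h4 : Real.exp 2 = Real.exp 1 * Real.exp 1 := by rw [← Real.exp_add]; norm_num
    have := Real.exp_one_gt_d9
    rw [h4]; nlinarith
  push_cast at h1
  linarith

/-- For q ≥ z^{-2} with log z = L/100, log(4/q) is at most L/40. The bound leaves room for the three
vertices subtracted in the extension counts. -/
theorem four_le_cliqueSize (hz : 1 ≤ z) (hlog : L = 100 * Real.log z) (hL : 1000 ≤ L)
    (hq : 1 / z ^ 2 ≤ q) (hq0 : 0 < q) (hq1 : q ≤ 1) : 4 ≤ cliqueSize L q := by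
  have h1 := log_four_div_pos hq0 hq1
  have h2 := log_four_div_le hz hlog hL hq hq0
  refine Nat.le_floor ?_
  rw [le_div_iff₀ (by positivity)]
  push_cast
  linarith

theorem cliqueSize_anti {q' : ℝ} (hL : 0 ≤ L) (hq0 : 0 < q) (hqq : q ≤ q') (hq1 : q' ≤ 1) :
    cliqueSize L q ≤ cliqueSize L q' := by
  have h1 := log_four_div_pos (hq0.trans_le hqq) hq1
  have h2 : 0 < 4 / q' := div_pos (by norm_num) (hq0.trans_le hqq)
  refine Nat.floor_le_floor ?_
  gcongr

/-- `L / k ≤ 20 log (4 / q)` for `k` the clique size. -/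
theorem div_cliqueSize_le (hz : 1 ≤ z) (hlog : L = 100 * Real.log z) (hL : 1000 ≤ L)
    (hq : 1 / z ^ 2 ≤ q) (hq0 : 0 < q) (hq1 : q ≤ 1) :
    L ≤ 20 * Real.log (4 / q) * cliqueSize L q := by
  have h1 := log_four_div_pos hq0 hq1
  have h2 : (4 : ℝ) ≤ cliqueSize L q := by
    exact_mod_cast four_le_cliqueSize hz hlog hL hq hq0 hq1
  have h3 : L / (10 * Real.log (4 / q)) < cliqueSize L q + 1 := Nat.lt_floor_add_one _
  rw [div_lt_iff₀ (by positivity)] at h3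
  nlinarith

end

/-- Take a = 1 - 2^{-1/T}, which is at most (log 2)/T; then `T` steps halve the density exactly. -/
theorem exists_half_pow (T : ℕ) (hT : 0 < T) :
    ∃ a : ℝ, 0 < a ∧ a ≤ 1 / T ∧ (1 - a) ^ T = 1 / 2 := by
  have hTR : (0 : ℝ) < T := by exact_mod_cast hT
  refine ⟨1 - (1 / 2 : ℝ) ^ ((T : ℝ)⁻¹), ?_, ?_, ?_⟩
  · have : (1 / 2 : ℝ) ^ ((T : ℝ)⁻¹) < 1 :=
      Real.rpow_lt_one (by norm_num) (by norm_num) (by positivity)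
    linarith
  · have h1 : (1 / 2 : ℝ) ^ ((T : ℝ)⁻¹) = Real.exp (-(Real.log 2 / T)) := by
      rw [Real.rpow_def_of_pos (by norm_num), one_div, Real.log_inv]
      congr 1
      field_simp
    have h2 := Real.add_one_le_exp (-(Real.log 2 / T))
    have h3 : Real.log 2 / T ≤ 1 / T := by
      gcongr
      linarith [Real.log_two_lt_d9]
    rw [h1]
    linarith
  · rw [sub_sub_cancel]
    exact Real.rpow_inv_natCast_pow (by norm_num) hT.ne'

variable {V : Type*} [Fintype V] [DecidableEq V]

-- All parameters are measured in powers of z = n^{1/100}: T = n⁴, a ≤ z^{-400}, ξ = z^{-90}, Y =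
-- z^{90}, λ = z^{40}, error increment z^{-25}. Then λ(η - η₀) = z^{15} exceeds the logarithm of the
-- number of tests, which is O(z²), while λ² k² / Y is only about z^{-8}. The waste at a vertex is
-- at most n · 2kη · z^{15}; as 2k ≤ z and η ≤ z^{-20}, this is at most z^{96}.
open scoped Classical in
theorem SimpleGraph.exists_stage {G : SimpleGraph V} {z L q η₀ : ℝ}
    (hn : (Fintype.card V : ℝ) = z ^ 100) (hlog : L = 100 * Real.log z) (hL : 1000 ≤ L)
    (hz : 1000 * (L + 1) ≤ z) (hq : 1 / z ^ 2 ≤ q) (hq1 : q ≤ 1) (hη₀ : 0 ≤ η₀)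
    (hη : η₀ + 1 / z ^ 25 ≤ 1 / z ^ 20)
    (hG : G.IsCodegreeRegular q η₀ (cliqueSize L q)) :
    ∃ G₁ G' : SimpleGraph V, G₁ ≤ G ∧ G' ≤ G ∧ Disjoint G₁ G' ∧
      G₁.HasColoredPartition ⌈4 * (z ^ 100 * q) / cliqueSize L q⌉₊ ∧
      G'.IsCodegreeRegular (q / 2) (η₀ + 1 / z ^ 25) (cliqueSize L q) ∧
      ∀ u, (#{v | G.Adj u v ∧ ¬ G₁.Adj u v ∧ ¬ G'.Adj u v} : ℝ) ≤ z ^ 96 := by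
  have hz1000 : 1000000 ≤ z := by linarith
  have hz0 : 0 < z := by linarith
  have hz1 : 1 ≤ z := by linarith
  have hq0 : 0 < q := lt_of_lt_of_le (by positivity) hq
  have hLz : L ≤ z / 1000 := by linarith
  set k := cliqueSize L q with hkdef
  have hk4 : 4 ≤ k := four_le_cliqueSize hz1 hlog hL hq hq0 hq1
  have hkL : (k : ℝ) ≤ L := cliqueSize_le (by linarith) hq0 hq1
  have hk4R : (4 : ℝ) ≤ k := by exact_mod_cast hk4
  have hkz : (k : ℝ) ≤ z / 1000 := by linarith
  set n := Fintype.card V with hndef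
  have hzpow : ∀ {i j : ℕ}, i ≤ j → z ^ i ≤ z ^ j := fun h => pow_le_pow_right₀ hz1 h
  have hn1 : 1 ≤ n := by
    have : (1 : ℝ) ≤ n := by rw [hn]; exact one_le_pow₀ hz1
    exact_mod_cast this
  obtain ⟨a, ha0, haT, hpow⟩ := exists_half_pow (n ^ 4) (by positivity)
  have ha : a ≤ 1 / z ^ 400 := by
    refine haT.trans (le_of_eq ?_)
    push_cast
    rw [hn, ← pow_mul]
  set N := ⌈4 * (z ^ 100 * q) / k⌉₊ with hNdef
  have hNge : 4 * (z ^ 100 * q) / k ≤ N := Nat.le_ceil _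
  have hqz : z ^ 98 ≤ z ^ 100 * q := by
    calc z ^ 98 = z ^ 100 * (1 / z ^ 2) := by field_simp
      _ ≤ _ := by gcongr
  have hNge' : 4 * z ^ 97 ≤ N := by
    refine le_trans ?_ hNge
    rw [le_div_iff₀ (by positivity)]
    calc 4 * z ^ 97 * k ≤ 4 * z ^ 97 * z := by gcongr; linarith
      _ = 4 * z ^ 98 := by ring
      _ ≤ _ := by gcongr
  have hNle : (N : ℝ) ≤ z ^ 100 + 1 := by
    refine (Nat.ceil_lt_add_one (by positivity)).le.trans ?_
    gcongr
    rw [div_le_iff₀ (by positivity)]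
    have : z ^ 100 * q ≤ z ^ 100 * 1 := by gcongr
    nlinarith [pow_pos hz0 100]
  have hNpos : 0 < N := by
    have : (0 : ℝ) < N := lt_of_lt_of_le (by positivity) hNge'
    exact_mod_cast this
  -- The stage is applied with m = k - 3, so its m + 2 is k - 1; the factor 4 in `N` gives N(k - 1)
  -- ≥ nq with room to spare.
  have hk1 : (k : ℝ) - 1 = ((k - 3 : ℕ) : ℝ) + 2 := by
    rw [Nat.cast_sub (by omega)]; push_cast; ring
  have hexp : Real.exp (-(L / 10)) = 1 / z ^ 10 := by
    have : -(L / 10) = -((10 : ℕ) * Real.log z) := by push_cast; linarith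
    rw [this, ← Real.log_pow, Real.exp_neg, Real.exp_log (by positivity), one_div]
  have h90 : z ^ 90 ≤ n * (q / 2) ^ k := by
    have h1 := exp_neg_le_pow_cliqueSize (L := L) (by linarith) hq0 hq1
    rw [hexp, ← hkdef] at h1
    have h2 : (q / 4) ^ k ≤ (q / 2) ^ k := by gcongr; norm_num
    rw [hn]
    calc z ^ 90 = z ^ 100 * (1 / z ^ 10) := by field_simp
      _ ≤ _ := by gcongr; exact h1.trans h2
  have hbig : ∀ {c : ℝ} {i j : ℕ}, c ≤ z → i + 1 ≤ j → c * z ^ i ≤ z ^ j := by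
    intro c i j hc hij
    calc c * z ^ i ≤ z * z ^ i := by gcongr
      _ = z ^ (i + 1) := by ring
      _ ≤ z ^ j := hzpow hij
  have hka : k * a ≤ 1 / z ^ 399 := by
    calc k * a ≤ z * (1 / z ^ 400) := by gcongr; linarith
      _ = 1 / z ^ 399 := by field_simp
  have hsmall : (1 : ℝ) / z ^ 399 ≤ 1 / z ^ 100 := by
    apply one_div_le_one_div_of_le (by positivity) (hzpow (by norm_num))
  have hη20 : (1 : ℝ) / z ^ 20 ≤ 1 := by
    rw [div_le_one (by positivity)]; exact one_le_pow₀ hz1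
  have hη0 : 0 ≤ η₀ + 1 / z ^ 25 := by positivity
  obtain ⟨G₁, G', h1, h2, h3, h4, h5, h6⟩ := exists_stage_decomposition (G := G) (k := k)
    (m := k - 3) (T := n ^ 4) (N := N) (a := a) (ξ := 1 / z ^ 90) (η₀ := η₀)
    (η := η₀ + 1 / z ^ 25) (lam := z ^ 40) (Y := z ^ 90) (q := q) (by omega) hn1 hNpos hq0 hq1 hpow
    ha0
    (by
      refine ha.trans ?_
      rw [div_le_one (by positivity)]; exact one_le_pow₀ hz1)
    (ha.trans (one_div_le_one_div_of_le (by positivity) (hzpow (by norm_num))))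
    (by
      rw [← hndef, hn]
      have h1 : (z ^ 100 + N) ^ 2 ≤ (z ^ 101) ^ 2 := by
        gcongr
        calc z ^ 100 + N ≤ 3 * z ^ 100 := by
              have : 1 ≤ z ^ 100 := one_le_pow₀ hz1
              linarith
          _ ≤ z ^ 101 := hbig (by linarith) (by norm_num)
      calc a * (z ^ 100 + N) ^ 2 ≤ 1 / z ^ 400 * (z ^ 101) ^ 2 := by gcongr
        _ = 1 / z ^ 198 := by field_simp
        _ ≤ 1 := by rw [div_le_one (by positivity)]; exact one_le_pow₀ hz1)
    (by
      refine hka.trans (hsmall.trans ?_)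
      apply one_div_le_one_div_of_le (by norm_num)
      calc (2 : ℝ) = 2 * z ^ 0 := by norm_num
        _ ≤ z ^ 100 := hbig (by linarith) (by norm_num))
    (by
      rw [← hndef, hn, ← hk1]
      have h1 : z ^ 100 * q ≤ 4 * (z ^ 100 * q) / k * (k - 1) := by
        rw [div_mul_eq_mul_div, le_div_iff₀ (by positivity)]
        have : 0 < z ^ 100 * q := by positivity
        nlinarith
      refine h1.trans (mul_le_mul_of_nonneg_right hNge (by linarith)))
    (by
      have hN0 : (0 : ℝ) < N := by exact_mod_cast hNpos
      rw [div_le_div_iff₀ hN0 (by positivity), one_mul]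
      refine le_trans ?_ hNge'
      gcongr 4 * ?_
      exact hzpow (by norm_num))
    (by
      rw [← hndef, hn]
      have : z ^ 96 ≤ z ^ 100 * q ^ 2 := by
        calc z ^ 96 = z ^ 100 * (1 / z ^ 2) ^ 2 := by field_simp
          _ ≤ _ := by gcongr
      have hc : 32 * (k : ℝ) ≤ z := by linarith
      calc 32 * k / (z ^ 100 * q ^ 2) ≤ z / z ^ 96 := by gcongr
        _ = 1 / z ^ 95 := by field_simp
        _ ≤ _ := one_div_le_one_div_of_le (by positivity) (hzpow (by norm_num)))
    hη₀ hη0 (hη.trans hη20) (by positivity) h90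
    (by
      have : 4 * z ^ 90 ≤ 4 * z ^ 97 := by gcongr 4 * ?_; exact hzpow (by norm_num)
      linarith)
    (by positivity)
    (by
      have e1 : 4 * (k * a) ≤ 1 / z ^ 89 := by
        calc 4 * (k * a) ≤ 4 * (1 / z ^ 399) := by gcongr
          _ ≤ z * (1 / z ^ 399) := by gcongr; linarith
          _ = 1 / z ^ 398 := by field_simp
          _ ≤ _ := one_div_le_one_div_of_le (by positivity) (hzpow (by norm_num))
      have e2 : 2 * ((k : ℝ) + 1) / z ^ 90 ≤ 1 / z ^ 89 := by
        calc 2 * ((k : ℝ) + 1) / z ^ 90 ≤ z / z ^ 90 := by gcongr; linarith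
          _ = _ := by field_simp
      calc z ^ 40 * (4 * (k * a) + 2 * (k + 1) / z ^ 90) ≤ z ^ 40 * (1 / z ^ 89 + 1 / z ^ 89) := by
            gcongr
        _ = 2 / z ^ 49 := by field_simp; norm_num
        _ ≤ 1 := by
            rw [div_le_one (by positivity)]
            calc (2 : ℝ) = 2 * z ^ 0 := by norm_num
              _ ≤ z ^ 49 := hbig (by linarith) (by norm_num))
    (by
      have e1 : z ^ 40 * (4 * k ^ 2 * (1 / z ^ 90)) ≤ 1 / z ^ 48 := by
        calc z ^ 40 * (4 * k ^ 2 * (1 / z ^ 90)) ≤ z ^ 40 * (4 * (z / 1000) ^ 2 * (1 / z ^ 90)) := by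
              gcongr
          _ = 4 / 1000000 * (1 / z ^ 48) := by field_simp; norm_num
          _ ≤ 1 * (1 / z ^ 48) := by gcongr; norm_num
          _ = _ := one_mul _
      have e2 : 32 * k ^ 2 * a ≤ 1 / z ^ 88 := by
        calc 32 * k ^ 2 * a ≤ 32 * (z / 1000) ^ 2 * (1 / z ^ 400) := by gcongr
          _ = 32 / 1000000 * (1 / z ^ 398) := by field_simp; norm_num
          _ ≤ 1 * (1 / z ^ 88) := by
            refine mul_le_mul (by norm_num) ?_ (by positivity) (by norm_num)
            exact one_div_le_one_div_of_le (by positivity) (hzpow (by norm_num))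
          _ = _ := one_mul _
      have e3 : 16 * ((k : ℝ) + 1) * k / z ^ 90 ≤ 1 / z ^ 88 := by
        calc 16 * ((k : ℝ) + 1) * k / z ^ 90 ≤ 16 * (z / 500) * (z / 1000) / z ^ 90 := by
              gcongr; linarith
          _ = 16 / 500000 * (1 / z ^ 88) := by field_simp; norm_num
          _ ≤ 1 * (1 / z ^ 88) := by gcongr; norm_num
          _ = _ := one_mul _
      calc _ ≤ 1 / z ^ 48 + (z ^ 40) ^ 2 * (1 / z ^ 88 + 1 / z ^ 88) := by gcongr
        _ = 1 / z ^ 48 + 2 / z ^ 8 := by congr 1; field_simp; norm_num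
        _ ≤ 1 / z ^ 8 + 2 / z ^ 8 := by
            gcongr ?_ + _
            exact one_div_le_one_div_of_le (by positivity) (hzpow (by norm_num))
        _ = 3 / z ^ 8 := by ring
        _ ≤ 1 := by
            rw [div_le_one (by positivity)]
            calc (3 : ℝ) = 3 * z ^ 0 := by norm_num
              _ ≤ z ^ 8 := hbig (by linarith) (by norm_num))
    (by
      rw [← hndef, hn]
      calc (1 : ℝ) ≤ z ^ 75 := one_le_pow₀ hz1
        _ = z ^ 100 * (1 * (1 / z ^ 25)) := by field_simp
        _ ≤ z ^ 100 * (2 * k * (η₀ + 1 / z ^ 25)) := by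
          gcongr
          · linarith
          · linarith)
    (by
      rw [add_sub_cancel_left, ← hndef, hn]
      have e1 : z ^ 40 * (1 / z ^ 25) = z ^ 15 := by field_simp
      rw [e1]
      have e2 : z ^ 100 + N + 1 ≤ z ^ 101 := by
        calc z ^ 100 + N + 1 ≤ 4 * z ^ 100 := by
              have : 1 ≤ z ^ 100 := one_le_pow₀ hz1
              linarith
          _ ≤ z ^ 101 := hbig (by linarith) (by norm_num)
      have e3 : 4 * (z ^ 100 + N + 1) ^ k + z ^ 100 ≤ 5 * (z ^ 101) ^ k := by
        have h1 : (z ^ 100 + N + 1) ^ k ≤ (z ^ 101) ^ k := by gcongr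
        have h2 : z ^ 100 ≤ (z ^ 101) ^ k := by
          calc z ^ 100 ≤ z ^ 101 := hzpow (by norm_num)
            _ ≤ (z ^ 101) ^ k := le_self_pow₀ (one_le_pow₀ hz1) (by omega)
        linarith
      have e4 : (z ^ 101) ^ k ≤ Real.exp (2 * z ^ 2) := by
        have : z ^ 101 = Real.exp (101 * Real.log z) := by
          have h := Real.exp_nat_mul (Real.log z) 101
          rw [Real.exp_log hz0] at h
          exact_mod_cast h.symm
        rw [this, ← Real.exp_nat_mul, Real.exp_le_exp]
        have h3 : 101 * Real.log z ≤ 2 * z := by linarith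
        have h4 : 0 ≤ Real.log z := Real.log_nonneg hz1
        calc (k : ℝ) * (101 * Real.log z) ≤ z * (2 * z) := by gcongr; linarith
          _ = _ := by ring
      have e5 : (5 : ℝ) ≤ Real.exp 4 := by
        have := Real.add_one_le_exp (4 : ℝ); linarith
      calc _ ≤ Real.exp 2 * (Real.exp 4 * Real.exp (2 * z ^ 2)) := by
            gcongr
            refine e3.trans ?_
            gcongr
        _ = Real.exp (2 + (4 + 2 * z ^ 2)) := by rw [Real.exp_add, Real.exp_add]
        _ ≤ Real.exp (z ^ 15) := by
          rw [Real.exp_le_exp]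
          have h5 : 1 ≤ z ^ 2 := one_le_pow₀ hz1
          calc 2 + (4 + 2 * z ^ 2) ≤ 8 * z ^ 2 := by linarith
            _ ≤ z ^ 15 := hbig (by linarith) (by norm_num))
    hG
  refine ⟨G₁, G', h1, h2, h3, h4, h5, fun u => (h6 u).trans ?_⟩
  rw [add_sub_cancel_left, ← hndef, hn]
  calc z ^ 100 * (2 * k * (η₀ + 1 / z ^ 25)) * (z ^ 40 * (1 / z ^ 25))
      ≤ z ^ 100 * (z * (1 / z ^ 20)) * (z ^ 40 * (1 / z ^ 25)) := by
        gcongr; linarith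
    _ = z ^ 96 := by field_simp

end Stages

/-! ### Iterating the stages and adding up the colours. -/

section Iteration

open Finset

namespace SimpleGraph

theorem IsCodegreeRegular.mono {V : Type*} [Fintype V] {G : SimpleGraph V} {q η η' : ℝ} {k k' : ℕ}
    (h : G.IsCodegreeRegular q η k) (hq : 0 ≤ q) (hη : η ≤ η') (hk : k' ≤ k) :
    G.IsCodegreeRegular q η' k' := fun S hS =>
  (h S (hS.trans hk)).trans (by gcongr)

theorem hasColoredPartition_bot {V : Type*} [DecidableEq V] :
    (⊥ : SimpleGraph V).HasColoredPartition 0 :=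
  ⟨∅, fun _ => 0, ⟨by simp, fun _ _ h => h.elim⟩, by simp, by simp, by simp⟩

variable {V : Type*} [Fintype V] [DecidableEq V]

-- Each stage is applied to the survivor of the previous one. It halves the density, adds z^{-25} to
-- the error and z^{96} to the waste; the covered parts are disjoint, so their coloured partitions
-- combine. Clique sizes decrease with the density, so the regularity inherited from the previous
-- stage reaches far enough.
open scoped Classical in
theorem exists_iterated_decomposition {G : SimpleGraph V} {z L p : ℝ}
    (hn : (Fintype.card V : ℝ) = z ^ 100) (hlog : L = 100 * Real.log z) (hL : 1000 ≤ L)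
    (hz : 1000 * (L + 1) ≤ z) (hp0 : 0 < p) (hp1 : p ≤ 1)
    (hG : G.IsCodegreeRegular p (1 / z ^ 25) (cliqueSize L p)) (j : ℕ) (hj : (j : ℝ) + 1 ≤ z)
    (hq : ∀ i < j, 1 / z ^ 2 ≤ p / 2 ^ i) :
    ∃ A G' : SimpleGraph V, A ≤ G ∧ G' ≤ G ∧ Disjoint A G' ∧
      A.HasColoredPartition
        (∑ i ∈ range j, ⌈4 * (z ^ 100 * (p / 2 ^ i)) / cliqueSize L (p / 2 ^ i)⌉₊) ∧
      G'.IsCodegreeRegular (p / 2 ^ j) ((j + 1) / z ^ 25) (cliqueSize L (p / 2 ^ j)) ∧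
      ∀ u, (#{v | G.Adj u v ∧ ¬ A.Adj u v ∧ ¬ G'.Adj u v} : ℝ) ≤ j * z ^ 96 := by
  have hz0 : 0 < z := by linarith
  have hz1 : 1 ≤ z := by linarith
  induction j with
  | zero =>
    refine ⟨⊥, G, bot_le, le_rfl, disjoint_bot_left, by simpa using hasColoredPartition_bot,
      by simpa using hG, fun u => ?_⟩
    simp
  | succ j ih =>
    push_cast at hj
    obtain ⟨A, G', hA, hG', hAG', hcol, hreg, hwaste⟩ := ih (by linarith)
      fun i hi => hq i (by omega)
    have hle1 : p / 2 ^ j ≤ 1 := by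
      rw [div_le_one (by positivity)]
      exact hp1.trans (one_le_pow₀ (by norm_num))
    obtain ⟨G₁, G'', h1, h2, h3, h4, h5, h6⟩ := exists_stage (G := G') hn hlog hL hz
      (hq j (by omega)) hle1 (by positivity : 0 ≤ ((j : ℝ) + 1) / z ^ 25)
      (by
        -- There are at most z stages, so the accumulated error stays below z · z^{-25} ≤ z^{-20}.
        rw [← add_div, div_le_div_iff₀ (by positivity) (by positivity), one_mul]
        calc ((j : ℝ) + 1 + 1) * z ^ 20 ≤ z ^ 5 * z ^ 20 := by
              gcongr
              exact hj.trans (le_self_pow₀ hz1 (by norm_num))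
          _ = z ^ 25 := by ring) hreg
    have hdisj : Disjoint A G₁ := hAG'.mono_right h1
    have hhalf : p / 2 ^ j / 2 = p / 2 ^ (j + 1) := by rw [pow_succ, div_div]
    obtain ⟨A', hA'⟩ : ∃ A', A' = A ⊔ G₁ := ⟨_, rfl⟩
    refine ⟨A', G'', hA' ▸ sup_le hA (h1.trans hG'), h2.trans hG', ?_, ?_, ?_, ?_⟩
    · rw [hA']
      exact disjoint_sup_left.mpr ⟨hAG'.mono_right h2, h3⟩
    · rw [sum_range_succ, hA']
      exact hcol.sup h4 hdisj
    · rw [hhalf] at h5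
      refine h5.mono (by positivity) (le_of_eq ?_) ?_
      · push_cast; rw [← add_div]
      · refine cliqueSize_anti (by linarith) (by positivity) ?_ hle1
        rw [← hhalf]
        have : 0 < p / 2 ^ j := by positivity
        linarith
    · intro u
      have hsub : (univ.filter fun v => G.Adj u v ∧ ¬ A'.Adj u v ∧ ¬ G''.Adj u v) ⊆
          (univ.filter fun v => G.Adj u v ∧ ¬ A.Adj u v ∧ ¬ G'.Adj u v) ∪
          (univ.filter fun v => G'.Adj u v ∧ ¬ G₁.Adj u v ∧ ¬ G''.Adj u v) := by
        intro v
        simp only [mem_filter, mem_univ, true_and, mem_union, hA', sup_adj]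
        tauto
      have h7 : (#(univ.filter fun v => G.Adj u v ∧ ¬ A'.Adj u v ∧ ¬ G''.Adj u v) : ℝ) ≤
          #(univ.filter fun v => G.Adj u v ∧ ¬ A.Adj u v ∧ ¬ G'.Adj u v) +
          #(univ.filter fun v => G'.Adj u v ∧ ¬ G₁.Adj u v ∧ ¬ G''.Adj u v) := by
        exact_mod_cast (card_le_card hsub).trans (card_union_le _ _)
      refine h7.trans ?_
      push_cast
      linarith [hwaste u, h6 u]

end SimpleGraph

theorem sum_range_add_three_div_two_pow_le (j : ℕ) :
    ∑ i ∈ range j, ((i : ℝ) + 3) / 2 ^ i ≤ 8 := by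
  have h : ∑ i ∈ range j, ((i : ℝ) + 3) / 2 ^ i = 8 - (2 * j + 8) / 2 ^ j := by
    induction j with
    | zero => norm_num
    | succ j ih =>
      rw [sum_range_succ, ih]
      push_cast
      field_simp
      ring
  rw [h]
  have : (0 : ℝ) ≤ (2 * j + 8) / 2 ^ j := by positivity
  linarith

/-- 1/k is at most 20 log(4/q) / L, and log(4 · 2^i / p) ≤ (i + 3) log(1/p) / γ: as log(1/p) ≥ γ,
the quotient log(1/p)/γ dominates both log 2 and log(1/p). -/
theorem div_cliqueSize_term_le {z L p γ : ℝ} (hz : 1 ≤ z) (hlog : L = 100 * Real.log z)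
    (hL : 1000 ≤ L) (hγ0 : 0 < γ) (hγ1 : γ ≤ 1) (hp0 : 0 < p) (hp1 : p ≤ 1)
    (hℓ : γ ≤ Real.log (1 / p)) {i : ℕ} (hpi : 1 / z ^ 2 ≤ p / 2 ^ i) :
    4 * (z ^ 100 * (p / 2 ^ i)) / cliqueSize L (p / 2 ^ i) ≤
      80 * (z ^ 100 * p * Real.log (1 / p) / L / γ) * (((i : ℝ) + 3) / 2 ^ i) := by
  have hz0 : 0 < z := by linarith
  have hL0 : 0 < L := by linarith
  have hq0 : 0 < p / 2 ^ i := by positivity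
  have hq1 : p / 2 ^ i ≤ 1 := by
    rw [div_le_one (by positivity)]
    exact hp1.trans (one_le_pow₀ (by norm_num))
  have h1 := div_cliqueSize_le hz hlog hL hpi hq0 hq1
  have h2 : (4 : ℝ) ≤ cliqueSize L (p / 2 ^ i) := by
    exact_mod_cast four_le_cliqueSize hz hlog hL hpi hq0 hq1
  have h3 : Real.log (4 / (p / 2 ^ i)) ≤ ((i : ℝ) + 3) * (Real.log (1 / p) / γ) := by
    have e : 4 / (p / 2 ^ i) = 2 ^ (i + 2) * (1 / p) := by
      rw [pow_add]; field_simp; norm_num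
    rw [e, Real.log_mul (by positivity) (by positivity), Real.log_pow]
    have h4 : 1 ≤ Real.log (1 / p) / γ := by rw [le_div_iff₀ hγ0]; linarith
    have h5 : Real.log (1 / p) ≤ Real.log (1 / p) / γ := by
      rw [le_div_iff₀ hγ0]; nlinarith
    have h6 : Real.log 2 ≤ Real.log (1 / p) / γ := by linarith [Real.log_two_lt_d9]
    push_cast
    have h7 : ((i : ℝ) + 2) * Real.log 2 ≤ (i + 2) * (Real.log (1 / p) / γ) :=
      mul_le_mul_of_nonneg_left h6 (by positivity)
    linarith
  generalize (cliqueSize L (p / 2 ^ i) : ℝ) = k at *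
  generalize Real.log (4 / (p / 2 ^ i)) = t at *
  generalize Real.log (1 / p) = ℓ at *
  have hk : 0 < k := by linarith
  have hy : 0 ≤ z ^ 100 := by positivity
  generalize z ^ 100 = y at *
  generalize (2 : ℝ) ^ i = w at *
  rw [div_le_iff₀ hk]
  have h9 : L ≤ 20 * (((i : ℝ) + 3) * (ℓ / γ)) * k :=
    h1.trans (mul_le_mul_of_nonneg_right (by linarith) hk.le)
  calc 4 * (y * (p / w)) = 4 * (y * (p / w)) / L * L := by
        rw [div_mul_cancel₀ _ hL0.ne']
    _ ≤ 4 * (y * (p / w)) / L * (20 * (((i : ℝ) + 3) * (ℓ / γ)) * k) :=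
        mul_le_mul_of_nonneg_left h9 (by positivity)
    _ = _ := by ring

/-- The weights (i + 3)/2^i sum to at most 8, which gives 640 = 80 · 8; rounding up costs one colour
per stage. -/
theorem sum_ceil_div_cliqueSize_le {z L p γ : ℝ} (hz : 1 ≤ z) (hlog : L = 100 * Real.log z)
    (hL : 1000 ≤ L) (hγ0 : 0 < γ) (hγ1 : γ ≤ 1) (hp0 : 0 < p) (hp1 : p ≤ 1)
    (hℓ : γ ≤ Real.log (1 / p)) {I : ℕ} (hpI : ∀ i ≤ I, 1 / z ^ 2 ≤ p / 2 ^ i) :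
    ∑ i ∈ range I, (⌈4 * (z ^ 100 * (p / 2 ^ i)) / cliqueSize L (p / 2 ^ i)⌉₊ : ℝ) ≤
      640 * (z ^ 100 * p * Real.log (1 / p) / L / γ) + I := by
  have hM : 0 ≤ z ^ 100 * p * Real.log (1 / p) / L / γ := by
    have : 0 ≤ Real.log (1 / p) := by linarith
    have : 0 ≤ L := by linarith
    positivity
  have hterm : ∀ i ∈ range I,
      (⌈4 * (z ^ 100 * (p / 2 ^ i)) / cliqueSize L (p / 2 ^ i)⌉₊ : ℝ) ≤
        80 * (z ^ 100 * p * Real.log (1 / p) / L / γ) * (((i : ℝ) + 3) / 2 ^ i) + 1 := by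
    intro i hi
    have h := div_cliqueSize_term_le hz hlog hL hγ0 hγ1 hp0 hp1 hℓ (hpI i (mem_range.mp hi).le)
    exact (Nat.ceil_lt_add_one (by positivity)).le.trans (add_le_add_left h 1)
  refine (sum_le_sum hterm).trans ?_
  rw [sum_add_distrib, ← mul_sum, sum_const, card_range, nsmul_eq_mul, mul_one]
  generalize z ^ 100 * p * Real.log (1 / p) / L / γ = M at hM ⊢
  have h := mul_le_mul_of_nonneg_left (sum_range_add_three_div_two_pow_le I)
    (by positivity : 0 ≤ 80 * M)
  linarith

theorem exists_two_pow_between {L : ℝ} (hL : 1000 ≤ L) :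
    ∃ I : ℕ, L ≤ 2 ^ I ∧ (2 : ℝ) ^ I ≤ 2 * L := by
  obtain ⟨I, h1, h2⟩ := exists_nat_pow_near (show (1 : ℝ) ≤ L by linarith) one_lt_two
  exact ⟨I + 1, h2.le, by rw [pow_succ]; linarith⟩

namespace SimpleGraph

open scoped Classical in
theorem commonNbrs_singleton {V : Type*} [Fintype V] (G : SimpleGraph V) (v : V) :
    G.commonNbrs {v} = univ.filter fun u => G.Adj v u := by
  ext u
  simp [mem_commonNbrs, G.adj_comm]

variable {V : Type*} [Fintype V] [DecidableEq V]

/-- A codegree-regular graph has a clique partition with small chromatic index. -/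
theorem cliquePartitionChromaticIndex_le_of_isCodegreeRegular {G : SimpleGraph V} {z L p γ : ℝ}
    (hn : (Fintype.card V : ℝ) = z ^ 100) (hlog : L = 100 * Real.log z) (hL : 1000 ≤ L)
    (hz : 1000 * (L + 1) ≤ z) (hγ0 : 0 < γ) (hp : 1 / z ≤ p) (hpγ : p ≤ 1 - γ)
    (hG : G.IsCodegreeRegular p (1 / z ^ 25) (cliqueSize L p)) :
    (G.cliquePartitionChromaticIndex : ℝ) ≤ 650 / γ * (z ^ 100 * p * Real.log (1 / p) / L) := by
  classical
  have hz0 : 0 < z := by linarith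
  have hz1 : 1 ≤ z := by linarith
  have hL0 : 0 < L := by linarith
  have hp0 : 0 < p := lt_of_lt_of_le (by positivity) hp
  have hp1 : p ≤ 1 := by linarith
  have hγ1 : γ ≤ 1 := by linarith
  set ℓ := Real.log (1 / p) with hℓ
  have hℓγ : γ ≤ ℓ := by
    rw [hℓ, one_div, Real.log_inv]
    linarith [Real.log_le_sub_one_of_pos hp0]
  have hℓ0 : 0 < ℓ := hγ0.trans_le hℓγ
  -- 2^I ≥ L brings the final density below p/L; 2^I ≤ 2L keeps every density above z^{-2}.
  obtain ⟨I, hI1, hI2⟩ := exists_two_pow_between hL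
  have hIL : (I : ℝ) + 1 ≤ 2 * L := by
    have : (I : ℝ) + 1 ≤ 2 ^ I := by exact_mod_cast Nat.lt_two_pow_self
    linarith
  have hpI : ∀ i ≤ I, 1 / z ^ 2 ≤ p / 2 ^ i := by
    intro i hi
    have h1 : (2 : ℝ) ^ i ≤ z := by
      calc (2 : ℝ) ^ i ≤ 2 ^ I := pow_le_pow_right₀ (by norm_num) hi
        _ ≤ z := by linarith
    calc 1 / z ^ 2 = 1 / z / z := by field_simp
      _ ≤ p / 2 ^ i := by gcongr
  obtain ⟨A, G', hA, hG', hAG', hcol, hreg, hwaste⟩ := exists_iterated_decomposition hn hlog hL hz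
    hp0 hp1 hG I (by linarith) fun i hi => hpI i hi.le
  set M := z ^ 100 * p * ℓ / L with hM
  have hnp : z ^ 99 ≤ z ^ 100 * p := by
    calc z ^ 99 = z ^ 100 * (1 / z) := by field_simp
      _ ≤ _ := by gcongr
  -- `B` = np/L is the unit for all leftovers: waste at a vertex is at most B, and the final
  -- survivor has degrees at most 2B.
  set B := z ^ 100 * p / L with hB
  have hBM : B ≤ M / γ := by
    rw [hM, hB, le_div_iff₀ hγ0, div_mul_eq_mul_div]
    gcongr
  have hLz : L ≤ z := by linarith
  have hz98 : z ^ 98 ≤ B := by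
    rw [hB, le_div_iff₀ hL0]
    calc z ^ 98 * L ≤ z ^ 98 * z := by gcongr
      _ = z ^ 99 := by ring
      _ ≤ _ := hnp
  have hIz : (I : ℝ) ≤ z := by linarith
  have hz97 : z ^ 97 ≤ z ^ 98 := pow_le_pow_right₀ hz1 (by norm_num)
  have hI98 : (I : ℝ) * z ^ 96 ≤ B := by
    calc (I : ℝ) * z ^ 96 ≤ z * z ^ 96 := by gcongr
      _ = z ^ 97 := by ring
      _ ≤ B := hz97.trans hz98
  have hIB : (I : ℝ) ≤ B := by
    refine le_trans ?_ hI98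
    exact le_mul_of_one_le_right (by positivity) (one_le_pow₀ hz1)
  have h1B : 1 ≤ B := (one_le_pow₀ hz1).trans hz98
  -- degrees of the uncovered graph
  have hdeg : ∀ u, (#{v | (G \ A).Adj u v} : ℝ) ≤ 3 * B := by
    intro u
    have hsub : (univ.filter fun v => (G \ A).Adj u v) ⊆
        (univ.filter fun v => G.Adj u v ∧ ¬ A.Adj u v ∧ ¬ G'.Adj u v) ∪
        (univ.filter fun v => G'.Adj u v) := by
      intro v
      simp only [mem_filter, mem_univ, true_and, mem_union, sdiff_adj]
      tauto
    have h1 : (#(univ.filter fun v => (G \ A).Adj u v) : ℝ) ≤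
        #(univ.filter fun v => G.Adj u v ∧ ¬ A.Adj u v ∧ ¬ G'.Adj u v) +
        #(univ.filter fun v => G'.Adj u v) := by
      exact_mod_cast (card_le_card hsub).trans (card_union_le _ _)
    have hk4 : 4 ≤ cliqueSize L (p / 2 ^ I) := four_le_cliqueSize hz1 hlog hL (hpI I le_rfl)
      (by positivity) (by
        rw [div_le_one (by positivity)]
        exact hp1.trans (one_le_pow₀ (by norm_num)))
    have h2 := le_of_abs_le (hreg {u} (by rw [card_singleton]; omega))
    rw [commonNbrs_singleton, card_singleton, pow_one, hn] at h2
    have h3 : ((I : ℝ) + 1) / z ^ 25 ≤ 1 := by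
      rw [div_le_one (by positivity)]
      calc (I : ℝ) + 1 ≤ z := by linarith
        _ ≤ z ^ 25 := le_self_pow₀ hz1 (by norm_num)
    have h4 : z ^ 100 * (p / 2 ^ I) ≤ B := by
      rw [hB, mul_div_assoc]
      gcongr
    have h5 : ((I : ℝ) + 1) / z ^ 25 * (z ^ 100 * (p / 2 ^ I)) ≤ 1 * (z ^ 100 * (p / 2 ^ I)) := by
      gcongr
    linarith [hwaste u]
  have hrest : (G \ A).HasColoredPartition (2 * ⌊3 * B⌋₊ + 1) :=
    hasColoredPartition_of_degree_le _ fun v => by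
      refine Nat.le_floor ?_
      convert hdeg v <;> rfl
  have htot := (hcol.sup hrest disjoint_sdiff_self_right).cliquePartitionChromaticIndex_le
  rw [sup_sdiff_cancel_right hA] at htot
  have hsum : ((∑ i ∈ range I, ⌈4 * (z ^ 100 * (p / 2 ^ i)) / cliqueSize L (p / 2 ^ i)⌉₊ : ℕ) : ℝ) ≤
      640 * (M / γ) + I := by
    push_cast
    exact sum_ceil_div_cliqueSize_le hz1 hlog hL hγ0 hγ1 hp0 hp1 hℓγ hpI
  have hfl : (⌊3 * B⌋₊ : ℝ) ≤ 3 * B := Nat.floor_le (by positivity)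
  have hfin : (G.cliquePartitionChromaticIndex : ℝ) ≤ (640 * (M / γ) + I) + (2 * (3 * B) + 1) := by
    refine (Nat.cast_le.mpr htot).trans ?_
    rw [Nat.cast_add]
    refine add_le_add hsum ?_
    push_cast
    linarith
  -- I, B and 1 are each at most M/γ, so the total is at most (640 + 1 + 6 + 1) M/γ.
  calc _ ≤ _ := hfin
    _ ≤ 650 * (M / γ) := by linarith
    _ = _ := by ring

/-- The greedy upper bound for sparse graphs. -/
theorem cliquePartitionChromaticIndex_le_of_sparse {G : SimpleGraph V} {p : ℝ}
    (hnp : 1 ≤ Fintype.card V * p) (hG : G.IsCodegreeRegular p (1 / 2) 1) :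
    (G.cliquePartitionChromaticIndex : ℝ) ≤ 4 * (Fintype.card V * p) := by
  classical
  have h : ∀ v, (#{u | G.Adj v u} : ℝ) ≤ 3 / 2 * (Fintype.card V * p) := by
    intro v
    have h2 := le_of_abs_le (hG {v} (by simp))
    rw [commonNbrs_singleton, card_singleton, pow_one] at h2
    linarith
  have h1 := (hasColoredPartition_of_degree_le G fun v =>
    Nat.le_floor (by convert h v)).cliquePartitionChromaticIndex_le
  have h2 : (⌊3 / 2 * (Fintype.card V * p)⌋₊ : ℝ) ≤ 3 / 2 * (Fintype.card V * p) :=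
    Nat.floor_le (by positivity)
  have h3 : (G.cliquePartitionChromaticIndex : ℝ) ≤
      2 * (⌊3 / 2 * (Fintype.card V * p)⌋₊ : ℝ) + 1 := by exact_mod_cast h1
  linarith

end SimpleGraph

end Iteration

/-! ### Failure probabilities and the final estimates. -/

section Conclusion

open Finset

namespace SimpleGraph

variable {V : Type*} [Fintype V] [DecidableEq V]

/-- A vertex has at least np/2 neighbours, and a clique through it covers at most ⌈3t⌉ ≤ 4t of its
edges; the quotient gives the constant 1/8. -/
theorem le_cliqueCoveringThickness_of_cliqueFree [Nonempty V] {G : SimpleGraph V} {p t : ℝ}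
    (ht : 1 ≤ t) (hG : G.IsCodegreeRegular p (1 / 2) 1)
    (hK : ¬ ∃ K : Finset V, #K = ⌈3 * t⌉₊ + 2 ∧ G.IsClique (K : Set V)) :
    1 / 8 * (Fintype.card V * p / t) ≤ (G.cliqueCoveringThickness : ℝ) := by
  obtain ⟨v⟩ := ‹Nonempty V›
  have hm : ∀ K : Finset V, G.IsClique (K : Set V) → #K ≤ ⌈3 * t⌉₊ + 1 := by
    intro K hKc
    by_contra! h
    obtain ⟨K', hK', hcard⟩ := exists_subset_card_eq (show ⌈3 * t⌉₊ + 2 ≤ #K by omega)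
    exact hK ⟨K', hcard, hKc.subset (by exact_mod_cast hK')⟩
  have h1 : (#(G.commonNbrs {v}) : ℝ) ≤ G.cliqueCoveringThickness * (⌈3 * t⌉₊ : ℝ) := by
    exact_mod_cast card_commonNbrs_singleton_le G hm v
  have h2 := neg_le_of_abs_le (hG {v} (by simp))
  rw [card_singleton, pow_one] at h2
  have h3 : (⌈3 * t⌉₊ : ℝ) ≤ 4 * t := by
    linarith [(Nat.ceil_lt_add_one (by positivity : 0 ≤ 3 * t)).le]
  have h4 : (G.cliqueCoveringThickness : ℝ) * (⌈3 * t⌉₊ : ℝ) ≤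
      G.cliqueCoveringThickness * (4 * t) := by gcongr
  rw [← mul_div_assoc, div_le_iff₀ (by linarith)]
  linarith

/-- The error 1/2 splits into 1/4 for Chernoff and 1/n ≤ 1/4. The exponent is at least np/128, and
384 = 3 · 128 makes it at least 3 log n, enough for a union bound. -/
theorem binomialRandom_real_not_isCodegreeRegular_one_le {p : unitInterval}
    (hn : 4 ≤ Fintype.card V)
    (hp : 384 * Real.log (Fintype.card V) ≤ Fintype.card V * (p : ℝ)) :
    (binomialRandom V p).real {G | ¬ G.IsCodegreeRegular p (1 / 2) 1} ≤
      1 / Fintype.card V := by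
  have hnR : (4 : ℝ) ≤ Fintype.card V := by exact_mod_cast hn
  have h := binomialRandom_real_not_isCodegreeRegular_le (V := V) p (η := 1 / 4) (k := 1)
    (by norm_num) (by norm_num) (by omega)
  have hsub : {G : SimpleGraph V | ¬ G.IsCodegreeRegular p (1 / 2) 1} ⊆
      {G | ¬ G.IsCodegreeRegular p (1 / 4 + (1 : ℕ) / Fintype.card V) 1} := by
    intro G hG h'
    refine hG (h'.mono p.2.1 ?_ le_rfl)
    have : ((1 : ℕ) : ℝ) / Fintype.card V ≤ 1 / 4 := by
      rw [Nat.cast_one]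
      exact one_div_le_one_div_of_le (by norm_num) hnR
    linarith
  refine (MeasureTheory.measureReal_mono hsub (MeasureTheory.measure_ne_top _ _)).trans
    (h.trans ?_)
  generalize (Fintype.card V : ℝ) = n at *
  have hn0 : 0 < n := by linarith
  have hexp : Real.exp (-((1 / 4) ^ 2 * ((n - (1 : ℕ)) * (p : ℝ) ^ 1) / 4)) ≤ 1 / n ^ 3 := by
    have e : 1 / n ^ 3 = Real.exp (-((3 : ℕ) * Real.log n)) := by
      rw [← Real.log_pow, Real.exp_neg, Real.exp_log (by positivity), one_div]
    rw [e, Real.exp_le_exp]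
    push_cast
    have : 0 ≤ (n / 2 - 1) * (p : ℝ) := mul_nonneg (by linarith) p.2.1
    linarith
  calc _ ≤ (n + 1) ^ 1 * (2 * (1 / n ^ 3)) := by gcongr
    _ ≤ 1 / n := by
      rw [pow_one, ← mul_assoc, mul_one_div, div_le_div_iff₀ (by positivity) hn0]
      have h2 : (n + 1) * 2 ≤ n ^ 2 := by nlinarith
      linarith [mul_le_mul_of_nonneg_right h2 hn0.le]

/-- First moment with r = m + 2 vertices and ℓ = log(1/p): mℓ ≥ 3L gives (m + 1)(m + 2)ℓ/2 ≥ (m +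
3)L, hence n^r p^{r(r-1)/2} ≤ 1/n. -/
theorem binomialRandom_real_exists_isClique_le_inv {p : unitInterval} {L t : ℝ}
    (hV : 1 ≤ Fintype.card V) (hL : L = Real.log (Fintype.card V)) (hp0 : 0 < (p : ℝ))
    (ht : t * Real.log (1 / p) = L) :
    (binomialRandom V p).real
      {G | ∃ K : Finset V, #K = ⌈3 * t⌉₊ + 2 ∧ G.IsClique (K : Set V)} ≤ 1 / Fintype.card V := by
  refine (binomialRandom_real_exists_isClique_le p _).trans ?_
  have hnR : (1 : ℝ) ≤ Fintype.card V := by exact_mod_cast hV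
  generalize (Fintype.card V : ℝ) = n at *
  have hL0 : 0 ≤ L := hL ▸ Real.log_nonneg hnR
  have hn : n = Real.exp L := by rw [hL, Real.exp_log (by linarith)]
  have hℓ0 : 0 ≤ Real.log (1 / p) :=
    Real.log_nonneg (by rw [le_div_iff₀ hp0, one_mul]; exact p.2.2)
  have hp : (p : ℝ) = Real.exp (-Real.log (1 / p)) := by
    rw [← Real.log_inv, one_div, inv_inv, Real.exp_log hp0]
  have hm : 3 * t ≤ ⌈3 * t⌉₊ := Nat.le_ceil _
  generalize ⌈3 * t⌉₊ = m at *
  rw [hn, one_div, ← Real.exp_neg]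
  generalize Real.log (1 / (p : ℝ)) = ℓ at *
  rw [hp, ← Real.exp_nat_mul, ← Real.exp_nat_mul, ← Real.exp_add, Real.exp_le_exp,
    Nat.cast_choose_two]
  push_cast
  have h1 : 3 * L ≤ m * ℓ := by nlinarith
  have h2 : 0 ≤ (m : ℝ) * (m * ℓ - 3 * L) := mul_nonneg (by positivity) (by linarith)
  have h3 : 0 ≤ (m : ℝ) * ℓ := by positivity
  have h4 : 0 ≤ (m : ℝ) * L := by positivity
  nlinarith

/-- Half of the error z^{-25} goes to Chernoff and half to k/n. The Chernoff exponent is at least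
z^{-50} z^{100} z^{-10} / 32 = z^{40}/32, while there are only e^{O(z²)} sets to consider. -/
theorem binomialRandom_real_not_isCodegreeRegular_cliqueSize_le {p : unitInterval} {z L : ℝ}
    (hn : (Fintype.card V : ℝ) = z ^ 100) (hlog : L = 100 * Real.log z) (hL : 1000 ≤ L)
    (hz : 1000 * (L + 1) ≤ z) (hp : 1 / z ≤ (p : ℝ)) :
    (binomialRandom V p).real {G | ¬ G.IsCodegreeRegular p (1 / z ^ 25) (cliqueSize L p)} ≤
      1 / Fintype.card V := by
  have hz0 : 0 < z := by linarith
  have hz1 : 1 ≤ z := by linarith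
  have hp0 : 0 < (p : ℝ) := lt_of_lt_of_le (by positivity) hp
  have hk := cliqueSize_le (by linarith : 0 ≤ L) hp0 p.2.2
  have hexp := exp_neg_le_pow_cliqueSize (by linarith : 0 ≤ L) hp0 p.2.2
  have hexpz : ∀ i : ℕ, z ^ i = Real.exp (i * Real.log z) := fun i => by
    rw [← Real.log_pow, Real.exp_log (by positivity)]
  have hL10 : Real.exp (-(L / 10)) = 1 / z ^ 10 := by
    rw [hexpz, one_div, ← Real.exp_neg, hlog]
    push_cast
    ring_nf
  rw [hL10] at hexp
  generalize cliqueSize L p = k at *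
  have hzpow : ∀ {i j : ℕ}, i ≤ j → z ^ i ≤ z ^ j := fun h => pow_le_pow_right₀ hz1 h
  have hbig : ∀ {c : ℝ} {i j : ℕ}, c ≤ z → i + 1 ≤ j → c * z ^ i ≤ z ^ j := by
    intro c i j hc hij
    calc c * z ^ i ≤ z * z ^ i := by gcongr
      _ = z ^ (i + 1) := by ring
      _ ≤ z ^ j := hzpow hij
  have hkz : 2 * (k : ℝ) ≤ z := by linarith
  have hkn : (k : ℝ) ≤ z ^ 100 / 2 := by
    have : z ^ 1 ≤ z ^ 100 := hzpow (by norm_num)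
    linarith
  have hkV : k ≤ Fintype.card V := by
    have : (k : ℝ) ≤ Fintype.card V := by
      rw [hn]; linarith [pow_pos hz0 100]
    exact_mod_cast this
  have hη1 : 1 / (2 * z ^ 25) ≤ 1 := by
    rw [div_le_one (by positivity)]
    linarith [one_le_pow₀ (n := 25) hz1]
  have h := binomialRandom_real_not_isCodegreeRegular_le (V := V) p (η := 1 / (2 * z ^ 25))
    (by positivity) hη1 hkV
  have hsub : {G : SimpleGraph V | ¬ G.IsCodegreeRegular p (1 / z ^ 25) k} ⊆
      {G | ¬ G.IsCodegreeRegular p (1 / (2 * z ^ 25) + k / Fintype.card V) k} := by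
    intro G hG h'
    refine hG (h'.mono p.2.1 ?_ le_rfl)
    have h1 : (k : ℝ) / Fintype.card V ≤ 1 / (2 * z ^ 25) := by
      rw [hn, div_le_div_iff₀ (by positivity) (by positivity)]
      calc (k : ℝ) * (2 * z ^ 25) = 2 * k * z ^ 25 := by ring
        _ ≤ z ^ 100 := hbig hkz (by norm_num)
        _ = _ := (one_mul _).symm
    have h2 : 1 / (2 * z ^ 25) + 1 / (2 * z ^ 25) = 1 / z ^ 25 := by field_simp; norm_num
    linarith
  refine (MeasureTheory.measureReal_mono hsub (MeasureTheory.measure_ne_top _ _)).trans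
    (h.trans ?_)
  rw [hn]
  have hlow : z ^ 40 / 32 ≤ (1 / (2 * z ^ 25)) ^ 2 * ((z ^ 100 - k) * (p : ℝ) ^ k) / 4 := by
    have h1 : 1 / z ^ 10 ≤ (p : ℝ) ^ k := by
      refine hexp.trans ?_
      gcongr
      linarith
    calc z ^ 40 / 32 = (1 / (2 * z ^ 25)) ^ 2 * ((z ^ 100 / 2) * (1 / z ^ 10)) / 4 := by
          field_simp; norm_num
      _ ≤ _ := by
          have h2 : z ^ 100 / 2 ≤ z ^ 100 - k := by linarith only [hkn]
          have h3 : 0 ≤ z ^ 100 / 2 := by positivity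
          generalize z ^ 100 = y at h2 h3 ⊢
          exact div_le_div_of_nonneg_right (mul_le_mul_of_nonneg_left
            (mul_le_mul h2 h1 (by positivity) (h3.trans h2)) (by positivity)) (by norm_num)
  have hpow : (z ^ 100 + 1) ^ k ≤ Real.exp (2 * z ^ 2) := by
    calc (z ^ 100 + 1) ^ k ≤ (z ^ 101) ^ k := by
          gcongr
          calc z ^ 100 + 1 ≤ 2 * z ^ 100 := by linarith [one_le_pow₀ (n := 100) hz1]
            _ ≤ z ^ 101 := hbig (by linarith) (by norm_num)
      _ = Real.exp (k * (101 * Real.log z)) := by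
          rw [hexpz, ← Real.exp_nat_mul]; norm_num
      _ ≤ _ := by
          rw [Real.exp_le_exp]
          have h3 : 101 * Real.log z ≤ 2 * z := by linarith
          have h4 : 0 ≤ Real.log z := Real.log_nonneg hz1
          calc (k : ℝ) * (101 * Real.log z) ≤ z * (2 * z) := by gcongr; linarith
            _ = _ := by ring
  have h2 : (2 : ℝ) ≤ Real.exp 1 := by linarith [Real.add_one_le_exp (1 : ℝ)]
  have hfin : 2 * z ^ 2 + (1 - z ^ 40 / 32) ≤ -L := by
    have h3 : z ^ 1 ≤ z ^ 2 := hzpow (by norm_num)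
    have h4 : (200 : ℝ) * z ^ 2 ≤ z ^ 40 := hbig (by linarith) (by norm_num)
    have h5 : 1 ≤ z ^ 2 := one_le_pow₀ hz1
    linarith
  calc _ ≤ Real.exp (2 * z ^ 2) * (Real.exp 1 * Real.exp (-(z ^ 40 / 32))) := by
        gcongr
    _ = Real.exp (2 * z ^ 2 + (1 - z ^ 40 / 32)) := by
        rw [← Real.exp_add, ← Real.exp_add]; ring_nf
    _ ≤ Real.exp (-L) := Real.exp_le_exp.mpr hfin
    _ = 1 / z ^ 100 := by
        rw [hexpz, one_div, ← Real.exp_neg, hlog]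
        norm_num

/-- The event that the three clique parameters have the asserted order. -/
theorem binomialRandom_real_not_bounds_le {p : unitInterval} {z L γ : ℝ}
    (hn : (Fintype.card V : ℝ) = z ^ 100) (hlog : L = 100 * Real.log z) (hL : 1000 ≤ L)
    (hz : 1000 * (L + 1) ≤ z) (hγ0 : 0 < γ) (hγ1 : γ < 1)
    (hp : 384 * Real.log (Fintype.card V) ≤ Fintype.card V * (p : ℝ)) (hpγ : (p : ℝ) ≤ 1 - γ) :
    (binomialRandom V p).real {G | ¬ (
      1 / 8 * (Fintype.card V * (p : ℝ) / Real.logb (1 / p) (Fintype.card V)) ≤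
        (G.cliqueCoveringThickness : ℝ) ∧
      (G.cliquePartitionChromaticIndex : ℝ) ≤
        650 / γ * (Fintype.card V * (p : ℝ) / Real.logb (1 / p) (Fintype.card V)))} ≤
      3 / Fintype.card V := by
  have hz0 : 0 < z := by linarith
  have hz1 : 1 ≤ z := by linarith
  have hLn : L = Real.log (Fintype.card V) := by rw [hn, Real.log_pow, hlog]; norm_num
  rw [← hLn] at hp
  have hn4R : (4 : ℝ) ≤ Fintype.card V := by
    rw [hn]
    exact (by linarith : 4 ≤ z).trans (le_self_pow₀ hz1 (by norm_num))
  have hn4 : 4 ≤ Fintype.card V := by exact_mod_cast hn4R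
  have : Nonempty V := Fintype.card_pos_iff.mp (by omega)
  have hnp1 : 1 ≤ Fintype.card V * (p : ℝ) := by linarith
  have hp0 : 0 < (p : ℝ) := by
    by_contra! h
    nlinarith
  have hℓγ : γ ≤ Real.log (1 / p) := by
    rw [one_div, Real.log_inv]
    linarith [Real.log_le_sub_one_of_pos hp0]
  have hℓ0 : 0 < Real.log (1 / p) := hγ0.trans_le hℓγ
  -- np ≥ 1 means 1/p ≤ n, so log_{1/p} n ≥ 1 as the lower bound requires.
  have hℓL : Real.log (1 / p) ≤ L := by
    rw [hLn]
    exact Real.log_le_log (by positivity) (by rwa [div_le_iff₀ hp0])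
  have hlogb : Real.logb (1 / p) (Fintype.card V) = L / Real.log (1 / p) := by
    rw [Real.logb, hLn]
  rw [hlogb]
  have ht1 : 1 ≤ L / Real.log (1 / p) := by rwa [one_le_div hℓ0]
  let E1 : Set (SimpleGraph V) := {G | ¬ G.IsCodegreeRegular p (1 / 2) 1}
  let E2 : Set (SimpleGraph V) :=
    {G | ∃ K : Finset V, #K = ⌈3 * (L / Real.log (1 / p))⌉₊ + 2 ∧ G.IsClique (K : Set V)}
  -- High-order regularity is needed, and likely, only in the dense range; for smaller `p` this
  -- event is empty.
  let E3 : Set (SimpleGraph V) :=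
    {G | 1 / z ≤ (p : ℝ) ∧ ¬ G.IsCodegreeRegular p (1 / z ^ 25) (cliqueSize L p)}
  have h1 : (binomialRandom V p).real E1 ≤ 1 / Fintype.card V :=
    binomialRandom_real_not_isCodegreeRegular_one_le hn4 (hLn ▸ hp)
  have h2 : (binomialRandom V p).real E2 ≤ 1 / Fintype.card V :=
    binomialRandom_real_exists_isClique_le_inv (by omega) hLn hp0 (div_mul_cancel₀ _ hℓ0.ne')
  have h3 : (binomialRandom V p).real E3 ≤ 1 / Fintype.card V := by
    by_cases hpz : 1 / z ≤ (p : ℝ)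
    · have := binomialRandom_real_not_isCodegreeRegular_cliqueSize_le hn hlog hL hz hpz
      refine (MeasureTheory.measureReal_mono ?_ (MeasureTheory.measure_ne_top _ _)).trans this
      exact fun G hG => hG.2
    · have : E3 = ∅ := Set.eq_empty_of_forall_notMem fun G hG => hpz hG.1
      rw [this, MeasureTheory.measureReal_empty]
      positivity
  have hsub : {G : SimpleGraph V | ¬ (
      1 / 8 * (Fintype.card V * (p : ℝ) / (L / Real.log (1 / p))) ≤
        (G.cliqueCoveringThickness : ℝ) ∧
      (G.cliquePartitionChromaticIndex : ℝ) ≤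
        650 / γ * (Fintype.card V * (p : ℝ) / (L / Real.log (1 / p))))} ⊆ E1 ∪ E2 ∪ E3 := by
    intro G hG
    by_contra hE
    have hE1 : G.IsCodegreeRegular p (1 / 2) 1 := by
      by_contra h; exact hE (Or.inl (Or.inl h))
    have hE2 : G ∉ E2 := fun h => hE (Or.inl (Or.inr h))
    refine hG ⟨le_cliqueCoveringThickness_of_cliqueFree ht1 hE1 hE2, ?_⟩
    by_cases hpz : 1 / z ≤ (p : ℝ)
    · have hE3 : G.IsCodegreeRegular p (1 / z ^ 25) (cliqueSize L p) := by
        by_contra h; exact hE (Or.inr ⟨hpz, h⟩)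
      refine (cliquePartitionChromaticIndex_le_of_isCodegreeRegular hn hlog hL hz hγ0 hpz hpγ
        hE3).trans (le_of_eq ?_)
      rw [hn, div_div_eq_mul_div]
    · refine (cliquePartitionChromaticIndex_le_of_sparse hnp1 hE1).trans ?_
      -- In the sparse range log_{1/p} n ≤ 100, so the 4np colours of the greedy bound are within
      -- 650 np / log_{1/p} n.
      have hℓz : L / 100 ≤ Real.log (1 / p) := by
        rw [hlog, mul_div_cancel_left₀ (Real.log z) (by norm_num : (100 : ℝ) ≠ 0)]
        refine Real.log_le_log hz0 ?_
        rw [le_div_iff₀ hp0]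
        push Not at hpz
        rw [lt_div_iff₀ hz0] at hpz
        linarith
      have hγ650 : 650 ≤ 650 / γ := by
        rw [le_div_iff₀ hγ0]; linarith
      rw [div_div_eq_mul_div]
      calc 4 * (Fintype.card V * (p : ℝ)) ≤
            650 * (Fintype.card V * (p : ℝ) * Real.log (1 / p) / L) := by
            rw [← mul_div_assoc, le_div_iff₀ (by linarith)]
            have hX : 0 ≤ Fintype.card V * (p : ℝ) := by linarith
            have h4 := mul_le_mul_of_nonneg_left hℓz hX
            have h5 := mul_nonneg hX hℓ0.le
            linarith
        _ ≤ _ := by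
            have : 0 ≤ L := by linarith
            gcongr
  calc _ ≤ (binomialRandom V p).real (E1 ∪ E2 ∪ E3) :=
        MeasureTheory.measureReal_mono hsub (MeasureTheory.measure_ne_top _ _)
    _ ≤ (binomialRandom V p).real E1 + (binomialRandom V p).real E2 +
        (binomialRandom V p).real E3 :=
        (MeasureTheory.measureReal_union_le _ _).trans
          (by gcongr; exact MeasureTheory.measureReal_union_le _ _)
    _ ≤ 1 / Fintype.card V + 1 / Fintype.card V + 1 / Fintype.card V := by gcongr
    _ = _ := by ring

end SimpleGraph

end Conclusion

/-- The constant `c` is absolute, while `C` depends only on `γ`. The binomial random graph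
`G_{n,p}` has law `SimpleGraph.binomialRandom (Fin n) (p n)`. -/
theorem mainTheorem3 :
    ∃ c : ℝ, 0 < c ∧ ∀ γ : ℝ, 0 < γ → γ < 1 → ∃ C : ℝ, 0 < C ∧
      ∀ p : ℕ → unitInterval,
        (fun n : ℕ => Real.log (n : ℝ) / (n : ℝ)) =o[atTop] (fun n : ℕ => (p n : ℝ)) →
        (∀ᶠ n : ℕ in atTop, (p n : ℝ) ≤ 1 - γ) →
        Tendsto
          (fun n : ℕ => SimpleGraph.binomialRandom (Fin n) (p n)
            {G : SimpleGraph (Fin n) |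
              c * ((n : ℝ) * (p n : ℝ) / Real.logb (1 / (p n : ℝ)) (n : ℝ))
                  ≤ (G.cliqueCoveringThickness : ℝ) ∧
              G.cliqueCoveringThickness ≤ G.cliqueCoveringChromaticIndex ∧
              G.cliqueCoveringChromaticIndex ≤ G.cliquePartitionChromaticIndex ∧
              (G.cliquePartitionChromaticIndex : ℝ)
                  ≤ C * ((n : ℝ) * (p n : ℝ) / Real.logb (1 / (p n : ℝ)) (n : ℝ))})
          atTop (𝓝 1) := by
  refine ⟨1 / 8, by norm_num, fun γ hγ0 hγ1 => ⟨650 / γ, by positivity, fun p hp hpγ => ?_⟩⟩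
  have hlim : Tendsto (fun n : ℕ => ENNReal.ofReal (1 - 3 / n)) atTop (𝓝 1) := by
    rw [← ENNReal.ofReal_one]
    refine ENNReal.tendsto_ofReal ?_
    simpa using (tendsto_const_div_atTop_nhds_zero_nat (3 : ℝ)).const_sub 1
  refine tendsto_of_tendsto_of_tendsto_of_le_of_le' hlim tendsto_const_nhds ?_
    (Eventually.of_forall fun n => MeasureTheory.prob_le_one)
  have hlog : ∀ᶠ n : ℕ in atTop, 1000 ≤ Real.log n :=
    (Real.tendsto_log_atTop.comp tendsto_natCast_atTop_atTop).eventually_ge_atTop 1000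
  -- With z = n^{1/100} and L ≥ 1000, the constant 2000 yields 1000(L + 1) ≤ 2000 L ≤ z.
  have hroot : ∀ᶠ n : ℕ in atTop, ‖Real.log n‖ ≤ 1 / 2000 * ‖(n : ℝ) ^ (1 / 100 : ℝ)‖ :=
    tendsto_natCast_atTop_atTop.eventually
      ((isLittleO_log_rpow_atTop (by norm_num : (0 : ℝ) < 1 / 100)).bound (by norm_num))
  filter_upwards [hlog, hroot, hp.bound (by norm_num : (0 : ℝ) < 1 / 384), hpγ,
    eventually_gt_atTop 0] with n hL hz hnp hpn hn0
  have hn0R : (0 : ℝ) < n := by exact_mod_cast hn0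
  have hz0 : 0 < (n : ℝ) ^ (1 / 100 : ℝ) := by positivity
  rw [Real.norm_of_nonneg (by linarith), Real.norm_of_nonneg hz0.le] at hz
  rw [Real.norm_of_nonneg (div_nonneg (by linarith) hn0R.le), Real.norm_of_nonneg (p n).2.1,
    div_le_iff₀ hn0R] at hnp
  have hpow : (n : ℝ) = ((n : ℝ) ^ (1 / 100 : ℝ)) ^ 100 := by
    rw [← Real.rpow_natCast, ← Real.rpow_mul hn0R.le]
    norm_num
  have hbad := SimpleGraph.binomialRandom_real_not_bounds_le (V := Fin n) (p := p n)
    (z := (n : ℝ) ^ (1 / 100 : ℝ)) (L := Real.log n) (γ := γ)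
    (by rw [Fintype.card_fin]; exact hpow) (by rw [Real.log_rpow hn0R]; ring) hL
    (by linarith) hγ0 hγ1 (by rw [Fintype.card_fin]; linarith) hpn
  rw [Fintype.card_fin] at hbad
  rw [← MeasureTheory.ofReal_measureReal]
  refine ENNReal.ofReal_le_ofReal ?_
  refine (sub_le_sub_left hbad 1).trans ?_
  -- The whole space lies in the union of the good and the bad event, so subadditivity bounds the
  -- good one from below without complements.
  have huniv := MeasureTheory.probReal_univ (μ := SimpleGraph.binomialRandom (Fin n) (p n))
  refine sub_le_iff_le_add.mpr (huniv.symm.le.trans ?_)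
  refine (MeasureTheory.measureReal_mono ?_ (MeasureTheory.measure_ne_top _ _)).trans
    (MeasureTheory.measureReal_union_le _ _)
  intro G _
  by_cases hG : 1 / 8 * ((n : ℝ) * (p n : ℝ) / Real.logb (1 / (p n : ℝ)) (n : ℝ))
        ≤ (G.cliqueCoveringThickness : ℝ) ∧
      (G.cliquePartitionChromaticIndex : ℝ)
        ≤ 650 / γ * ((n : ℝ) * (p n : ℝ) / Real.logb (1 / (p n : ℝ)) (n : ℝ))
  · exact Or.inl ⟨hG.1, G.cliqueCoveringThickness_le_cliqueCoveringChromaticIndex,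
      G.cliqueCoveringChromaticIndex_le_cliquePartitionChromaticIndex, hG.2⟩
  · exact Or.inr hG
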